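/- Let $G$ be a compact connected Lie group that is the product of a simply connected group and a torus, with Lie algebra $\mathfrak g$ equipped with an invariant inner product, and let $T\subset G$ be a maximal torus with Lie algebra $\mathfrak t$; use the inner product to identify $\mathfrak t\cong\mathfrak t^*$. Let $\Lambda^*\subset\mathfrak t^*$ be the weight lattice, write $t^\lambda$ for the character $T\to S^1$, $(\exp\xi)^\lambda=e^{2\pi i\langle\lambda,\xi\rangle}$, defined by $\lambda\in\Lambda^*$, fix a (closed) fundamental Weyl chamber $\mathfrak t_+$, and let $\Lambda^*_+=\Lambda^*\cap\mathfrak t_+$ be the set of dominant weights and $\rho\in\Lambda^*_+$ the half-sum of the positive roots. For $\lambda\in\Lambda^*_+$ let $V_\lambda$ be the irreducible unitary representation of $G$ with highest weight $\lambda$, let $v_\lambda\in V_\lambda$ be a highest weight vector of unit length, and let $\Delta_\lambda\in C^\infty(G)$ be the matrix element $\Delta_\lambda(g)=(v_\lambda,g\cdot v_\lambda)$, where the inner product is linear in the second argument. For $M=G$ or $M=T$ let $\mathcal E'(M)$ be the space of complex-valued distributions on $M$, that is, the topological dual of $C^\infty(M)=C^\infty(M,\mathbb C)$ with its usual topology,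 equipped with the topology defined by the seminorms $u\mapsto|\langle u,\phi\rangle|$, $\phi\in C^\infty(M)$. Let $$\mathcal E'(T)^-=\{w\in\mathcal E'(T)\mid \langle w,t^\nu\rangle=0 \text{ for all } \nu\in\Lambda^*\setminus(\rho+\Lambda^*_+)\}$$ with the subspace topology. Proposition. The map $r_G^T:\mathcal E'(G)\to\mathcal E'(T)^-$ given by $$\langle r_G^T(u),t^{\lambda+\rho}\rangle=\langle u,\Delta_\lambda\rangle\qquad(\lambda\in\Lambda^*_+)$$ is well-defined, linear and continuous: for every $u\in\mathcal E'(G)$ there is exactly one $w\in\mathcal E'(T)^-$ with $\langle w,t^{\lambda+\rho}\rangle=\langle u,\Delta_\lambda\rangle$ for all $\lambda\in\Lambda^*_+$, and $u\mapsto w$ is linear and continuous. -/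

import Mathlib

open scoped Manifold ContDiff TensorProduct InnerProductSpace

noncomputable section

namespace LieDist

/-! ### Smooth functions and distributions on a manifold -/

section SmoothFunctions

variable (E : Type*) [NormedAddCommGroup E] [NormedSpace ℝ E]
  (M : Type*) [TopologicalSpace M] [ChartedSpace E M]

/-- The smooth functions `M → ℂ` as a complex subspace of all functions. -/
def smoothSubmodule : Submodule ℂ (M → ℂ) where
  carrier := {f | ContMDiff 𝓘(ℝ, E) 𝓘(ℝ, ℂ) ∞ f}
  add_mem' hf hg := ContMDiff.add hf hg
  zero_mem' := contMDiff_const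
  smul_mem' c f hf := by
    have h : ContMDiff 𝓘(ℝ, E) 𝓘(ℝ, ℂ) ∞ fun x => (c • ContinuousLinearMap.id ℝ ℂ) (f x) :=
      (c • ContinuousLinearMap.id ℝ ℂ).contMDiff.comp hf
    exact h

/-- The space `C^∞(M)` of smooth complex-valued functions. It is a type synonym, so that it does
not inherit the topology of pointwise convergence. -/
def SmoothFn : Type _ := smoothSubmodule E M

instance : AddCommGroup (SmoothFn E M) := inferInstanceAs (AddCommGroup (smoothSubmodule E M))

instance : Module ℂ (SmoothFn E M) := inferInstanceAs (Module ℂ (smoothSubmodule E M))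

variable {E M}

instance : CoeFun (SmoothFn E M) fun _ => M → ℂ := ⟨fun f => f.1⟩

theorem SmoothFn.contMDiff (f : SmoothFn E M) : ContMDiff 𝓘(ℝ, E) 𝓘(ℝ, ℂ) ∞ (f : M → ℂ) := f.2

variable [IsManifold 𝓘(ℝ, E) ∞ M]

/-- The expression of `f` in the preferred chart at `x`. -/
def SmoothFn.local (f : SmoothFn E M) (x : M) : E → ℂ := fun y => f ((chartAt E x).symm y)

theorem SmoothFn.contDiffOn_local (f : SmoothFn E M) (x : M) :
    ContDiffOn ℝ ∞ (f.local x) (chartAt E x).target := by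
  rw [← contMDiffOn_iff_contDiffOn]
  exact f.contMDiff.comp_contMDiffOn contMDiffOn_chart_symm

theorem SmoothFn.contDiffAt_local (f : SmoothFn E M) {x : M} {y : E}
    (hy : y ∈ (chartAt E x).target) (k : ℕ) : ContDiffAt ℝ k (f.local x) y :=
  ((f.contDiffOn_local x).contDiffAt ((chartAt E x).open_target.mem_nhds hy)).of_le
    (by exact_mod_cast le_top)

theorem SmoothFn.continuousOn_iteratedFDeriv_local (f : SmoothFn E M) (x : M) (k : ℕ) :
    ContinuousOn (iteratedFDeriv ℝ k (f.local x)) (chartAt E x).target := by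
  have h := (f.contDiffOn_local x).continuousOn_iteratedFDerivWithin (m := k)
    (by exact_mod_cast le_top) (chartAt E x).open_target.uniqueDiffOn
  exact h.congr fun y hy =>
    (iteratedFDerivWithin_of_isOpen k (chartAt E x).open_target hy).symm

variable (E M) in
/-- Indices of the seminorms of `C^∞(M)`: a point, a compact subset of the image of the chart at
this point, and an order of differentiation. -/
def SeminormIndex : Type _ :=
  (Σ x : M, {K : TopologicalSpace.Compacts E // (K : Set E) ⊆ (chartAt E x).target}) × ℕ

instance [Nonempty M] : Nonempty (SeminormIndex E M) :=
  ⟨(⟨Classical.arbitrary M, ⟨⊥, by simp⟩⟩, 0)⟩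

variable (E M) in
/-- The `k`-th derivative of `f` in a chart, restricted to a compact set in the chart. -/
def derivOn (i : SeminormIndex E M) : SmoothFn E M →ₗ[ℂ] C(i.1.2.1, E [×i.2]→L[ℝ] ℂ) where
  toFun f := ⟨fun y => iteratedFDeriv ℝ i.2 (f.local i.1.1) y,
    ((f.continuousOn_iteratedFDeriv_local i.1.1 i.2).mono i.1.2.2).domRestrict⟩
  map_add' f g := by
    ext1 y
    exact iteratedFDeriv_add_apply (f.contDiffAt_local (i.1.2.2 y.2) i.2)
      (g.contDiffAt_local (i.1.2.2 y.2) i.2)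
  map_smul' c f := by
    ext1 y
    exact iteratedFDeriv_const_smul_apply (a := c) (f.contDiffAt_local (i.1.2.2 y.2) i.2)

variable (E M) in
/-- The seminorms `f ↦ sup_{y ∈ K} ‖D^k (f ∘ chart⁻¹)(y)‖`. -/
def smoothSeminorms : SeminormFamily ℂ (SmoothFn E M) (SeminormIndex E M) :=
  fun i => (normSeminorm ℂ C(i.1.2.1, E [×i.2]→L[ℝ] ℂ)).comp (derivOn E M i)

/-- The usual topology of `C^∞(M)`: locally uniform convergence of all derivatives in charts. -/
instance : TopologicalSpace (SmoothFn E M) := (smoothSeminorms E M).moduleFilterBasis.topology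

theorem withSeminorms_smoothFn : WithSeminorms (smoothSeminorms E M) := ⟨rfl⟩

variable (E M) in
/-- The space `E'(M)` of compactly supported complex distributions, i.e. the topological dual of
`C^∞(M)`, with the topology defined by the seminorms `u ↦ |⟨u, φ⟩|`, `φ ∈ C^∞(M)`. -/
abbrev Dist : Type _ := WeakDual ℂ (SmoothFn E M)

end SmoothFunctions

/-! ### Tori, weights and roots -/

section Groups

variable {E : Type*} [NormedAddCommGroup E] [NormedSpace ℝ E]
  {G : Type*} [TopologicalSpace G] [ChartedSpace E G] [Group G]
  {F : Type*} [NormedAddCommGroup F] [NormedSpace ℝ F]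
  {T : Type*} [TopologicalSpace T] [ChartedSpace F T] [CommGroup T]

variable (F T) in
/-- The Lie group `T` is a torus, that is isomorphic to `ℝ^r / ℤ^r` for some `r`. -/
def IsTorus : Prop :=
  ∃ (r : ℕ) (p : (Fin r → ℝ) → T),
    (∀ x y, p (x + y) = p x * p y) ∧ Function.Surjective p ∧
    (∀ x, p x = 1 ↔ ∃ n : Fin r → ℤ, x = fun i => (n i : ℝ)) ∧
    IsLocalDiffeomorph 𝓘(ℝ, Fin r → ℝ) 𝓘(ℝ, F) ∞ p

/-- The topological group `G` is the product of a simply connected group and a torus. -/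
def IsSimplyConnectedTimesTorus (G : Type*) [TopologicalSpace G] [Group G] : Prop :=
  ∃ (K : Subgroup G) (d : ℕ),
    SimplyConnectedSpace K ∧ Nonempty (G ≃ₜ* (K × (Fin d → Circle)))

/-- Smooth homomorphisms `T → G`. -/
abbrev LieHom (F T E G : Type*) [NormedAddCommGroup F] [NormedSpace ℝ F] [TopologicalSpace T]
    [ChartedSpace F T] [Group T] [NormedAddCommGroup E] [NormedSpace ℝ E] [TopologicalSpace G]
    [ChartedSpace E G] [Group G] : Type _ :=
  ContMDiffMonoidMorphism 𝓘(ℝ, F) 𝓘(ℝ, E) ∞ T G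

/-- `ι` embeds `T` as a maximal torus of the compact Lie group `G`: it is injective and its image
is maximal among the closed connected commutative subgroups. -/
def IsMaximalTorus (ι : LieHom F T E G) : Prop :=
  Function.Injective ι ∧
    Maximal (fun S : Subgroup G => IsClosed (S : Set G) ∧ IsConnected (S : Set G) ∧
      ∀ x ∈ S, ∀ y ∈ S, x * y = y * x) ι.toMonoidHom.range

/-- The weight lattice `Λ*` of `T`, as the set of characters `t ↦ t^λ` of `T`. -/
abbrev Weight (F T : Type*) [NormedAddCommGroup F] [NormedSpace ℝ F] [TopologicalSpace T]
    [ChartedSpace F T] [CommGroup T] : Type _ :=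
  ContMDiffMonoidMorphism 𝓘(ℝ, F) (𝓡 1) ∞ T Circle

theorem circle_coe_contMDiff : ContMDiff (𝓡 1) 𝓘(ℝ, ℂ) ∞ fun z : Circle => (z : ℂ) :=
  haveI : Fact (Module.finrank ℝ ℂ = 1 + 1) := finrank_real_complex_fact'
  contMDiff_coe_sphere

/-- The function `t ↦ t^λ` as an element of `C^∞(T)`. -/
def Weight.toSmoothFn (χ : Weight F T) : SmoothFn F T :=
  ⟨fun t => (χ t : ℂ), circle_coe_contMDiff.comp χ.contMDiff_toFun⟩

/-- The derivative at the unit, `𝔤 = T_1 G → V`, of a map `f` from `G` to a manifold modelled on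
`V`. The tangent space of the target at `f 1` is `V` by definition. -/
def derivOne (V : Type*) [NormedAddCommGroup V] [NormedSpace ℝ V] {N : Type*} [TopologicalSpace N]
    [ChartedSpace V N] (f : G → N) : GroupLieAlgebra 𝓘(ℝ, E) G →ₗ[ℝ] V where
  toFun X := mfderiv 𝓘(ℝ, E) 𝓘(ℝ, V) f 1 X
  map_add' X Y := (mfderiv 𝓘(ℝ, E) 𝓘(ℝ, V) f 1).map_add X Y
  map_smul' c X := (mfderiv 𝓘(ℝ, E) 𝓘(ℝ, V) f 1).map_smul c X

/-- The weight `λ` as a linear form on the Lie algebra `𝔱` of `T`: the derivative of `t ↦ t^λ` at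
the unit is `2πi λ`. -/
def Weight.toDual (χ : Weight F T) : Module.Dual ℝ (GroupLieAlgebra 𝓘(ℝ, F) T) :=
  (1 / (2 * Real.pi)) • (Complex.imLm ∘ₗ derivOne ℂ fun t : T => (χ t : ℂ))

/-- The inclusion `𝔱 → 𝔤`. -/
def lieIncl (ι : LieHom F T E G) :
    GroupLieAlgebra 𝓘(ℝ, F) T →ₗ[ℝ] GroupLieAlgebra 𝓘(ℝ, E) G :=
  derivOne E (ι : T → G)

variable (E) in
/-- The adjoint action of `g` on `𝔤`. -/
def Ad (g : G) : GroupLieAlgebra 𝓘(ℝ, E) G →ₗ[ℝ] GroupLieAlgebra 𝓘(ℝ, E) G :=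
  derivOne E fun h : G => g * h * g⁻¹

/-- `B` is an invariant inner product on `𝔤`. -/
structure IsInvariantInner (B : LinearMap.BilinForm ℝ (GroupLieAlgebra 𝓘(ℝ, E) G)) : Prop where
  symm : ∀ X Y, B X Y = B Y X
  pos : ∀ X, X ≠ 0 → 0 < B X X
  invariant : ∀ (g : G) (X Y), B (Ad E g X) (Ad E g Y) = B X Y

/-- The joint eigenspace in `𝔤 ⊗ ℂ` on which `T` acts by `t^α`. -/
def rootSpace (ι : LieHom F T E G) (α : Weight F T) :
    Submodule ℂ (ℂ ⊗[ℝ] GroupLieAlgebra 𝓘(ℝ, E) G) :=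
  ⨅ t : T, Module.End.eigenspace ((Ad E (ι t)).baseChange ℂ) (α t : ℂ)

/-- `α` is a root of `G`. -/
def IsRoot (ι : LieHom F T E G) (α : Weight F T) : Prop :=
  α ≠ 1 ∧ rootSpace ι α ≠ ⊥

/-- `ξ₀ ∈ 𝔱` lies on no root hyperplane. Such a `ξ₀` determines the fundamental Weyl chamber
that contains it. -/
def IsRegular (ι : LieHom F T E G) (ξ₀ : GroupLieAlgebra 𝓘(ℝ, F) T) : Prop :=
  ∀ α : Weight F T, IsRoot ι α → α.toDual ξ₀ ≠ 0

/-- The positive roots. -/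
def posRoots (ι : LieHom F T E G) (ξ₀ : GroupLieAlgebra 𝓘(ℝ, F) T) : Set (Weight F T) :=
  {α | IsRoot ι α ∧ 0 < α.toDual ξ₀}

/-- The (closed) fundamental Weyl chamber `𝔱₊` containing `ξ₀`. -/
def weylChamber (ι : LieHom F T E G) (ξ₀ : GroupLieAlgebra 𝓘(ℝ, F) T) :
    Set (GroupLieAlgebra 𝓘(ℝ, F) T) :=
  {η | ∀ α ∈ posRoots ι ξ₀, 0 ≤ α.toDual η}

/-- `λ` is a dominant weight: under the identification `𝔱 ≅ 𝔱*` given by the inner product `B`,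
it lies in the fundamental Weyl chamber. -/
def IsDominant (ι : LieHom F T E G) (B : LinearMap.BilinForm ℝ (GroupLieAlgebra 𝓘(ℝ, E) G))
    (ξ₀ : GroupLieAlgebra 𝓘(ℝ, F) T) (χ : Weight F T) : Prop :=
  ∃ η ∈ weylChamber ι ξ₀, ∀ ζ, B (lieIncl ι η) (lieIncl ι ζ) = χ.toDual ζ

/-- The half-sum of the positive roots, as a linear form on `𝔱`. -/
def rho (ι : LieHom F T E G) (ξ₀ : GroupLieAlgebra 𝓘(ℝ, F) T) :
    Module.Dual ℝ (GroupLieAlgebra 𝓘(ℝ, F) T) :=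
  (1 / 2 : ℝ) • ∑ᶠ α ∈ posRoots ι ξ₀, α.toDual

/-- The weight `ν` equals `λ + ρ`. (For the groups of `IsSimplyConnectedTimesTorus`, `ρ` is itself
a weight, so that there is exactly one such `ν` for every `λ`.) -/
def IsRhoShift (ι : LieHom F T E G) (ξ₀ : GroupLieAlgebra 𝓘(ℝ, F) T) (χ ν : Weight F T) : Prop :=
  ν.toDual = χ.toDual + rho ι ξ₀

/-! ### Highest weight representations and the functions `Δ_λ` -/

/-- An irreducible unitary representation `V_λ` of `G` with highest weight `λ`, together with a
highest weight vector `v_λ` of unit length. Every finite-dimensional `V_λ` with an invariant inner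
product is isometric to some `ℂ^n`. -/
structure HighestWeightRep (ι : LieHom F T E G) (ξ₀ : GroupLieAlgebra 𝓘(ℝ, F) T)
    (χ : Weight F T) where
  n : ℕ
  π : Representation ℂ G (EuclideanSpace ℂ (Fin n))
  smooth : ∀ w, ContMDiff 𝓘(ℝ, E) 𝓘(ℝ, EuclideanSpace ℂ (Fin n)) ∞ fun g => π g w
  unitary : ∀ g w w', ⟪π g w, π g w'⟫_ℂ = ⟪w, w'⟫_ℂ
  irreducible : π.IsIrreducible
  v : EuclideanSpace ℂ (Fin n)
  norm_v : ‖v‖ = 1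
  weight_v : ∀ t : T, π (ι t) v = (χ t : ℂ) • v
  /-- `e · v = 0` for every root vector `e ∈ 𝔤 ⊗ ℂ` of a positive root. -/
  highest : ∀ α ∈ posRoots ι ξ₀, ∀ e ∈ rootSpace ι α,
    LinearMap.liftBaseChange ℂ (derivOne (EuclideanSpace ℂ (Fin n)) fun g : G => π g v) e = 0

/-- The matrix element `g ↦ (v_λ, g · v_λ)`. -/
def HighestWeightRep.coeff {ι : LieHom F T E G} {ξ₀ : GroupLieAlgebra 𝓘(ℝ, F) T}
    {χ : Weight F T} (V : HighestWeightRep ι ξ₀ χ) : SmoothFn E G :=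
  ⟨fun g => ⟪V.v, V.π g V.v⟫_ℂ,
    ((innerSL ℂ V.v).restrictScalars ℝ).contMDiff.comp (V.smooth V.v)⟩

/-- A choice of `(V_λ, v_λ)` for every weight `λ` that admits one (by the theorem of the highest
weight, every dominant `λ` does). -/
abbrev RepChoice (ι : LieHom F T E G) (ξ₀ : GroupLieAlgebra 𝓘(ℝ, F) T) : Type _ :=
  ∀ χ : Weight F T, Nonempty (HighestWeightRep ι ξ₀ χ) → HighestWeightRep ι ξ₀ χ

open Classical in
/-- The function `Δ_λ ∈ C^∞(G)`, `Δ_λ(g) = (v_λ, g · v_λ)`. The value `0` is a convention for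
weights without a representation `V_λ`, hence never concerns a dominant `λ`. -/
def Delta {ι : LieHom F T E G} {ξ₀ : GroupLieAlgebra 𝓘(ℝ, F) T} (V : RepChoice ι ξ₀)
    (χ : Weight F T) : SmoothFn E G :=
  if h : Nonempty (HighestWeightRep ι ξ₀ χ) then (V χ h).coeff else 0

variable [IsManifold 𝓘(ℝ, F) ∞ T] [IsManifold 𝓘(ℝ, E) ∞ G]

/-- The negative Hardy space `E'(T)⁻`: distributions `u` on `T` with `⟨u, t^ν⟩ = 0` unless
`ν ∈ ρ + Λ*₊`. -/
def hardy (ι : LieHom F T E G) (B : LinearMap.BilinForm ℝ (GroupLieAlgebra 𝓘(ℝ, E) G))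
    (ξ₀ : GroupLieAlgebra 𝓘(ℝ, F) T) : Submodule ℂ (Dist F T) where
  carrier := {u | ∀ ν : Weight F T,
    (¬ ∃ χ, IsDominant ι B ξ₀ χ ∧ IsRhoShift ι ξ₀ χ ν) → u ν.toSmoothFn = 0}
  add_mem' {u w} hu hw ν hν := by
    have h : (u + w) ν.toSmoothFn = u ν.toSmoothFn + w ν.toSmoothFn := rfl
    rw [h, hu ν hν, hw ν hν, add_zero]
  zero_mem' _ _ := rfl
  smul_mem' c u hu ν hν := by
    have h : (c • u) ν.toSmoothFn = c • u ν.toSmoothFn := rfl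
    rw [h, hu ν hν, smul_zero]

/-- The relation `w = r(u)`, that is `⟨w, t^{λ+ρ}⟩ = ⟨u, Δ_λ⟩` for all dominant weights `λ`. -/
def IsRestriction {ι : LieHom F T E G} (B : LinearMap.BilinForm ℝ (GroupLieAlgebra 𝓘(ℝ, E) G))
    {ξ₀ : GroupLieAlgebra 𝓘(ℝ, F) T} (V : RepChoice ι ξ₀) (u : Dist E G)
    (w : hardy ι B ξ₀) : Prop :=
  ∀ χ ν : Weight F T, IsDominant ι B ξ₀ χ → IsRhoShift ι ξ₀ χ ν →
    (w : Dist F T) ν.toSmoothFn = u (Delta V χ)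

end Groups

end LieDist

end

open LieDist

open Filter Topology
noncomputable section
namespace LieDist

/-! ### Absolutely convergent series in `C^∞(M)` -/

section Series

variable {E : Type*} [NormedAddCommGroup E] [NormedSpace ℝ E]
  {M : Type*} [TopologicalSpace M] [ChartedSpace E M]

/-! The map is a transpose. It suffices to find a continuous linear map ψ : C^∞(T) → C^∞(G) that
sends t^{λ+ρ} to Δ_λ for dominant λ and kills the other characters; then u ∘ ψ is the required
distribution, and it depends linearly and weakly continuously on u. Take ψ(φ) = ∑ φ̂(n) D_n, where
D_n = Δ_λ if n is the coordinate vector of λ + ρ, and D_n = 0 otherwise. Fourier coefficients of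
smooth functions decay faster than every power of n, with constants that are continuous seminorms of
φ (`exists_seminorm_torusCoeff_le`). Hence the series converges and is continuous in φ as soon as
every seminorm of D_n grows polynomially in n (`exists_synthesis`). The same device with D_n = t^n
shows that Fourier series converge in C^∞(T), so that Fourier coefficients determine a distribution
(`dist_ext`); this is uniqueness.

The main point is the polynomial growth of Δ_λ, a matrix coefficient of a unitary representation π.
In a chart, Dπ = π · dπ(θ) with θ the Maurer-Cartan form, and ‖π‖ ≤ 1, so derivatives of order k are
at most C(1 + ‖dπ‖)^k with C independent of π (`exists_norm_iteratedFDeriv_hom_le`). It remains to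
bound ‖dπ‖ linearly in λ (`exists_norm_derivHom_le`). By Schur's lemma the Casimir operator ∑
dπ(b_i)² is a scalar, so ∑ ‖dπ(b_i)w‖² is the same for all unit vectors w, and only w = v_λ matters
(`HighestWeightRep.sum_norm_sq_dHom`).

On v_λ there are two cases (`growthSubmodule_eq_top`). If Z is fixed by Ad T, its one-parameter
subgroup commutes with T, hence lies in T by maximality, and Z acts on v_λ by a scalar linear in λ.
If X + iY belongs to a positive root, it kills v_λ; skew-adjointness then bounds ‖dπ(X)v_λ‖² and
‖dπ(Y)v_λ‖² by a multiple of ‖dπ([X,Y])v_λ‖, and [X,Y] is fixed by Ad T. Fourier analysis of t ↦ Ad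
t X shows that such vectors span the Lie algebra (`eq_top_of_isRotationPair`). -/

@[ext]
theorem SmoothFn.ext {f g : SmoothFn E M} (h : ∀ x, f x = g x) : f = g :=
  Subtype.ext (funext h)

@[simp]
theorem SmoothFn.add_apply (f g : SmoothFn E M) (x : M) : (f + g) x = f x + g x := rfl

@[simp]
theorem SmoothFn.smul_apply (c : ℂ) (f : SmoothFn E M) (x : M) : (c • f) x = c * f x := rfl

variable [IsManifold 𝓘(ℝ, E) ∞ M]

/-- The index of the seminorm `f ↦ sup_{y ∈ K} ‖D^k (f ∘ chart⁻¹)(y)‖`. -/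
def seminormIndex (x : M) (K : Set E) (hK : IsCompact K) (h : K ⊆ (chartAt E x).target) (k : ℕ) :
    SeminormIndex E M :=
  (⟨x, ⟨⟨K, hK⟩, h⟩⟩, k)

theorem smoothSeminorms_le_iff {i : SeminormIndex E M} {f : SmoothFn E M} {C : ℝ} (hC : 0 ≤ C) :
    smoothSeminorms E M i f ≤ C ↔
      ∀ y ∈ i.1.2.1, ‖iteratedFDeriv ℝ i.2 (f.local i.1.1) y‖ ≤ C := by
  change ‖derivOn E M i f‖ ≤ C ↔ _
  rw [ContinuousMap.norm_le _ hC]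
  exact ⟨fun h y hy => h ⟨y, hy⟩, fun h y => h y y.2⟩

theorem norm_iteratedFDeriv_local_le (i : SeminormIndex E M) (f : SmoothFn E M) {y : E}
    (hy : y ∈ i.1.2.1) :
    ‖iteratedFDeriv ℝ i.2 (f.local i.1.1) y‖ ≤ smoothSeminorms E M i f :=
  (smoothSeminorms_le_iff (apply_nonneg _ f)).1 le_rfl y hy

theorem norm_iteratedFDeriv_local_le' {x : M} {K : Set E} (hK : IsCompact K)
    (h : K ⊆ (chartAt E x).target) (k : ℕ) (f : SmoothFn E M) {y : E} (hy : y ∈ K) :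
    ‖iteratedFDeriv ℝ k (f.local x) y‖ ≤ smoothSeminorms E M (seminormIndex x K hK h k) f :=
  norm_iteratedFDeriv_local_le (seminormIndex x K hK h k) f hy

theorem norm_apply_le (f : SmoothFn E M) (x : M) :
    ‖f x‖ ≤ smoothSeminorms E M (seminormIndex x {chartAt E x x} isCompact_singleton
      (by simp) 0) f := by
  have h := norm_iteratedFDeriv_local_le' (x := x) isCompact_singleton (by simp) 0 f
    (Set.mem_singleton (chartAt E x x))
  rwa [norm_iteratedFDeriv_zero, SmoothFn.local, (chartAt E x).left_inv (mem_chart_source E x)]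
    at h

/-- The seminorms only see compact subsets of a chart, whereas termwise differentiation of a series
on `E` asks for bounds on all of `E`. A cut-off makes the local expression global, and the Leibniz
rule keeps its derivatives under control. -/
theorem exists_norm_iteratedFDeriv_bump_le [FiniteDimensional ℝ E] {x : M} {y₀ : E}
    (b : ContDiffBump y₀) (hb : Metric.closedBall y₀ b.rOut ⊆ (chartAt E x).target) (k : ℕ) :
    ∃ C : ℝ, ∀ (f : SmoothFn E M) (y : E),
      ‖iteratedFDeriv ℝ k (fun y => b y • f.local x y) y‖ ≤
        C * ∑ j ∈ Finset.range (k + 1), smoothSeminorms E M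
          (seminormIndex x _ (isCompact_closedBall y₀ b.rOut) hb j) f := by
  have hbd : ∀ i : ℕ, ∃ A : ℝ, ∀ y, ‖iteratedFDeriv ℝ i b y‖ ≤ A := fun i =>
    ((b.contDiff (n := ⊤)).continuous_iteratedFDeriv
      (by exact_mod_cast le_top)).bounded_above_of_compact_support
      (b.hasCompactSupport.iteratedFDeriv i)
  choose A hA using hbd
  have hA0 : ∀ i, 0 ≤ A i := fun i => (norm_nonneg _).trans (hA i y₀)
  refine ⟨∑ i ∈ Finset.range (k + 1), (k.choose i) * A i, fun f y => ?_⟩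
  have hS : ∀ j, 0 ≤ smoothSeminorms E M
      (seminormIndex x _ (isCompact_closedBall y₀ b.rOut) hb j) f := fun j => apply_nonneg _ _
  by_cases hy : y ∈ Metric.closedBall y₀ b.rOut
  · have ht := (chartAt E x).open_target
    rw [← iteratedFDerivWithin_of_isOpen k ht (hb hy)]
    refine (norm_iteratedFDerivWithin_smul_le (N := ∞)
      (b.contDiff (n := ⊤)).contDiffOn (f.contDiffOn_local x) ht.uniqueDiffOn (hb hy)
      (by exact_mod_cast le_top)).trans ?_
    rw [Finset.sum_mul]
    refine Finset.sum_le_sum fun i hi => ?_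
    rw [iteratedFDerivWithin_of_isOpen _ ht (hb hy), iteratedFDerivWithin_of_isOpen _ ht (hb hy)]
    refine mul_le_mul (mul_le_mul_of_nonneg_left (hA i y) (Nat.cast_nonneg _)) ?_
      (norm_nonneg _) (mul_nonneg (Nat.cast_nonneg _) (hA0 i))
    refine (norm_iteratedFDeriv_local_le' (isCompact_closedBall y₀ b.rOut) hb (k - i) f hy).trans ?_
    exact Finset.single_le_sum (f := fun j => smoothSeminorms E M
      (seminormIndex x _ (isCompact_closedBall y₀ b.rOut) hb j) f) (fun j _ => hS j)
      (Finset.mem_range.2 (by omega))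
  · have h0 : (fun y => b y • f.local x y) =ᶠ[𝓝 y] fun _ => 0 := by
      rw [← b.tsupport_eq] at hy
      filter_upwards [notMem_tsupport_iff_eventuallyEq.1 hy] with z hz
      simp [hz]
    rw [(h0.iteratedFDeriv ℝ k).eq_of_nhds]
    rw [show iteratedFDeriv ℝ k (fun _ : E => (0 : ℂ)) y = 0 from by simp, norm_zero]
    exact mul_nonneg (Finset.sum_nonneg fun i _ => mul_nonneg (Nat.cast_nonneg _) (hA0 i))
      (Finset.sum_nonneg fun j _ => hS j)

theorem contDiff_bump_smul_local [FiniteDimensional ℝ E] {x : M} {y₀ : E}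
    (b : ContDiffBump y₀) (hb : Metric.closedBall y₀ b.rOut ⊆ (chartAt E x).target)
    (f : SmoothFn E M) : ContDiff ℝ ∞ fun y => b y • f.local x y := by
  rw [contDiff_iff_contDiffAt]
  intro y
  by_cases hy : y ∈ Metric.closedBall y₀ b.rOut
  · exact (b.contDiff (n := ⊤)).contDiffAt.smul
      ((f.contDiffOn_local x).contDiffAt ((chartAt E x).open_target.mem_nhds (hb hy)))
  · have h0 : (fun y => b y • f.local x y) =ᶠ[𝓝 y] fun _ => 0 := by
      rw [← b.tsupport_eq] at hy
      filter_upwards [notMem_tsupport_iff_eventuallyEq.1 hy] with z hz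
      simp [hz]
    exact contDiffAt_const.congr_of_eventuallyEq h0

variable {ι : Type*} {f : ι → SmoothFn E M}

/-- The bump function equals 1 near `y₀`, so the series and its cut-off version have the same germ
there, and the global theorem on termwise differentiation applies to the latter. -/
theorem local_tsum [FiniteDimensional ℝ E] (hf : ∀ i, Summable fun n => smoothSeminorms E M i (f n))
    {x : M} {y₀ : E} (hy₀ : y₀ ∈ (chartAt E x).target) :
    ContDiffAt ℝ ∞ (fun y => ∑' n, (f n).local x y) y₀ ∧
      ∀ k : ℕ, iteratedFDeriv ℝ k (fun y => ∑' n, (f n).local x y) y₀ =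
        ∑' n, iteratedFDeriv ℝ k ((f n).local x) y₀ := by
  obtain ⟨r, hr, hrt⟩ := Metric.nhds_basis_closedBall.mem_iff.1
    ((chartAt E x).open_target.mem_nhds hy₀)
  let b : ContDiffBump y₀ := ⟨r / 2, r, half_pos hr, half_lt_self hr⟩
  have hb : Metric.closedBall y₀ b.rOut ⊆ (chartAt E x).target := hrt
  choose C hC using exists_norm_iteratedFDeriv_bump_le b hb
  have hsm := fun n => contDiff_bump_smul_local b hb (f n)
  have hv : ∀ k : ℕ, (k : ℕ∞) ≤ ⊤ → Summable fun n => C k *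
      ∑ j ∈ Finset.range (k + 1), smoothSeminorms E M
        (seminormIndex x _ (isCompact_closedBall y₀ b.rOut) hb j) (f n) := fun k _ =>
    (summable_sum fun j _ => hf _).mul_left _
  have heq : (fun y => ∑' n, (f n).local x y) =ᶠ[𝓝 y₀] fun y => ∑' n, b y • (f n).local x y := by
    filter_upwards [b.eventuallyEq_one] with y hy
    simp [hy]
  have heqn : ∀ n, (fun y => b y • (f n).local x y) =ᶠ[𝓝 y₀] (f n).local x := fun n => by
    filter_upwards [b.eventuallyEq_one] with y hy
    simp [hy]
  constructor
  · exact (contDiff_tsum (N := ⊤) hsm hv fun k n y _ => hC k (f n) y).contDiffAt.congr_of_eventuallyEq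
      heq
  · intro k
    rw [(heq.iteratedFDeriv ℝ k).eq_of_nhds, iteratedFDeriv_tsum_apply (N := ⊤) hsm hv
      (fun k n y _ => hC k (f n) y) le_top]
    exact tsum_congr fun n => ((heqn n).iteratedFDeriv ℝ k).eq_of_nhds

theorem contMDiff_tsum [FiniteDimensional ℝ E]
    (hf : ∀ i, Summable fun n => smoothSeminorms E M i (f n)) :
    ContMDiff 𝓘(ℝ, E) 𝓘(ℝ, ℂ) ∞ fun x => ∑' n, f n x := by
  intro x
  have h := (local_tsum hf (mem_chart_target E x)).1
  have h2 : ContMDiffAt 𝓘(ℝ, E) 𝓘(ℝ, ℂ) ∞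
      ((fun y => ∑' n, (f n).local x y) ∘ chartAt E x) x :=
    h.contMDiffAt.comp x (contMDiffAt_of_mem_maximalAtlas
      (IsManifold.chart_mem_maximalAtlas x) (mem_chart_source E x))
  refine h2.congr_of_eventuallyEq ?_
  filter_upwards [(chartAt E x).open_source.mem_nhds (mem_chart_source E x)] with z hz
  refine tsum_congr fun n => ?_
  rw [SmoothFn.local, (chartAt E x).left_inv hz]

/-- The pointwise sum of an absolutely convergent series in `C^∞(M)`. -/
def tsumSmooth [FiniteDimensional ℝ E] (hf : ∀ i, Summable fun n => smoothSeminorms E M i (f n)) :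
    SmoothFn E M :=
  ⟨fun x => ∑' n, f n x, contMDiff_tsum hf⟩

theorem tsumSmooth_apply [FiniteDimensional ℝ E]
    (hf : ∀ i, Summable fun n => smoothSeminorms E M i (f n)) (x : M) :
    tsumSmooth hf x = ∑' n, f n x := rfl

theorem smoothSeminorms_apply (i : SeminormIndex E M) (f : SmoothFn E M) :
    smoothSeminorms E M i f = ‖derivOn E M i f‖ := rfl

/-- The series converges absolutely in a Banach space of continuous functions on a compact set;
`local_tsum` identifies its limit point by point. -/
theorem hasSum_derivOn_tsumSmooth [FiniteDimensional ℝ E]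
    (hf : ∀ i, Summable fun n => smoothSeminorms E M i (f n)) (i : SeminormIndex E M) :
    HasSum (fun n => derivOn E M i (f n)) (derivOn E M i (tsumSmooth hf)) := by
  have hs : Summable fun n => derivOn E M i (f n) :=
    Summable.of_norm (f := fun n => derivOn E M i (f n)) (hf i)
  have he : ∑' n, derivOn E M i (f n) = derivOn E M i (tsumSmooth hf) := by
    refine ContinuousMap.ext fun y => (ContinuousMap.tsum_apply hs y).symm.trans ?_
    exact ((local_tsum hf (i.1.2.2 y.2)).2 i.2).symm
  rw [← he]
  exact hs.hasSum

theorem eventually_norm_sum_sub_lt {X V : Type*} [TopologicalSpace X] [CompactSpace X]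
    [NormedAddCommGroup V] {g : ι → C(X, V)} {a : C(X, V)} (h : HasSum g a) {ε : ℝ} (hε : 0 < ε) :
    ∀ᶠ s in (SummationFilter.unconditional ι).filter, ‖∑ n ∈ s, g n - a‖ < ε :=
  (tendsto_iff_norm_sub_tendsto_zero.1 h).eventually_lt_const hε

theorem hasSum_tsumSmooth [FiniteDimensional ℝ E]
    (hf : ∀ i, Summable fun n => smoothSeminorms E M i (f n)) : HasSum f (tsumSmooth hf) := by
  rw [HasSum, withSeminorms_smoothFn.tendsto_nhds]
  intro i ε hε
  have h := eventually_norm_sum_sub_lt (hasSum_derivOn_tsumSmooth hf i) hε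
  filter_upwards [h] with s hs
  rwa [smoothSeminorms_apply, map_sub, map_sum]

theorem smoothSeminorms_tsumSmooth_le [FiniteDimensional ℝ E]
    (hf : ∀ i, Summable fun n => smoothSeminorms E M i (f n)) (i : SeminormIndex E M) :
    smoothSeminorms E M i (tsumSmooth hf) ≤ ∑' n, smoothSeminorms E M i (f n) := by
  rw [smoothSeminorms_apply, ← (hasSum_derivOn_tsumSmooth hf i).tsum_eq]
  exact norm_tsum_le_tsum_norm (f := fun n => derivOn E M i (f n)) (hf i)

end Series

/-! ### Fourier series on the standard torus -/

section StandardTorus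

open MeasureTheory UnitAddTorus

local instance : MeasureSpace UnitAddCircle := ⟨AddCircle.haarAddCircle⟩

local instance : Measure.IsAddHaarMeasure (volume : Measure UnitAddCircle) :=
  inferInstanceAs (Measure.IsAddHaarMeasure AddCircle.haarAddCircle)

local instance : IsProbabilityMeasure (volume : Measure UnitAddCircle) :=
  inferInstanceAs (IsProbabilityMeasure AddCircle.haarAddCircle)

variable {r : ℕ}

/-- The projection `ℝ^r → ℝ^r / ℤ^r`. -/
def torusProj (x : Fin r → ℝ) : UnitAddTorus (Fin r) := fun i => (x i : UnitAddCircle)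

theorem isOpenQuotientMap_torusProj : IsOpenQuotientMap (torusProj (r := r)) :=
  IsOpenQuotientMap.piMap fun _ => QuotientAddGroup.isOpenQuotientMap_mk

theorem surjective_torusProj : Function.Surjective (torusProj (r := r)) :=
  isOpenQuotientMap_torusProj.surjective

theorem torusProj_add (x y : Fin r → ℝ) : torusProj (x + y) = torusProj x + torusProj y := rfl

theorem torusProj_eq_iff {x y : Fin r → ℝ} :
    torusProj x = torusProj y ↔ ∃ n : Fin r → ℤ, x = y + fun i => (n i : ℝ) := by
  constructor
  · intro h
    have h1 : ∀ i, ∃ n : ℤ, x i = y i + n := fun i => by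
      have h2 : ((x i : ℝ) : UnitAddCircle) = (y i : ℝ) := congrFun h i
      rw [← sub_eq_zero, ← AddCircle.coe_sub, AddCircle.coe_eq_zero_iff] at h2
      obtain ⟨n, hn⟩ := h2
      rw [zsmul_one] at hn
      exact ⟨n, by linarith⟩
    choose n hn using h1
    exact ⟨n, funext hn⟩
  · rintro ⟨n, rfl⟩
    funext i
    simp [torusProj]

theorem mFourier_torusProj (n : Fin r → ℤ) (x : Fin r → ℝ) :
    mFourier n (torusProj x) = Complex.exp (2 * Real.pi * Complex.I * ∑ i, n i * x i) := by
  simp only [mFourier, torusProj, ContinuousMap.coe_mk, fourier_coe_apply]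
  rw [← Complex.exp_sum, Complex.ofReal_sum, Finset.mul_sum]
  congr 1
  refine Finset.sum_congr rfl fun i _ => ?_
  push_cast
  ring

theorem mFourier_add_apply (n : Fin r → ℤ) (s t : UnitAddTorus (Fin r)) :
    mFourier n (s + t) = mFourier n s * mFourier n t := by
  simp only [mFourier, ContinuousMap.coe_mk, Pi.add_apply, ← Finset.prod_mul_distrib]
  refine Finset.prod_congr rfl fun i _ => ?_
  simp [fourier_apply, smul_add, AddCircle.toCircle_add]

theorem mFourier_neg_mul_self (n : Fin r → ℤ) (s : UnitAddTorus (Fin r)) :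
    mFourier (-n) s * mFourier n s = 1 := by
  rw [← mFourier_add, neg_add_cancel, mFourier_zero]; rfl

theorem norm_mFourier_apply (n : Fin r → ℤ) (s : UnitAddTorus (Fin r)) : ‖mFourier n s‖ = 1 := by
  simp only [mFourier, fourier_apply, ContinuousMap.coe_mk, norm_prod, Circle.norm_coe,
    Finset.prod_const_one]

theorem integrable_of_continuous {V : Type*} [NormedAddCommGroup V]
    {f : UnitAddTorus (Fin r) → V} (hf : Continuous f) : Integrable f :=
  hf.integrable_of_hasCompactSupport (HasCompactSupport.of_compactSpace f)

/-- Invariance of Haar measure. The identity serves to classify characters, to compute the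
coefficients of a partial derivative, and to split the adjoint action of the torus. -/
theorem mFourierCoeff_translate (f : UnitAddTorus (Fin r) → ℂ) (n : Fin r → ℤ)
    (s : UnitAddTorus (Fin r)) :
    mFourierCoeff (fun t => f (s + t)) n = mFourier n s * mFourierCoeff f n := by
  rw [mFourierCoeff, mFourierCoeff,
    ← integral_add_left_eq_self (fun t => mFourier (-n) t • f t) s, ← integral_const_mul]
  congr 1
  funext t
  rw [mFourier_add_apply, smul_eq_mul, smul_eq_mul, ← mul_assoc, ← mul_assoc,
    mul_comm (mFourier n s), mFourier_neg_mul_self, one_mul]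

theorem norm_mFourierCoeff_le {f : UnitAddTorus (Fin r) → ℂ} {C : ℝ} (h : ∀ t, ‖f t‖ ≤ C)
    (n : Fin r → ℤ) : ‖mFourierCoeff f n‖ ≤ C := by
  have h1 := norm_integral_le_of_norm_le_const (μ := volume)
    (f := fun t => mFourier (-n) t • f t) (C := C)
    (Eventually.of_forall fun t => by rw [norm_smul, norm_mFourier_apply, one_mul]; exact h t)
  simpa [mFourierCoeff] using h1

theorem mFourierCoeff_mFourier (m n : Fin r → ℤ) :
    mFourierCoeff (mFourier m) n = if n = m then 1 else 0 := by
  rw [← mFourierCoeff_toLp, ← mFourierBasis_repr, HilbertBasis.repr_apply_apply]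
  rw [coe_mFourierBasis]
  exact orthonormal_iff_ite.1 (orthonormal_mFourier (d := Fin r)) n m

theorem mFourierCoeff_add {f g : UnitAddTorus (Fin r) → ℂ} (hf : Continuous f)
    (hg : Continuous g) (n : Fin r → ℤ) :
    mFourierCoeff (fun t => f t + g t) n = mFourierCoeff f n + mFourierCoeff g n := by
  simp only [mFourierCoeff, smul_eq_mul, mul_add]
  exact integral_add (integrable_of_continuous (by fun_prop))
    (integrable_of_continuous (by fun_prop))

theorem mFourierCoeff_const_mul (c : ℂ) (f : UnitAddTorus (Fin r) → ℂ) (n : Fin r → ℤ) :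
    mFourierCoeff (fun t => c * f t) n = c * mFourierCoeff f n := by
  simp only [mFourierCoeff, smul_eq_mul]
  rw [← integral_const_mul]
  congr 1
  funext t
  ring

/-- A continuous function all of whose Fourier coefficients vanish is zero. -/
theorem eq_zero_of_mFourierCoeff {f : UnitAddTorus (Fin r) → ℂ} (hf : Continuous f)
    (h : ∀ n, mFourierCoeff f n = 0) (t : UnitAddTorus (Fin r)) : f t = 0 := by
  have h1 : mFourierCoeff (⟨f, hf⟩ : C(UnitAddTorus (Fin r), ℂ)) = 0 := funext h
  -- Vanishing coefficients are summable, so the Fourier series converges pointwise to `f`.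
  have h2 := hasSum_mFourier_series_apply_of_summable (f := ⟨f, hf⟩)
    (by rw [h1]; exact summable_zero) t
  rw [h1] at h2
  simpa using h2.unique (by simp)

/-- A continuous unitary character of `ℝ^r / ℤ^r` is one of the `mFourier n`. -/
theorem exists_eq_mFourier {f : UnitAddTorus (Fin r) → ℂ} (hf : Continuous f) (h0 : f 0 ≠ 0)
    (hadd : ∀ s t, f (s + t) = f s * f t) : ∃ n : Fin r → ℤ, ∀ t, f t = mFourier n t := by
  have h1 : ∃ n, mFourierCoeff f n ≠ 0 := by
    by_contra! h
    exact h0 (eq_zero_of_mFourierCoeff hf h 0)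
  obtain ⟨n, hn⟩ := h1
  -- The `n`-th coefficient of the translate of `f` by `s` is its `n`-th coefficient times `mFourier
  -- n s`, and also times `f s` by multiplicativity. The coefficient is nonzero and cancels.
  refine ⟨n, fun s => mul_right_cancel₀ hn ?_⟩
  rw [← mFourierCoeff_translate, ← mFourierCoeff_const_mul]
  simp only [hadd]

/-- Comparison with the sum of inverse powers of the norm over a lattice; the exponent `r + 1`
exceeds the rank. -/
theorem summable_one_add_norm_inv_pow :
    Summable fun n : Fin r → ℤ => ((1 + ‖n‖) ^ (r + 1))⁻¹ := by
  let b := Pi.basisFun ℝ (Fin r)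
  let L := Submodule.span ℤ (Set.range b)
  have hmem : ∀ n : Fin r → ℤ, (fun i => (n i : ℝ)) ∈ L := fun n => by
    have : (fun i => (n i : ℝ)) = ∑ i, n i • b i := by
      funext j
      simp [b, Finset.sum_apply, Pi.single_apply]
    rw [this]
    exact Submodule.sum_mem _ fun i _ => Submodule.smul_mem _ _ (Submodule.subset_span ⟨i, rfl⟩)
  have h1 := ZLattice.summable_norm_sub_inv_pow L (r + 1)
    (by rw [ZLattice.rank ℝ L]; simp) 0
  let e : (Fin r → ℤ) → L := fun n => ⟨_, hmem n⟩
  have he : Function.Injective e := fun m n h => by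
    funext i
    have h3 : (m i : ℝ) = n i := congrFun (congrArg Subtype.val h) i
    exact_mod_cast h3
  have h2 := h1.comp_injective he
  have hnorm : ∀ n : Fin r → ℤ, ‖(fun i => (n i : ℝ))‖ = ‖n‖ := fun n => by
    simp only [Pi.norm_def]
    congr 2
  refine Summable.of_norm_bounded_eventually h2 ?_
  -- The origin must be left out: the majorant has the value 0 there.
  have : {n : Fin r → ℤ | n = 0}.Finite := by simp
  filter_upwards [this.compl_mem_cofinite] with n hn
  have hpos : 0 < ‖n‖ := norm_pos_iff.2 hn
  simp only [Function.comp, sub_zero, e, hnorm]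
  rw [Real.norm_of_nonneg (by positivity), inv_pow]
  gcongr
  linarith

end StandardTorus

/-! ### Decay of the Fourier coefficients of smooth periodic functions -/

section Decay

open MeasureTheory UnitAddTorus

local instance : MeasureSpace UnitAddCircle := ⟨AddCircle.haarAddCircle⟩

local instance : Measure.IsAddHaarMeasure (volume : Measure UnitAddCircle) :=
  inferInstanceAs (Measure.IsAddHaarMeasure AddCircle.haarAddCircle)

local instance : IsProbabilityMeasure (volume : Measure UnitAddCircle) :=
  inferInstanceAs (IsProbabilityMeasure AddCircle.haarAddCircle)

variable {r : ℕ}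

/-- A right inverse of the projection `ℝ^r → ℝ^r / ℤ^r`. -/
def torusLift : UnitAddTorus (Fin r) → (Fin r → ℝ) := Function.surjInv surjective_torusProj

theorem torusProj_torusLift (t : UnitAddTorus (Fin r)) : torusProj (torusLift t) = t :=
  Function.surjInv_eq surjective_torusProj t

theorem exists_torusLift_torusProj (x : Fin r → ℝ) :
    ∃ n : Fin r → ℤ, torusLift (torusProj x) = x + fun i => (n i : ℝ) :=
  torusProj_eq_iff.1 (torusProj_torusLift _)

theorem exists_mem_Icc_torusProj_eq (t : UnitAddTorus (Fin r)) :
    ∃ x ∈ Set.Icc (0 : Fin r → ℝ) 1, torusProj x = t := by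
  refine ⟨fun i => Int.fract (torusLift t i), ⟨fun i => Int.fract_nonneg _,
    fun i => (Int.fract_lt_one _).le⟩, ?_⟩
  conv_rhs => rw [← torusProj_torusLift t]
  exact torusProj_eq_iff.2 ⟨fun i => -⌊torusLift t i⌋, by
    funext i
    simp [Int.fract, sub_eq_add_neg]⟩

/-- The function `f` on `ℝ^r` is invariant under `ℤ^r`. -/
def IsPeriodic {V : Type*} (f : (Fin r → ℝ) → V) : Prop :=
  ∀ x (n : Fin r → ℤ), f (x + fun i => (n i : ℝ)) = f x

theorem IsPeriodic.torusLift_torusProj {V : Type*} {f : (Fin r → ℝ) → V} (hf : IsPeriodic f)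
    (x : Fin r → ℝ) : f (torusLift (torusProj x)) = f x := by
  obtain ⟨n, hn⟩ := exists_torusLift_torusProj x
  rw [hn, hf]

/-- `torusLift` is an arbitrary section, with no continuity of its own. A periodic function does not
see the choice, so continuity descends through the quotient map. -/
theorem IsPeriodic.continuous_comp_torusLift {V : Type*} [TopologicalSpace V]
    {f : (Fin r → ℝ) → V} (hf : IsPeriodic f) (hc : Continuous f) :
    Continuous fun t => f (torusLift t) := by
  rw [isOpenQuotientMap_torusProj.isQuotientMap.continuous_iff]
  exact hc.congr fun x => (hf.torusLift_torusProj x).symm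

/-- The `j`-th partial derivative. -/
def partialDeriv (j : Fin r) (f : (Fin r → ℝ) → ℂ) : (Fin r → ℝ) → ℂ :=
  fun x => fderiv ℝ f x (Pi.single j 1)

theorem contDiff_partialDeriv (j : Fin r) {f : (Fin r → ℝ) → ℂ} (hf : ContDiff ℝ ∞ f) :
    ContDiff ℝ ∞ (partialDeriv j f) :=
  (hf.fderiv_right (m := ∞) (by exact_mod_cast le_top)).clm_apply contDiff_const

theorem IsPeriodic.partialDeriv (j : Fin r) {f : (Fin r → ℝ) → ℂ} (hf : IsPeriodic f) :
    IsPeriodic (partialDeriv j f) := fun x n => by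
  have h : (fun y => f (y + fun i => (n i : ℝ))) = f := funext fun y => hf y n
  rw [LieDist.partialDeriv, ← fderiv_comp_add_right, h, LieDist.partialDeriv]

theorem norm_iteratedFDeriv_partialDeriv_le (j : Fin r) {f : (Fin r → ℝ) → ℂ}
    (hf : ContDiff ℝ ∞ f) (k : ℕ) (x : Fin r → ℝ) :
    ‖iteratedFDeriv ℝ k (LieDist.partialDeriv j f) x‖ ≤ ‖iteratedFDeriv ℝ (k + 1) f x‖ := by
  have h := norm_iteratedFDeriv_clm_apply_const (𝕜 := ℝ) (f := fderiv ℝ f)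
    (c := (Pi.single j 1 : Fin r → ℝ)) (x := x) (N := ∞) (n := k)
    ((hf.fderiv_right (m := ∞) (by exact_mod_cast le_top)).contDiffAt) (by exact_mod_cast le_top)
  rw [norm_iteratedFDeriv_fderiv] at h
  refine h.trans (mul_le_of_le_one_left (norm_nonneg _) ?_)
  rw [Pi.norm_single, norm_one]

theorem norm_iterate_partialDeriv_le (j : Fin r) (k : ℕ) {f : (Fin r → ℝ) → ℂ}
    (hf : ContDiff ℝ ∞ f) (x : Fin r → ℝ) :
    ‖(LieDist.partialDeriv j)^[k] f x‖ ≤ ‖iteratedFDeriv ℝ k f x‖ := by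
  -- The induction replaces `f` by a partial derivative, so it needs the bound for derivatives of
  -- every order `m`.
  suffices h : ∀ m, ‖iteratedFDeriv ℝ m ((LieDist.partialDeriv j)^[k] f) x‖ ≤
      ‖iteratedFDeriv ℝ (m + k) f x‖ by
    have h0 := h 0
    rwa [norm_iteratedFDeriv_zero, zero_add] at h0
  induction k generalizing f with
  | zero => simp
  | succ k ih =>
    intro m
    rw [Function.iterate_succ_apply]
    exact (ih (contDiff_partialDeriv j hf) m).trans
      (norm_iteratedFDeriv_partialDeriv_le j hf (m + k) x)

/-- The Fourier coefficient of a periodic function on `ℝ^r`. -/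
def periodicCoeff (f : (Fin r → ℝ) → ℂ) (n : Fin r → ℤ) : ℂ :=
  mFourierCoeff (fun t => f (torusLift t)) n

/-- Translate `f` by `h` in the `j`-th direction and differentiate its coefficient at `h = 0` in two
ways: under the integral sign, and through the factor exp(2πi n_j h) from `mFourierCoeff_translate`.
This takes the place of an integration by parts. -/
theorem periodicCoeff_partialDeriv (j : Fin r) {f : (Fin r → ℝ) → ℂ} (hf : ContDiff ℝ ∞ f)
    (hper : IsPeriodic f) (n : Fin r → ℤ) :
    periodicCoeff (partialDeriv j f) n = 2 * Real.pi * Complex.I * n j * periodicCoeff f n := by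
  set e : Fin r → ℝ := Pi.single j 1
  have hcf := hper.continuous_comp_torusLift hf.continuous
  have hcd := (hper.partialDeriv j).continuous_comp_torusLift
    (contDiff_partialDeriv j hf).continuous
  obtain ⟨C, hC⟩ : ∃ C, ∀ t, ‖partialDeriv j f (torusLift t)‖ ≤ C := by
    obtain ⟨C, hC⟩ := isCompact_univ.exists_bound_of_continuousOn hcd.continuousOn
    exact ⟨C, fun t => hC t trivial⟩
  have hF : ∀ (g : (Fin r → ℝ) → ℂ), IsPeriodic g → ∀ (h : ℝ) (x : Fin r → ℝ),
      g (torusLift (torusProj (h • e) + torusProj x)) = g (x + h • e) := fun g hg h x => by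
    rw [← torusProj_add, hg.torusLift_torusProj, add_comm]
  have hder := (hasDerivAt_integral_of_dominated_loc_of_deriv_le (μ := volume)
    (F := fun (h : ℝ) t => mFourier (-n) t * f (torusLift (torusProj (h • e) + t)))
    (F' := fun (h : ℝ) t => mFourier (-n) t * partialDeriv j f (torusLift (torusProj (h • e) + t)))
    (x₀ := 0) (s := Set.univ) (bound := fun _ => C) univ_mem
    (Eventually.of_forall fun h => (Continuous.mul (map_continuous _)
      (hcf.comp (continuous_const_add _))).aestronglyMeasurable)
    (integrable_of_continuous (Continuous.mul (map_continuous _)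
      (hcf.comp (continuous_const_add _))))
    (Continuous.mul (map_continuous _)
      (hcd.comp (continuous_const_add _))).aestronglyMeasurable
    (Eventually.of_forall fun t h _ => by
      rw [norm_mul, norm_mFourier_apply, one_mul]; exact hC _)
    (integrable_of_continuous continuous_const)
    (Eventually.of_forall fun t h _ => by
      obtain ⟨x, rfl⟩ := surjective_torusProj t
      simp only [hF f hper, hF _ (hper.partialDeriv j)]
      refine HasDerivAt.const_mul _ ?_
      have h1 : HasDerivAt (fun h : ℝ => x + h • e) e h := by
        simpa using ((hasDerivAt_id h).smul_const e).const_add x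
      exact ((hf.differentiable (by simp)) (x + h • e)).hasFDerivAt.comp_hasDerivAt h h1)).2
  have hl : ∀ h : ℝ, ∫ t, mFourier (-n) t * f (torusLift (torusProj (h • e) + t)) =
      Complex.exp (2 * Real.pi * Complex.I * (n j * h)) * periodicCoeff f n := fun h => by
    have h1 := mFourierCoeff_translate (fun t => f (torusLift t)) n (torusProj (h • e))
    rw [mFourier_torusProj] at h1
    have h2 : ∑ i, (n i : ℝ) * (h • e) i = n j * h := by
      rw [Finset.sum_eq_single j]
      · simp [e]
      · intro i _ hij
        simp [e, hij]
      · simp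
    rw [h2] at h1
    simpa [mFourierCoeff, periodicCoeff] using h1
  simp only [hl] at hder
  have hder2 : HasDerivAt (fun h : ℝ => Complex.exp (2 * Real.pi * Complex.I * (n j * h)) *
      periodicCoeff f n) (2 * Real.pi * Complex.I * n j * periodicCoeff f n) 0 := by
    have h1 : HasDerivAt (fun h : ℝ => (2 * Real.pi * Complex.I * (n j * (h : ℂ))))
        (2 * Real.pi * Complex.I * n j) 0 := by
      have := ((Complex.ofRealCLM.hasDerivAt (x := (0 : ℝ))).const_mul (n j : ℂ)).const_mul
        (2 * Real.pi * Complex.I)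
      simpa using this
    simpa using h1.cexp.mul_const (periodicCoeff f n)
  rw [hder2.unique hder]
  have h0 : torusProj (0 : Fin r → ℝ) = 0 := by
    funext i
    simp [torusProj]
  simp [periodicCoeff, mFourierCoeff, h0]

theorem periodicCoeff_iterate_partialDeriv (j : Fin r) (k : ℕ) {f : (Fin r → ℝ) → ℂ}
    (hf : ContDiff ℝ ∞ f) (hper : IsPeriodic f) (n : Fin r → ℤ) :
    periodicCoeff ((partialDeriv j)^[k] f) n =
      (2 * Real.pi * Complex.I * n j) ^ k * periodicCoeff f n := by
  induction k generalizing f with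
  | zero => simp
  | succ k ih =>
    rw [Function.iterate_succ_apply, ih (contDiff_partialDeriv j hf) (hper.partialDeriv j),
      periodicCoeff_partialDeriv j hf hper]
    ring

theorem iterate_partialDeriv_periodic (j : Fin r) (k : ℕ) {f : (Fin r → ℝ) → ℂ}
    (hper : IsPeriodic f) : IsPeriodic ((partialDeriv j)^[k] f) := by
  induction k generalizing f with
  | zero => exact hper
  | succ k ih => exact ih (hper.partialDeriv j)

theorem norm_periodicCoeff_le {f : (Fin r → ℝ) → ℂ} (hper : IsPeriodic f) {C : ℝ}
    (h : ∀ x ∈ Set.Icc (0 : Fin r → ℝ) 1, ‖f x‖ ≤ C) (n : Fin r → ℤ) :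
    ‖periodicCoeff f n‖ ≤ C := by
  refine norm_mFourierCoeff_le (fun t => ?_) n
  obtain ⟨x, hx, rfl⟩ := exists_mem_Icc_torusProj_eq t
  rw [hper.torusLift_torusProj]
  exact h x hx

/-- For ‖n‖ > 1, differentiate `k` times along a coordinate where |n_j| = ‖n‖; for ‖n‖ ≤ 1 the bound
on `f` itself is enough. The factor 2^k comes from 1 + ‖n‖ ≤ 2 max(1, ‖n‖). -/
theorem norm_periodicCoeff_mul_le (k : ℕ) {f : (Fin r → ℝ) → ℂ} (hf : ContDiff ℝ ∞ f)
    (hper : IsPeriodic f) {C₀ C : ℝ} (h₀ : ∀ x ∈ Set.Icc (0 : Fin r → ℝ) 1, ‖f x‖ ≤ C₀)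
    (h : ∀ x ∈ Set.Icc (0 : Fin r → ℝ) 1, ‖iteratedFDeriv ℝ k f x‖ ≤ C) (n : Fin r → ℤ) :
    ‖periodicCoeff f n‖ * (1 + ‖n‖) ^ k ≤ 2 ^ k * (C₀ + C) := by
  have hC : 0 ≤ C := (norm_nonneg _).trans (h 0 ⟨le_rfl, fun i => zero_le_one⟩)
  have hb₀ := norm_periodicCoeff_le hper h₀ n
  by_cases hn : ‖n‖ ≤ 1
  · have h1 : (1 + ‖n‖) ^ k ≤ 2 ^ k := by gcongr; linarith
    calc ‖periodicCoeff f n‖ * (1 + ‖n‖) ^ k ≤ C₀ * 2 ^ k := by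
          gcongr
          exact (norm_nonneg _).trans hb₀
      _ ≤ _ := by
          rw [mul_comm]
          gcongr
          linarith
  · push Not at hn
    obtain ⟨j, hj⟩ : ∃ j, ‖n‖ = ‖n j‖ := by
      have : Nonempty (Fin r) := by
        by_contra hr
        rw [not_nonempty_iff] at hr
        rw [Subsingleton.elim n 0, norm_zero] at hn
        linarith
      obtain ⟨j, -, hj⟩ := Finset.exists_mem_eq_sup Finset.univ Finset.univ_nonempty
        fun i => ‖n i‖₊
      exact ⟨j, by rw [Pi.norm_def, hj]; rfl⟩
    have hb : ‖n‖ ^ k * ‖periodicCoeff f n‖ ≤ C := by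
      have h1 : ‖periodicCoeff ((partialDeriv j)^[k] f) n‖ ≤ C :=
        norm_periodicCoeff_le (iterate_partialDeriv_periodic j k hper)
          (fun x hx => (norm_iterate_partialDeriv_le j k hf x).trans (h x hx)) n
      rw [periodicCoeff_iterate_partialDeriv j k hf hper, norm_mul, norm_pow] at h1
      refine le_trans ?_ h1
      gcongr
      rw [hj, norm_mul]
      have h2 : ‖(n j : ℂ)‖ = ‖n j‖ := by simp [Int.norm_eq_abs]
      rw [h2]
      refine le_mul_of_one_le_left (norm_nonneg _) ?_
      simp only [norm_mul, Complex.norm_I, mul_one, Complex.norm_real, Complex.norm_ofNat,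
        Real.norm_of_nonneg Real.pi_pos.le]
      linarith [Real.pi_gt_three]
    have hC₀ : 0 ≤ C₀ := (norm_nonneg _).trans hb₀
    calc ‖periodicCoeff f n‖ * (1 + ‖n‖) ^ k ≤ ‖periodicCoeff f n‖ * (2 * ‖n‖) ^ k := by
          gcongr
          linarith
      _ = 2 ^ k * (‖n‖ ^ k * ‖periodicCoeff f n‖) := by rw [mul_pow]; ring
      _ ≤ _ := by
          gcongr
          linarith

end Decay

/-! ### Pullback estimates -/

section Pullback

variable {E : Type*} [NormedAddCommGroup E] [NormedSpace ℝ E] [FiniteDimensional ℝ E]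
  {M : Type*} [TopologicalSpace M] [ChartedSpace E M] [IsManifold 𝓘(ℝ, E) ∞ M]
  {W : Type*} [NormedAddCommGroup W] [NormedSpace ℝ W]

/-- Iterated chain rule in the chart at `p x₀`. On a small neighbourhood `p` stays in a fixed
compact ball of the chart, so one finite sum of seminorms works for all `f` at once. -/
theorem exists_nhds_norm_iteratedFDeriv_comp_le {p : W → M}
    (hp : ContMDiff 𝓘(ℝ, W) 𝓘(ℝ, E) ∞ p) (k : ℕ) (x₀ : W) :
    ∃ V ∈ 𝓝 x₀, ∃ q : Seminorm ℂ (SmoothFn E M), Continuous q ∧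
      ∀ (f : SmoothFn E M), ∀ x ∈ V, ‖iteratedFDeriv ℝ k (fun x => f (p x)) x‖ ≤ q f := by
  set c := chartAt E (p x₀)
  have hx₀ : p x₀ ∈ c.source := mem_chart_source E (p x₀)
  obtain ⟨R, hR, hRt⟩ := Metric.nhds_basis_closedBall.mem_iff.1
    (c.open_target.mem_nhds (c.map_source hx₀))
  have hU₀ : IsOpen (p ⁻¹' c.source) := c.open_source.preimage hp.continuous
  have hg : ContDiffOn ℝ ∞ (c ∘ p) (p ⁻¹' c.source) := by
    rw [← contMDiffOn_iff_contDiffOn]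
    exact (contMDiffOn_chart (n := ∞) (I := 𝓘(ℝ, E)) (x := p x₀)).comp hp.contMDiffOn
      subset_rfl
  set U := (p ⁻¹' c.source) ∩ (c ∘ p) ⁻¹' Metric.ball (c (p x₀)) R
  have hU : IsOpen U := hg.continuousOn.isOpen_inter_preimage hU₀ Metric.isOpen_ball
  have hxU : x₀ ∈ U := ⟨hx₀, Metric.mem_ball_self hR⟩
  have hgU : ContDiffOn ℝ ∞ (c ∘ p) U := hg.mono Set.inter_subset_left
  have hbd : ∀ i : ℕ, ∀ᶠ x in 𝓝 x₀, ‖iteratedFDeriv ℝ i (c ∘ p) x‖ ≤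
      ‖iteratedFDeriv ℝ i (c ∘ p) x₀‖ + 1 := fun i => by
    have h1 : ContinuousAt (iteratedFDeriv ℝ i (c ∘ p)) x₀ :=
      ((hgU.continuousOn_iteratedFDerivWithin (m := i) (by exact_mod_cast le_top)
        hU.uniqueDiffOn).congr fun y hy => (iteratedFDerivWithin_of_isOpen i hU hy).symm).continuousAt
        (hU.mem_nhds hxU)
    exact (h1.norm.eventually_lt_const (lt_add_one _)).mono fun _ h => h.le
  have hbd' : ∀ᶠ x in 𝓝 x₀, ∀ i ∈ Finset.range (k + 1), ‖iteratedFDeriv ℝ i (c ∘ p) x‖ ≤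
      ‖iteratedFDeriv ℝ i (c ∘ p) x₀‖ + 1 := (Finset.eventually_all _).2 fun i _ => hbd i
  -- The chain rule estimate wants the `i`-th derivative to be at most D^i with a single D. The
  -- summand 1 gives D ≥ 1, so D ≤ D^i for i ≥ 1.
  set D : ℝ := 1 + ∑ i ∈ Finset.range (k + 1), (‖iteratedFDeriv ℝ i (c ∘ p) x₀‖ + 1)
  have hD1 : 1 ≤ D := le_add_of_nonneg_right (by positivity)
  set S : ℕ → Seminorm ℂ (SmoothFn E M) := fun j => smoothSeminorms E M
    (seminormIndex (p x₀) _ (isCompact_closedBall (c (p x₀)) R) hRt j)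
  have hS : ∀ j, Continuous (S j) := fun j => withSeminorms_smoothFn.continuous_seminorm _
  set q : Seminorm ℂ (SmoothFn E M) :=
    Real.toNNReal (k.factorial * D ^ k) • ∑ j ∈ Finset.range (k + 1), S j
  have hsum : ∀ f, (∑ j ∈ Finset.range (k + 1), S j) f = ∑ j ∈ Finset.range (k + 1), S j f :=
    fun f => by simp
  have hq : ∀ f, q f = k.factorial * D ^ k * ∑ j ∈ Finset.range (k + 1), S j f := fun f => by
    rw [← hsum]
    change (Real.toNNReal (k.factorial * D ^ k) : ℝ) * (∑ j ∈ Finset.range (k + 1), S j) f = _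
    rw [Real.coe_toNNReal _ (by positivity)]
  refine ⟨_, inter_mem (hU.mem_nhds hxU) hbd', q, ?_, fun f x hx => ?_⟩
  · have : (q : SmoothFn E M → ℝ) =
        fun f => k.factorial * D ^ k * ∑ j ∈ Finset.range (k + 1), S j f := funext hq
    rw [this]
    exact continuous_const.mul (continuous_finsetSum _ fun j _ => hS j)
  · obtain ⟨hxU, hxD⟩ := hx
    have heq : (fun x => f (p x)) =ᶠ[𝓝 x] f.local (p x₀) ∘ (c ∘ p) := by
      filter_upwards [hU.mem_nhds hxU] with z hz
      simp [SmoothFn.local, c, c.left_inv hz.1]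
    rw [(heq.iteratedFDeriv ℝ k).eq_of_nhds, ← iteratedFDerivWithin_of_isOpen k hU hxU, hq]
    have h := norm_iteratedFDerivWithin_comp_le (N := ∞) (n := k) (f.contDiffOn_local (p x₀)) hgU
      (by exact_mod_cast le_top) c.open_target.uniqueDiffOn hU.uniqueDiffOn
      (fun z hz => hRt (Metric.ball_subset_closedBall hz.2)) hxU
      (C := ∑ j ∈ Finset.range (k + 1), S j f) (D := D) (fun i hi => ?_) (fun i hi hik => ?_)
    · refine h.trans_eq ?_
      ring
    · have hz := hRt (Metric.ball_subset_closedBall hxU.2)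
      rw [iteratedFDerivWithin_of_isOpen i c.open_target hz]
      refine (norm_iteratedFDeriv_local_le' (isCompact_closedBall (c (p x₀)) R) hRt i f
        (Metric.ball_subset_closedBall hxU.2)).trans ?_
      exact Finset.single_le_sum (f := fun j => S j f) (fun j _ => apply_nonneg _ _)
        (Finset.mem_range.2 (by omega))
    · rw [iteratedFDerivWithin_of_isOpen i hU hxU]
      refine (hxD i (Finset.mem_range.2 (by omega))).trans ?_
      have h1 : ‖iteratedFDeriv ℝ i (c ∘ p) x₀‖ + 1 ≤ D := by
        have := Finset.single_le_sum (f := fun i => ‖iteratedFDeriv ℝ i (c ∘ p) x₀‖ + 1)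
          (s := Finset.range (k + 1)) (fun j _ => by positivity)
          (Finset.mem_range.2 (show i < k + 1 by omega))
        simp only [D]
        linarith
      exact h1.trans (le_self_pow₀ hD1 (by omega))

theorem exists_seminorm_norm_iteratedFDeriv_comp_le {p : W → M}
    (hp : ContMDiff 𝓘(ℝ, W) 𝓘(ℝ, E) ∞ p) (k : ℕ) {K : Set W} (hK : IsCompact K) :
    ∃ q : Seminorm ℂ (SmoothFn E M), Continuous q ∧
      ∀ (f : SmoothFn E M), ∀ x ∈ K, ‖iteratedFDeriv ℝ k (fun x => f (p x)) x‖ ≤ q f := by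
  refine hK.induction_on (p := fun K => ∃ q : Seminorm ℂ (SmoothFn E M), Continuous q ∧
      ∀ (f : SmoothFn E M), ∀ x ∈ K, ‖iteratedFDeriv ℝ k (fun x => f (p x)) x‖ ≤ q f)
    ⟨0, continuous_const, by simp⟩ ?_ ?_ ?_
  · rintro s t hst ⟨q, hq, h⟩
    exact ⟨q, hq, fun f x hx => h f x (hst hx)⟩
  · rintro s t ⟨q, hq, h⟩ ⟨q', hq', h'⟩
    refine ⟨q + q', hq.add hq', fun f x hx => ?_⟩
    rcases hx with hx | hx
    · exact (h f x hx).trans (le_add_of_nonneg_right (apply_nonneg q' f))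
    · exact (h' f x hx).trans (le_add_of_nonneg_left (apply_nonneg q f))
  · intro x _
    obtain ⟨V, hV, q, hq⟩ := exists_nhds_norm_iteratedFDeriv_comp_le hp k x
    exact ⟨V, mem_nhdsWithin_of_mem_nhds hV, q, hq⟩

end Pullback

/-! ### Fourier series on a torus -/

section Torus

open UnitAddTorus

variable {F : Type*} [NormedAddCommGroup F] [NormedSpace ℝ F]
  {T : Type*} [TopologicalSpace T] [ChartedSpace F T] [CommGroup T] {r : ℕ}

variable (F) in
/-- The map `p` identifies the Lie group `T` with `ℝ^r / ℤ^r`. -/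
structure IsTorusParam (p : (Fin r → ℝ) → T) : Prop where
  map_add : ∀ x y, p (x + y) = p x * p y
  surjective : Function.Surjective p
  ker : ∀ x, p x = 1 ↔ ∃ n : Fin r → ℤ, x = fun i => (n i : ℝ)
  isLocalDiffeomorph : IsLocalDiffeomorph 𝓘(ℝ, Fin r → ℝ) 𝓘(ℝ, F) ∞ p

/-- The isomorphism `ℝ^r / ℤ^r → T`. -/
def torusMap (p : (Fin r → ℝ) → T) (t : UnitAddTorus (Fin r)) : T := p (torusLift t)

variable {p : (Fin r → ℝ) → T} (hp : IsTorusParam F p)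

include hp

theorem IsTorusParam.contMDiff : ContMDiff 𝓘(ℝ, Fin r → ℝ) 𝓘(ℝ, F) ∞ p :=
  hp.isLocalDiffeomorph.contMDiff

theorem IsTorusParam.map_zero : p 0 = 1 := (hp.ker 0).2 ⟨0, by funext i; simp⟩

theorem IsTorusParam.isPeriodic : IsPeriodic p := fun x n => by
  rw [hp.map_add, (hp.ker _).2 ⟨n, rfl⟩, mul_one]

theorem torusMap_torusProj (x : Fin r → ℝ) : torusMap p (torusProj x) = p x :=
  hp.isPeriodic.torusLift_torusProj x

theorem continuous_torusMap : Continuous (torusMap p) :=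
  hp.isPeriodic.continuous_comp_torusLift hp.contMDiff.continuous

theorem torusMap_add (s t : UnitAddTorus (Fin r)) :
    torusMap p (s + t) = torusMap p s * torusMap p t := by
  obtain ⟨x, rfl⟩ := surjective_torusProj s
  obtain ⟨y, rfl⟩ := surjective_torusProj t
  rw [← torusProj_add, torusMap_torusProj hp, torusMap_torusProj hp, torusMap_torusProj hp,
    hp.map_add]

theorem torusMap_zero : torusMap p 0 = 1 := by
  have h := torusMap_torusProj hp 0
  rw [hp.map_zero] at h
  rw [← h]
  congr 1

theorem surjective_torusMap : Function.Surjective (torusMap p) := fun t => by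
  obtain ⟨x, rfl⟩ := hp.surjective t
  exact ⟨torusProj x, torusMap_torusProj hp x⟩

theorem compactSpace_of_isTorusParam : CompactSpace T :=
  ⟨by
    rw [← (surjective_torusMap hp).range_eq]
    exact isCompact_range (continuous_torusMap hp)⟩

theorem connectedSpace_of_isTorusParam : ConnectedSpace T :=
  hp.surjective.connectedSpace hp.contMDiff.continuous

omit hp

/-- The Fourier coefficients of a smooth function on the torus. -/
def torusCoeff (p : (Fin r → ℝ) → T) (φ : SmoothFn F T) (n : Fin r → ℤ) : ℂ :=
  mFourierCoeff (fun t => φ (torusMap p t)) n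

include hp

variable [IsManifold 𝓘(ℝ, F) ∞ T]

omit [IsManifold 𝓘(ℝ, F) ∞ T] in
theorem SmoothFn.continuous_comp_torusMap (φ : SmoothFn F T) :
    Continuous fun t => φ (torusMap p t) :=
  φ.contMDiff.continuous.comp (continuous_torusMap hp)

omit [IsManifold 𝓘(ℝ, F) ∞ T] in
theorem SmoothFn.contDiff_comp_param (φ : SmoothFn F T) : ContDiff ℝ ∞ fun x => φ (p x) := by
  rw [← contMDiff_iff_contDiff]
  exact φ.contMDiff.comp hp.contMDiff

omit [IsManifold 𝓘(ℝ, F) ∞ T] in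
theorem torusCoeff_add (φ ψ : SmoothFn F T) (n : Fin r → ℤ) :
    torusCoeff p (φ + ψ) n = torusCoeff p φ n + torusCoeff p ψ n :=
  mFourierCoeff_add (φ.continuous_comp_torusMap hp) (ψ.continuous_comp_torusMap hp) n

omit hp [CommGroup T] [IsManifold 𝓘(ℝ, F) ∞ T] in
theorem torusCoeff_smul (c : ℂ) (φ : SmoothFn F T) (n : Fin r → ℤ) :
    torusCoeff p (c • φ) n = c * torusCoeff p φ n :=
  mFourierCoeff_const_mul c _ n

/-- The constant in the rapid decay is a continuous seminorm of φ; this is what later makes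
synthesis operators continuous and not merely defined. -/
theorem exists_seminorm_torusCoeff_le [FiniteDimensional ℝ F] (k : ℕ) :
    ∃ q : Seminorm ℂ (SmoothFn F T), Continuous q ∧
      ∀ φ n, ‖torusCoeff p φ n‖ * (1 + ‖n‖) ^ k ≤ q φ := by
  have hK : IsCompact (Set.Icc (0 : Fin r → ℝ) 1) := isCompact_Icc
  obtain ⟨q₀, hq₀, h₀⟩ := exists_seminorm_norm_iteratedFDeriv_comp_le hp.contMDiff 0 hK
  obtain ⟨q, hq, h⟩ := exists_seminorm_norm_iteratedFDeriv_comp_le hp.contMDiff k hK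
  refine ⟨(2 ^ k : NNReal) • (q₀ + q), continuous_const.mul (hq₀.add hq), fun φ n => ?_⟩
  have hper : IsPeriodic fun x => φ (p x) := fun x n =>
    congrArg (φ : T → ℂ) (hp.isPeriodic x n)
  exact norm_periodicCoeff_mul_le k (φ.contDiff_comp_param hp) hper
    (fun x hx => by simpa using h₀ φ x hx) (h φ) n

variable {E : Type*} [NormedAddCommGroup E] [NormedSpace ℝ E] [FiniteDimensional ℝ E]
  {M : Type*} [TopologicalSpace M] [ChartedSpace E M] [IsManifold 𝓘(ℝ, E) ∞ M]

/-- A family of smooth functions with seminorms of polynomial growth can be paired with the Fourier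
coefficients of smooth functions on the torus. -/
theorem exists_synthesis [FiniteDimensional ℝ F] {D : (Fin r → ℤ) → SmoothFn E M}
    (hD : ∀ i, ∃ (C : ℝ) (k : ℕ), ∀ n, smoothSeminorms E M i (D n) ≤ C * (1 + ‖n‖) ^ k) :
    ∃ ψ : SmoothFn F T →L[ℂ] SmoothFn E M, ∀ φ,
      HasSum (fun n => torusCoeff p φ n • D n) (ψ φ) ∧
        ∀ x, ψ φ x = ∑' n, torusCoeff p φ n * D n x := by
  have hD' : ∀ i, ∃ q : Seminorm ℂ (SmoothFn F T), Continuous q ∧ ∀ φ n,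
      smoothSeminorms E M i (torusCoeff p φ n • D n) ≤ q φ * ((1 + ‖n‖) ^ (r + 1))⁻¹ := fun i => by
    obtain ⟨C, k, hC⟩ := hD i
    -- Decay of order k absorbs the growth of `D`; the remaining order r + 1 makes the sum over the
    -- lattice converge.
    obtain ⟨q, hq, h⟩ := exists_seminorm_torusCoeff_le hp (k + (r + 1))
    refine ⟨Real.toNNReal C • q, continuous_const.mul hq, fun φ n => ?_⟩
    have hpos : 0 < (1 + ‖n‖) ^ (r + 1) := by positivity
    rw [map_smul_eq_mul, ← div_eq_mul_inv, le_div_iff₀ hpos]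
    calc ‖torusCoeff p φ n‖ * smoothSeminorms E M i (D n) * (1 + ‖n‖) ^ (r + 1)
        ≤ ‖torusCoeff p φ n‖ * (Real.toNNReal C * (1 + ‖n‖) ^ k) * (1 + ‖n‖) ^ (r + 1) := by
          gcongr
          refine (hC n).trans ?_
          gcongr
          exact Real.le_coe_toNNReal C
      _ = Real.toNNReal C * (‖torusCoeff p φ n‖ * (1 + ‖n‖) ^ (k + (r + 1))) := by ring
      _ ≤ Real.toNNReal C * q φ := by
          gcongr
          exact h φ n
  have hsum : ∀ φ i, Summable fun n => smoothSeminorms E M i (torusCoeff p φ n • D n) :=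
    fun φ i => by
      obtain ⟨q, -, h⟩ := hD' i
      exact Summable.of_nonneg_of_le (fun n => apply_nonneg _ _) (h φ)
        (summable_one_add_norm_inv_pow.mul_left _)
  have hpt : ∀ φ x, Summable fun n => torusCoeff p φ n * D n x := fun φ x =>
    Summable.of_norm_bounded (hsum φ (seminormIndex x {chartAt E x x} isCompact_singleton
      (by simp) 0)) fun n => norm_apply_le (torusCoeff p φ n • D n) x
  let ψ : SmoothFn F T →ₗ[ℂ] SmoothFn E M :=
    { toFun := fun φ => tsumSmooth (hsum φ)
      map_add' := fun φ φ' => SmoothFn.ext fun x => by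
        rw [SmoothFn.add_apply, tsumSmooth_apply, tsumSmooth_apply, tsumSmooth_apply]
        simp only [SmoothFn.smul_apply]
        rw [← (hpt φ x).tsum_add (hpt φ' x)]
        exact tsum_congr fun n => by rw [torusCoeff_add hp, add_mul]
      map_smul' := fun c φ => SmoothFn.ext fun x => by
        rw [RingHom.id_apply, SmoothFn.smul_apply, tsumSmooth_apply, tsumSmooth_apply,
          ← tsum_mul_left]
        exact tsum_congr fun n => by
          rw [SmoothFn.smul_apply, SmoothFn.smul_apply, torusCoeff_smul, mul_assoc] }
  refine ⟨⟨ψ, ?_⟩, fun φ => ⟨hasSum_tsumSmooth (hsum φ), fun x => rfl⟩⟩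
  have hga : IsTopologicalAddGroup (SmoothFn F T) := withSeminorms_smoothFn.topologicalAddGroup
  have hcs : ContinuousSMul ℂ (SmoothFn F T) := withSeminorms_smoothFn.continuousSMul
  refine WithSeminorms.continuous_of_continuous_comp withSeminorms_smoothFn ψ fun i => ?_
  obtain ⟨q, hq, h⟩ := hD' i
  set A := ∑' n : Fin r → ℤ, ((1 + ‖n‖) ^ (r + 1))⁻¹
  have hA : 0 ≤ A := tsum_nonneg fun n => by positivity
  refine Seminorm.continuous_of_le (q := Real.toNNReal A • q) (continuous_const.mul hq) fun φ => ?_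
  refine (smoothSeminorms_tsumSmooth_le (hsum φ) i).trans ?_
  refine ((hsum φ i).tsum_le_tsum (h φ) (summable_one_add_norm_inv_pow.mul_left _)).trans_eq ?_
  rw [tsum_mul_left, mul_comm]
  change A * q φ = Real.toNNReal A * q φ
  rw [Real.coe_toNNReal A hA]

end Torus

/-! ### Estimates for the derivatives of representations in charts -/

section Equation

theorem natCast_le_infty (j : ℕ) : (j : WithTop ℕ∞) ≤ ∞ := by exact_mod_cast le_top

variable {E : Type*} [NormedAddCommGroup E] [NormedSpace ℝ E]

set_option maxSynthPendingDepth 3 in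
/-- The derivatives of a bounded solution of `DA = A · (δ ∘ θ)` are bounded by powers of `‖δ‖`. -/
theorem exists_norm_iteratedFDeriv_le_of_fderiv_eq {U : Set E} (hU : IsOpen U)
    {θ : E → E →L[ℝ] E} (hθ : ContDiffOn ℝ ∞ θ U) {K : Set E} (hK : IsCompact K) (hKU : K ⊆ U)
    (k : ℕ) :
    ∃ C : ℝ, 0 ≤ C ∧ ∀ {𝔸 : Type} [NormedRing 𝔸] [NormedAlgebra ℝ 𝔸] (A : E → 𝔸)
      (δ : E →L[ℝ] 𝔸) (L : ℝ), ContDiffOn ℝ ∞ A U → ‖δ‖ ≤ L → (∀ y ∈ U, ‖A y‖ ≤ 1) →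
      (∀ y ∈ U, ∀ η, fderiv ℝ A y η = A y * δ (θ y η)) →
      ∀ y ∈ K, ‖iteratedFDeriv ℝ k A y‖ ≤ C * (1 + L) ^ k := by
  have hΩ : ∀ j : ℕ, ∃ c, ∀ y ∈ K, ‖iteratedFDerivWithin ℝ j θ U y‖ ≤ c := fun j =>
    hK.exists_bound_of_continuousOn ((hθ.continuousOn_iteratedFDerivWithin
      (by exact_mod_cast le_top) hU.uniqueDiffOn).mono hKU)
  choose Ω₀ hΩ₀ using hΩ
  set Ω : ℕ → ℝ := fun j => max (Ω₀ j) 0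
  have hΩ : ∀ j, ∀ y ∈ K, ‖iteratedFDerivWithin ℝ j θ U y‖ ≤ Ω j := fun j y hy =>
    (hΩ₀ j y hy).trans (le_max_left _ _)
  have hΩ0 : ∀ j, 0 ≤ Ω j := fun j => le_max_right _ _
  induction k using Nat.strong_induction_on with
  | _ k ih =>
  rcases k with _ | k
  · refine ⟨1, zero_le_one, fun A δ L _ _ h1 _ y hy => ?_⟩
    simpa using h1 y (hKU hy)
  -- The hypothesis is extended to all `i` so that constants can be chosen now, before the algebra
  -- is introduced: they must serve all representations simultaneously.
  · have ih' : ∀ i, ∃ C : ℝ, 0 ≤ C ∧ (i < k + 1 → ∀ {𝔸 : Type} [NormedRing 𝔸] [NormedAlgebra ℝ 𝔸]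
      (A : E → 𝔸) (δ : E →L[ℝ] 𝔸) (L : ℝ), ContDiffOn ℝ ∞ A U → ‖δ‖ ≤ L → (∀ y ∈ U, ‖A y‖ ≤ 1) →
      (∀ y ∈ U, ∀ η, fderiv ℝ A y η = A y * δ (θ y η)) →
      ∀ y ∈ K, ‖iteratedFDeriv ℝ i A y‖ ≤ C * (1 + L) ^ i) := fun i => by
      by_cases hi : i < k + 1
      · obtain ⟨C, hC, h⟩ := ih i hi
        exact ⟨C, hC, fun _ => h⟩
      · exact ⟨0, le_rfl, fun h => absurd h hi⟩
    choose C hC0 hC using ih'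
    refine ⟨∑ i ∈ Finset.range (k + 1), (k.choose i) * C i * Ω (k - i),
      Finset.sum_nonneg fun i _ => mul_nonneg (mul_nonneg (Nat.cast_nonneg _) (hC0 i)) (hΩ0 _), ?_⟩
    intro 𝔸 _ _ A δ L hA hδ h1 hD y hy
    have hL : 0 ≤ L := (norm_nonneg _).trans hδ
    have hyU := hKU hy
    let B : 𝔸 →L[ℝ] (E →L[ℝ] 𝔸) →L[ℝ] (E →L[ℝ] 𝔸) :=
      (ContinuousLinearMap.compL ℝ E 𝔸 𝔸).comp (ContinuousLinearMap.mul ℝ 𝔸)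
    have hB : ‖B‖ ≤ 1 := (ContinuousLinearMap.opNorm_comp_le _ _).trans
      (mul_le_one₀ (ContinuousLinearMap.norm_compL_le ℝ E 𝔸 𝔸) (norm_nonneg _)
        (ContinuousLinearMap.opNorm_mul_le ℝ 𝔸))
    let P : (E →L[ℝ] E) →L[ℝ] (E →L[ℝ] 𝔸) := ContinuousLinearMap.compL ℝ E E 𝔸 δ
    have hP : ‖P‖ ≤ L := by
      refine ((ContinuousLinearMap.compL ℝ E E 𝔸).le_opNorm δ).trans ?_
      exact (mul_le_of_le_one_left (norm_nonneg _)
        (ContinuousLinearMap.norm_compL_le ℝ E E 𝔸)).trans hδ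
    have hM : ContDiffOn ℝ ∞ (P ∘ θ) U := P.contDiff.comp_contDiffOn hθ
    have hfd : Set.EqOn (fderivWithin ℝ A U) (fun z => B (A z) ((P ∘ θ) z)) U := fun z hz => by
      ext η
      rw [fderivWithin_of_isOpen hU hz, hD z hz]
      rfl
    -- By the equation, the derivative of order k + 1 of `A` is the derivative of order k of the
    -- product A · (δ ∘ θ). The Leibniz rule then involves only derivatives of `A` of order at most
    -- k.
    rw [← iteratedFDerivWithin_of_isOpen (k + 1) hU hyU,
      ← norm_iteratedFDerivWithin_fderivWithin hU.uniqueDiffOn hyU,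
      iteratedFDerivWithin_congr hfd hyU]
    refine (B.norm_iteratedFDerivWithin_le_of_bilinear_of_le_one hA hM hU.uniqueDiffOn hyU
      (by exact_mod_cast le_top) hB).trans ?_
    rw [Finset.sum_mul]
    refine Finset.sum_le_sum fun i hi => ?_
    have hi' : i < k + 1 := Finset.mem_range.1 hi
    have e1 : ‖iteratedFDerivWithin ℝ i A U y‖ ≤ C i * (1 + L) ^ i := by
      rw [iteratedFDerivWithin_of_isOpen i hU hyU]
      exact hC i hi' A δ L hA hδ h1 hD y hy
    have e2 : ‖iteratedFDerivWithin ℝ (k - i) (P ∘ θ) U y‖ ≤ L * Ω (k - i) :=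
      (P.norm_iteratedFDerivWithin_comp_left (hθ y hyU) hU.uniqueDiffOn hyU
        (natCast_le_infty _)).trans (mul_le_mul hP (hΩ _ y hy) (norm_nonneg _) hL)
    calc (k.choose i : ℝ) * ‖iteratedFDerivWithin ℝ i A U y‖ *
          ‖iteratedFDerivWithin ℝ (k - i) (P ∘ θ) U y‖
        ≤ (k.choose i : ℝ) * (C i * (1 + L) ^ i) * (L * Ω (k - i)) := by
          gcongr
          exact mul_nonneg (Nat.cast_nonneg _) (mul_nonneg (hC0 i) (by positivity))
      _ = (k.choose i : ℝ) * C i * Ω (k - i) * ((1 + L) ^ i * L) := by ring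
      _ ≤ (k.choose i : ℝ) * C i * Ω (k - i) * (1 + L) ^ (k + 1) := by
          refine mul_le_mul_of_nonneg_left ?_
            (mul_nonneg (mul_nonneg (Nat.cast_nonneg _) (hC0 i)) (hΩ0 _))
          calc (1 + L) ^ i * L ≤ (1 + L) ^ i * (1 + L) := by gcongr; linarith
            _ = (1 + L) ^ (i + 1) := (pow_succ _ _).symm
            _ ≤ (1 + L) ^ (k + 1) := pow_le_pow_right₀ (by linarith) (by omega)

end Equation

/-! ### Calculus of the derivative at the unit. -/

section DerivOne

variable {E : Type*} [NormedAddCommGroup E] [NormedSpace ℝ E]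
  {G : Type*} [TopologicalSpace G] [ChartedSpace E G] [Group G]
  {F : Type*} [NormedAddCommGroup F] [NormedSpace ℝ F]
  {T : Type*} [TopologicalSpace T] [ChartedSpace F T] [Group T]
  {V : Type*} [NormedAddCommGroup V] [NormedSpace ℝ V]
  {N : Type*} [TopologicalSpace N] [ChartedSpace V N]

/-- The base point occurs in the type of `mfderiv`; reading the derivative as a map between model
spaces allows the point to be exchanged. -/
theorem mfderiv_congr_point' {f : G → N} {a : G} (ha : a = 1) (X : E) :
    (mfderiv 𝓘(ℝ, E) 𝓘(ℝ, V) f a : E →L[ℝ] V) X =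
      (mfderiv 𝓘(ℝ, E) 𝓘(ℝ, V) f 1 : E →L[ℝ] V) X := by
  subst ha
  rfl

theorem derivOne_comp {f : G → N} {j : T → G} (hj1 : j 1 = 1)
    (hf : MDifferentiableAt 𝓘(ℝ, E) 𝓘(ℝ, V) f 1) (hj : MDifferentiableAt 𝓘(ℝ, F) 𝓘(ℝ, E) j 1)
    (X : GroupLieAlgebra 𝓘(ℝ, F) T) :
    derivOne V (fun t => f (j t)) X = derivOne V f (derivOne E j X) := by
  have h := mfderiv_comp (I := 𝓘(ℝ, F)) (I' := 𝓘(ℝ, E)) (I'' := 𝓘(ℝ, V)) (1 : T)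
    (g := f) (f := j) (by rw [hj1]; exact hf) hj
  have h2 := mfderiv_congr_point' (V := V) (f := f) hj1 (derivOne E j X)
  rw [← show _ = derivOne V f (derivOne E j X) from h2]
  exact congrArg (fun L : F →L[ℝ] V => L X) h

theorem derivOne_eq_fderiv {f : G → V} (hf : MDifferentiableAt 𝓘(ℝ, E) 𝓘(ℝ, V) f 1)
    (X : GroupLieAlgebra 𝓘(ℝ, E) G) :
    derivOne V f X = fderiv ℝ (f ∘ (chartAt E (1 : G)).symm) (chartAt E (1 : G) 1) X := by
  have h := hf.mfderiv
  simp only [mfld_simps, fderivWithin_univ] at h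
  change (mfderiv 𝓘(ℝ, E) 𝓘(ℝ, V) f 1 : E →L[ℝ] V) X = _
  rw [h]
  rfl

theorem derivOne_clm_comp {V' : Type*} [NormedAddCommGroup V'] [NormedSpace ℝ V'] {f : G → V}
    (hf : MDifferentiableAt 𝓘(ℝ, E) 𝓘(ℝ, V) f 1) (ℓ : V →L[ℝ] V') (X : GroupLieAlgebra 𝓘(ℝ, E) G) :
    derivOne V' (fun g => ℓ (f g)) X = ℓ (derivOne V f X) := by
  have h := mfderiv_comp (I := 𝓘(ℝ, E)) (I' := 𝓘(ℝ, V)) (I'' := 𝓘(ℝ, V')) (1 : G)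
    (g := ℓ) (f := f) ℓ.mdifferentiableAt hf
  rw [ContinuousLinearMap.mfderiv_eq] at h
  exact congrArg (fun L : E →L[ℝ] V' => L X) h

end DerivOne

/-! ### The Maurer-Cartan form and homomorphisms to algebras. -/

section Chart

variable {E : Type*} [NormedAddCommGroup E] [NormedSpace ℝ E] [FiniteDimensional ℝ E]
  {G : Type*} [TopologicalSpace G] [ChartedSpace E G] [Group G] [LieGroup 𝓘(ℝ, E) ∞ G]

/-- The left-invariant Maurer-Cartan form in the chart at `x`. -/
def maurerCartan (x : G) (y : E) : E →L[ℝ] E :=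
  fderiv ℝ (fun z => chartAt E (1 : G) (((chartAt E x).symm y)⁻¹ * (chartAt E x).symm z)) y

omit [FiniteDimensional ℝ E] in
-- On the diagonal the quotient is the unit, which lies in the source of the chart at 1. Joint
-- smoothness is needed because the Maurer-Cartan form differentiates in one variable and then
-- varies the other.
theorem contDiffAt_inv_mul (x : G) {y : E} (hy : y ∈ (chartAt E x).target) :
    ContDiffAt ℝ ∞ (Function.uncurry fun y z : E => chartAt E (1 : G)
      (((chartAt E x).symm y)⁻¹ * (chartAt E x).symm z)) (y, y) := by
  rw [← contMDiffAt_iff_contDiffAt]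
  have hsymm : ContMDiffAt 𝓘(ℝ, E) 𝓘(ℝ, E) ∞ (chartAt E x).symm y :=
    contMDiffOn_chart_symm.contMDiffAt ((chartAt E x).open_target.mem_nhds hy)
  have h1 : ContMDiffAt 𝓘(ℝ, E × E) 𝓘(ℝ, E) ∞ (fun q : E × E => (chartAt E x).symm q.1) (y, y) :=
    hsymm.comp (y, y) (contDiff_fst.contMDiff.contMDiffAt)
  have h2 : ContMDiffAt 𝓘(ℝ, E × E) 𝓘(ℝ, E) ∞ (fun q : E × E => (chartAt E x).symm q.2) (y, y) :=
    hsymm.comp (y, y) (contDiff_snd.contMDiff.contMDiffAt)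
  have h3 := h1.inv.mul h2
  have h4 : ContMDiffAt 𝓘(ℝ, E) 𝓘(ℝ, E) ∞ (chartAt E (1 : G))
      (((chartAt E x).symm y)⁻¹ * (chartAt E x).symm y) := by
    rw [inv_mul_cancel]
    exact contMDiffAt_of_mem_maximalAtlas (IsManifold.chart_mem_maximalAtlas _)
      (mem_chart_source E _)
  exact h4.comp (y, y) h3

omit [FiniteDimensional ℝ E] in
theorem contDiffOn_maurerCartan (x : G) :
    ContDiffOn ℝ ∞ (maurerCartan (E := E) x) (chartAt E x).target := fun y hy =>
  (ContDiffAt.fderiv (f := fun y z : E => chartAt E (1 : G)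
      (((chartAt E x).symm y)⁻¹ * (chartAt E x).symm z)) (g := fun y => y) (n := ∞) (m := ∞)
    (contDiffAt_inv_mul x hy) contDiffAt_id (by exact_mod_cast le_top)).contDiffWithinAt

variable {𝔸 : Type*} [NormedRing 𝔸] [NormedAlgebra ℝ 𝔸] {A : G →* 𝔸}

/-- The derivative at the unit of a smooth homomorphism to an algebra, as a continuous map. -/
def derivHom (A : G →* 𝔸) : E →L[ℝ] 𝔸 :=
  LinearMap.toContinuousLinearMap (E := E) (derivOne (E := E) 𝔸 A)

omit [LieGroup 𝓘(ℝ, E) ∞ G] in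
theorem derivHom_apply (X : E) : derivHom A X = derivOne (E := E) 𝔸 A X := rfl

/-- Write A(h) = A(g) A(g⁻¹h) with g, h the points of coordinates y, z, and differentiate in z at z
= y; the second factor is evaluated near the unit. -/
theorem fderiv_comp_chart_symm (hA : ContMDiff 𝓘(ℝ, E) 𝓘(ℝ, 𝔸) ∞ A) (x : G) {y : E}
    (hy : y ∈ (chartAt E x).target) (η : E) :
    fderiv ℝ (A ∘ (chartAt E x).symm) y η =
      A ((chartAt E x).symm y) * derivHom A (maurerCartan x y η) := by
  set c := chartAt E x
  set c₁ := chartAt E (1 : G)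
  let m : E → E := fun z => c₁ ((c.symm y)⁻¹ * c.symm z)
  have hm1 : m y = c₁ 1 := by simp [m]
  have hm : DifferentiableAt ℝ m y := by
    have h := (contDiffAt_inv_mul x hy).comp y
      (contDiffAt_const.prodMk contDiffAt_id : ContDiffAt ℝ ∞ (fun z : E => (y, z)) y)
    exact h.differentiableAt (by simp)
  have hcont : ContinuousAt (fun z => (c.symm y)⁻¹ * c.symm z) y := by
    have : ContMDiffAt 𝓘(ℝ, E) 𝓘(ℝ, E) ∞ c.symm y :=
      contMDiffOn_chart_symm.contMDiffAt (c.open_target.mem_nhds hy)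
    exact (contMDiffAt_const.mul this).continuousAt
  have hev : ∀ᶠ z in 𝓝 y, (c.symm y)⁻¹ * c.symm z ∈ c₁.source := by
    refine hcont.eventually_mem (c₁.open_source.mem_nhds ?_)
    rw [inv_mul_cancel]
    exact mem_chart_source E 1
  have heq : A ∘ c.symm =ᶠ[𝓝 y] fun z => A (c.symm y) * (A ∘ c₁.symm) (m z) := by
    filter_upwards [hev] with z hz
    simp only [m, Function.comp, c₁.left_inv hz]
    rw [← map_mul, mul_inv_cancel_left]
  have hA1 : DifferentiableAt ℝ (A ∘ c₁.symm) (m y) := by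
    rw [hm1]
    have h : ContMDiffAt 𝓘(ℝ, E) 𝓘(ℝ, E) ∞ c₁.symm (c₁ 1) :=
      contMDiffOn_chart_symm.contMDiffAt (c₁.open_target.mem_nhds (mem_chart_target E 1))
    have h2 := (hA _).comp _ h
    rw [contMDiffAt_iff_contDiffAt] at h2
    exact h2.differentiableAt (by simp)
  have hd : HasFDerivAt (fun z => A (c.symm y) * (A ∘ c₁.symm) (m z)) _ y :=
    (hA1.hasFDerivAt.comp y hm.hasFDerivAt).const_mul (A (c.symm y))
  rw [heq.fderiv_eq, hd.fderiv]
  have h3 := derivOne_eq_fderiv (hA.mdifferentiableAt (by simp) (x := 1)) (maurerCartan x y η)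
  rw [derivHom_apply, h3, ← hm1]
  rfl

/-- The derivatives of a bounded homomorphism to an algebra are bounded by powers of the norm of its
derivative at the unit. -/
theorem exists_norm_iteratedFDeriv_hom_le (x : G) {K : Set E} (hK : IsCompact K)
    (hKx : K ⊆ (chartAt E x).target) (k : ℕ) :
    ∃ C : ℝ, 0 ≤ C ∧ ∀ {𝔸 : Type} [NormedRing 𝔸] [NormedAlgebra ℝ 𝔸] (A : G →* 𝔸) (L : ℝ),
      ContMDiff 𝓘(ℝ, E) 𝓘(ℝ, 𝔸) ∞ A → (∀ g, ‖A g‖ ≤ 1) → ‖derivHom (E := E) A‖ ≤ L →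
      ∀ y ∈ K, ‖iteratedFDeriv ℝ k (A ∘ (chartAt E x).symm) y‖ ≤ C * (1 + L) ^ k := by
  obtain ⟨C, hC0, hC⟩ := exists_norm_iteratedFDeriv_le_of_fderiv_eq (chartAt E x).open_target
    (contDiffOn_maurerCartan x) hK hKx k
  refine ⟨C, hC0, fun A L hA h1 hL y hy => ?_⟩
  refine hC (A ∘ (chartAt E x).symm) (derivHom A) L ?_ hL (fun y _ => h1 _)
    (fun y hy η => fderiv_comp_chart_symm hA x hy η) y hy
  rw [← contMDiffOn_iff_contDiffOn]
  exact hA.comp_contMDiffOn contMDiffOn_chart_symm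

/-- Used twice: for Δ_λ with the operators on V_λ as algebra, and for the characters of the torus
with ℂ as algebra. -/
theorem exists_smoothSeminorms_matrixCoeff_le (i : SeminormIndex E G) :
    ∃ C : ℝ, 0 ≤ C ∧ ∀ {𝔸 : Type} [NormedRing 𝔸] [NormedAlgebra ℝ 𝔸] (A : G →* 𝔸) (L : ℝ)
      (ℓ : 𝔸 →L[ℝ] ℂ) (f : SmoothFn E G),
      ContMDiff 𝓘(ℝ, E) 𝓘(ℝ, 𝔸) ∞ A → (∀ g, ‖A g‖ ≤ 1) → ‖derivHom (E := E) A‖ ≤ L → ‖ℓ‖ ≤ 1 →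
      (∀ g, f g = ℓ (A g)) → smoothSeminorms E G i f ≤ C * (1 + L) ^ i.2 := by
  obtain ⟨C, hC0, hC⟩ := exists_norm_iteratedFDeriv_hom_le i.1.1 i.1.2.1.isCompact i.1.2.2 i.2
  refine ⟨C, hC0, fun A L ℓ f hA h1 hL hℓ hf => ?_⟩
  have hL0 : 0 ≤ L := (norm_nonneg _).trans hL
  rw [smoothSeminorms_le_iff (by positivity)]
  intro y hy
  have hloc : f.local i.1.1 = ℓ ∘ (A ∘ (chartAt E i.1.1).symm) := funext fun z => hf _
  have hyt := i.1.2.2 hy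
  have hs : ContDiffAt ℝ ∞ (A ∘ (chartAt E i.1.1).symm) y := by
    have : ContDiffOn ℝ ∞ (A ∘ (chartAt E i.1.1).symm) (chartAt E i.1.1).target := by
      rw [← contMDiffOn_iff_contDiffOn]
      exact hA.comp_contMDiffOn contMDiffOn_chart_symm
    exact this.contDiffAt ((chartAt E i.1.1).open_target.mem_nhds hyt)
  rw [hloc]
  refine (ℓ.norm_iteratedFDeriv_comp_left hs (by exact_mod_cast le_top)).trans ?_
  exact (mul_le_of_le_one_left (norm_nonneg _) hℓ).trans (hC A L hA h1 hL y hy)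

end Chart

/-! ### The adjoint representation -/

section Adjoint

variable {E : Type*} [NormedAddCommGroup E] [NormedSpace ℝ E]
  {G : Type*} [TopologicalSpace G] [ChartedSpace E G] [Group G]
  {V : Type*} [NormedAddCommGroup V] [NormedSpace ℝ V]

theorem derivOne_eq_fderiv_chart {N : Type*} [TopologicalSpace N] [ChartedSpace V N] {j : G → N}
    {n : N} (hn : j 1 = n) (hj : MDifferentiableAt 𝓘(ℝ, E) 𝓘(ℝ, V) j 1)
    (X : GroupLieAlgebra 𝓘(ℝ, E) G) :
    derivOne V j X = fderiv ℝ (chartAt V n ∘ j ∘ (chartAt E (1 : G)).symm) (chartAt E (1 : G) 1) X := by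
  subst hn
  have h := hj.mfderiv
  simp only [mfld_simps, fderivWithin_univ] at h
  exact congrArg (fun L : E →L[ℝ] V => L X) h

theorem derivOne_add {f g : G → V} (hf : MDifferentiableAt 𝓘(ℝ, E) 𝓘(ℝ, V) f 1)
    (hg : MDifferentiableAt 𝓘(ℝ, E) 𝓘(ℝ, V) g 1) (X : GroupLieAlgebra 𝓘(ℝ, E) G) :
    derivOne V (fun x => f x + g x) X = derivOne V f X + derivOne V g X := by
  have h := (hf.hasMFDerivAt.add hg.hasMFDerivAt).mfderiv
  exact congrArg (fun L : E →L[ℝ] V => L X) h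

theorem derivOne_mul {𝔸 : Type*} [NormedRing 𝔸] [NormedAlgebra ℝ 𝔸] {f g : G → 𝔸}
    (hf : MDifferentiableAt 𝓘(ℝ, E) 𝓘(ℝ, 𝔸) f 1) (hg : MDifferentiableAt 𝓘(ℝ, E) 𝓘(ℝ, 𝔸) g 1)
    (X : GroupLieAlgebra 𝓘(ℝ, E) G) :
    derivOne 𝔸 (fun x => f x * g x) X = derivOne 𝔸 f X * g 1 + f 1 * derivOne 𝔸 g X := by
  have h := (hf.hasMFDerivAt.mul' hg.hasMFDerivAt).mfderiv
  refine (congrArg (fun L : E →L[ℝ] 𝔸 => L X) h).trans ?_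
  exact add_comm _ _

variable [LieGroup 𝓘(ℝ, E) ∞ G]

theorem contMDiff_conj (g : G) : ContMDiff 𝓘(ℝ, E) 𝓘(ℝ, E) ∞ fun h : G => g * h * g⁻¹ :=
  (contMDiff_const.mul contMDiff_id).mul contMDiff_const

theorem mdifferentiable_conj (g : G) : MDifferentiable 𝓘(ℝ, E) 𝓘(ℝ, E) fun h : G => g * h * g⁻¹ :=
  (contMDiff_conj g).mdifferentiable (by simp)

theorem derivOne_comp_conj {N : Type*} [TopologicalSpace N] [ChartedSpace V N] {f : G → N}
    (hf : MDifferentiableAt 𝓘(ℝ, E) 𝓘(ℝ, V) f 1) (g : G) (X : GroupLieAlgebra 𝓘(ℝ, E) G) :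
    derivOne V (fun h => f (g * h * g⁻¹)) X = derivOne V f (Ad E g X) :=
  derivOne_comp (j := fun h => g * h * g⁻¹) (by simp) hf (mdifferentiable_conj g 1) X

theorem Ad_mul (g h : G) (X : GroupLieAlgebra 𝓘(ℝ, E) G) :
    Ad E (g * h) X = Ad E g (Ad E h X) := by
  have h1 := derivOne_comp_conj (mdifferentiable_conj (E := E) g 1) h X
  refine Eq.trans ?_ h1
  simp only [Ad, mul_inv_rev, mul_assoc]
  rfl

omit [LieGroup 𝓘(ℝ, E) ∞ G] in
theorem Ad_one (X : GroupLieAlgebra 𝓘(ℝ, E) G) : Ad E (1 : G) X = X := by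
  have h : (fun h : G => 1 * h * 1⁻¹) = id := by funext h; simp
  simp only [Ad, h]
  exact congrArg (fun L : E →L[ℝ] E => L X) (mfderiv_id (I := 𝓘(ℝ, E)) (x := (1 : G)))

theorem Ad_inv_Ad (g : G) (X : GroupLieAlgebra 𝓘(ℝ, E) G) : Ad E g⁻¹ (Ad E g X) = X := by
  rw [← Ad_mul, inv_mul_cancel, Ad_one]

theorem Ad_Ad_inv (g : G) (X : GroupLieAlgebra 𝓘(ℝ, E) G) : Ad E g (Ad E g⁻¹ X) = X := by
  rw [← Ad_mul, mul_inv_cancel, Ad_one]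

theorem Ad_eq_fderiv (g : G) (X : GroupLieAlgebra 𝓘(ℝ, E) G) :
    Ad E g X = fderiv ℝ (fun z => chartAt E (1 : G) (g * (chartAt E (1 : G)).symm z * g⁻¹))
      (chartAt E (1 : G) 1) X :=
  derivOne_eq_fderiv_chart (by simp) (mdifferentiable_conj g 1) X

/-- The map `g ↦ Ad g X`, with values in the model space of `G`. -/
def adOrbit (X : GroupLieAlgebra 𝓘(ℝ, E) G) (g : G) : E := Ad E g X

/-- In charts, g h g⁻¹ is jointly smooth in g and h near h = 1, so its derivative in h at 1 depends
smoothly on g. -/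
theorem contMDiff_Ad (X : GroupLieAlgebra 𝓘(ℝ, E) G) :
    ContMDiff 𝓘(ℝ, E) 𝓘(ℝ, E) ∞ (adOrbit X) := by
  intro x
  set c := chartAt E x
  set c₁ := chartAt E (1 : G)
  have hx : c x ∈ c.target := mem_chart_target E x
  have hsymm : ContMDiffAt 𝓘(ℝ, E) 𝓘(ℝ, E) ∞ c.symm (c x) :=
    contMDiffOn_chart_symm.contMDiffAt (c.open_target.mem_nhds hx)
  have hsymm₁ : ContMDiffAt 𝓘(ℝ, E) 𝓘(ℝ, E) ∞ c₁.symm (c₁ 1) :=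
    contMDiffOn_chart_symm.contMDiffAt (c₁.open_target.mem_nhds (mem_chart_target E 1))
  have h1 : ContMDiffAt 𝓘(ℝ, E × E) 𝓘(ℝ, E) ∞ (fun q : E × E => c.symm q.1) (c x, c₁ 1) :=
    hsymm.comp (c x, c₁ 1) (contDiff_fst.contMDiff.contMDiffAt)
  have h2 : ContMDiffAt 𝓘(ℝ, E × E) 𝓘(ℝ, E) ∞ (fun q : E × E => c₁.symm q.2) (c x, c₁ 1) :=
    hsymm₁.comp (c x, c₁ 1) (contDiff_snd.contMDiff.contMDiffAt)
  have h3 := (h1.mul h2).mul h1.inv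
  have h4 : ContMDiffAt 𝓘(ℝ, E) 𝓘(ℝ, E) ∞ c₁ (c.symm (c x) * c₁.symm (c₁ 1) * (c.symm (c x))⁻¹) := by
    rw [c₁.left_inv (mem_chart_source E 1), mul_one, mul_inv_cancel]
    exact contMDiffAt_of_mem_maximalAtlas (IsManifold.chart_mem_maximalAtlas _)
      (mem_chart_source E _)
  have h5 : ContMDiffAt 𝓘(ℝ, E × E) 𝓘(ℝ, E) ∞ (Function.uncurry fun y z : E =>
      c₁ (c.symm y * c₁.symm z * (c.symm y)⁻¹)) (c x, c₁ 1) := h4.comp (c x, c₁ 1) h3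
  rw [contMDiffAt_iff_contDiffAt] at h5
  have h6 : ContDiffAt ℝ ∞ (fun y => fderiv ℝ (fun z =>
      c₁ (c.symm y * c₁.symm z * (c.symm y)⁻¹)) (c₁ 1)) (c x) :=
    ContDiffAt.fderiv (f := fun y z : E => c₁ (c.symm y * c₁.symm z * (c.symm y)⁻¹))
      (g := fun _ => c₁ 1) (n := ∞) (m := ∞) h5 contDiffAt_const (by exact_mod_cast le_top)
  have h7 : ContDiffAt ℝ ∞ (fun y => fderiv ℝ (fun z =>
      c₁ (c.symm y * c₁.symm z * (c.symm y)⁻¹)) (c₁ 1) X) (c x) := h6.clm_apply contDiffAt_const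
  have h8 := h7.contMDiffAt.comp x (contMDiffAt_of_mem_maximalAtlas (n := ∞)
    (IsManifold.chart_mem_maximalAtlas (I := 𝓘(ℝ, E)) x) (mem_chart_source E x))
  refine h8.congr_of_eventuallyEq ?_
  filter_upwards [c.open_source.mem_nhds (mem_chart_source E x)] with g hg
  rw [adOrbit, Ad_eq_fderiv]
  simp only [Function.comp]
  rw [c.left_inv hg]

theorem mdifferentiableAt_Ad (X : GroupLieAlgebra 𝓘(ℝ, E) G) (g : G) :
    MDifferentiableAt 𝓘(ℝ, E) 𝓘(ℝ, E) (adOrbit X) g :=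
  (contMDiff_Ad X).mdifferentiable (by simp) g

/-- The derivative of `g ↦ Ad g Y` at the unit in the direction `X`. -/
def adDeriv (X Y : GroupLieAlgebra 𝓘(ℝ, E) G) : GroupLieAlgebra 𝓘(ℝ, E) G :=
  derivOne E (adOrbit Y) X

omit [LieGroup 𝓘(ℝ, E) ∞ G] in
theorem adDeriv_add_left (X X' Y : GroupLieAlgebra 𝓘(ℝ, E) G) :
    adDeriv (X + X') Y = adDeriv X Y + adDeriv X' Y :=
  map_add (derivOne E (adOrbit Y)) X X'

omit [LieGroup 𝓘(ℝ, E) ∞ G] in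
theorem adDeriv_smul_left (c : ℝ) (X Y : GroupLieAlgebra 𝓘(ℝ, E) G) :
    adDeriv (c • X) Y = c • adDeriv X Y :=
  map_smul (derivOne E (adOrbit Y)) c X

theorem adDeriv_add_right (X Y Y' : GroupLieAlgebra 𝓘(ℝ, E) G) :
    adDeriv X (Y + Y') = adDeriv X Y + adDeriv X Y' := by
  have h := derivOne_add (mdifferentiableAt_Ad Y 1) (mdifferentiableAt_Ad Y' 1) X
  refine Eq.trans ?_ h
  have h2 : adOrbit (Y + Y') = fun g => adOrbit Y g + adOrbit Y' g := by
    funext g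
    exact map_add (Ad E g) Y Y'
  rw [adDeriv, h2]

theorem adDeriv_smul_right (c : ℝ) (X Y : GroupLieAlgebra 𝓘(ℝ, E) G) :
    adDeriv X (c • Y) = c • adDeriv X Y := by
  have h := derivOne_clm_comp (mdifferentiableAt_Ad Y 1) (c • ContinuousLinearMap.id ℝ E) X
  refine Eq.trans ?_ h
  have h2 : adOrbit (c • Y) = fun g => (c • ContinuousLinearMap.id ℝ E) (adOrbit Y g) := by
    funext g
    exact map_smul (Ad E g) c Y
  rw [adDeriv, h2]

variable [FiniteDimensional ℝ E]

/-- Differentiate Ad t (Ad g Y) = Ad (t g t⁻¹) (Ad t Y) in g at the unit. -/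
theorem Ad_adDeriv (t : G) (X Y : GroupLieAlgebra 𝓘(ℝ, E) G) :
    Ad E t (adDeriv X Y) = adDeriv (Ad E t X) (Ad E t Y) := by
  have h1 := derivOne_clm_comp (mdifferentiableAt_Ad Y 1)
    (LinearMap.toContinuousLinearMap (E := E) (F' := E) (Ad E t)) X
  have h2 := derivOne_comp_conj (mdifferentiableAt_Ad (Ad E t Y) 1) t X
  refine Eq.trans (Eq.trans h1.symm ?_) h2
  congr 1
  congr 1
  funext g
  change Ad E t (Ad E g Y) = Ad E (t * g * t⁻¹) (Ad E t Y)
  rw [Ad_mul, Ad_mul, Ad_inv_Ad]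

/-- A version of the commutator of `X` and `Y` which is antisymmetric by construction; it is twice
the Lie bracket. -/
def commTwo (X Y : GroupLieAlgebra 𝓘(ℝ, E) G) : GroupLieAlgebra 𝓘(ℝ, E) G :=
  adDeriv X Y - adDeriv Y X

theorem Ad_commTwo (t : G) (X Y : GroupLieAlgebra 𝓘(ℝ, E) G) :
    Ad E t (commTwo X Y) = commTwo (Ad E t X) (Ad E t Y) := by
  rw [commTwo, map_sub, Ad_adDeriv, Ad_adDeriv, commTwo]

omit [FiniteDimensional ℝ E] in
-- An antisymmetric bilinear map is multiplied by the determinant a² + b² of the rotation. Hence the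
-- commutator of a rotation pair is fixed by the torus.
theorem commTwo_rotation {a b : ℝ} (hab : a ^ 2 + b ^ 2 = 1) (X Y : GroupLieAlgebra 𝓘(ℝ, E) G) :
    commTwo (a • X - b • Y) (b • X + a • Y) = commTwo X Y := by
  rw [sub_eq_add_neg, ← neg_smul]
  simp only [commTwo, adDeriv_add_left, adDeriv_add_right, adDeriv_smul_left, adDeriv_smul_right]
  have h : commTwo X Y = (a ^ 2 + b ^ 2) • (adDeriv X Y - adDeriv Y X) := by
    rw [hab, one_smul, commTwo]
  rw [commTwo] at h
  rw [h]
  module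

variable {𝔸 : Type*} [NormedRing 𝔸] [NormedAlgebra ℝ 𝔸] {A : G →* 𝔸}

omit [FiniteDimensional ℝ E] in
theorem derivOne_hom_Ad (hA : ContMDiff 𝓘(ℝ, E) 𝓘(ℝ, 𝔸) ∞ A) (g : G)
    (X : GroupLieAlgebra 𝓘(ℝ, E) G) :
    derivOne 𝔸 A (Ad E g X) = A g * derivOne 𝔸 A X * A g⁻¹ := by
  have hd : MDifferentiableAt 𝓘(ℝ, E) 𝓘(ℝ, 𝔸) A 1 := hA.mdifferentiable (by simp) 1
  rw [← derivOne_comp_conj hd g X]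
  have h := derivOne_clm_comp hd (ContinuousLinearMap.mulLeftRight ℝ 𝔸 (A g) (A g⁻¹)) X
  refine Eq.trans ?_ (h.trans ?_)
  · congr 1
    congr 1
    funext x
    simp
  · simp

/-- Differentiate A(g) dA(Y) = dA(Ad g Y) A(g) at g = 1 in the direction X. -/
theorem derivOne_hom_commutator (hA : ContMDiff 𝓘(ℝ, E) 𝓘(ℝ, 𝔸) ∞ A)
    (X Y : GroupLieAlgebra 𝓘(ℝ, E) G) :
    derivOne 𝔸 A X * derivOne 𝔸 A Y - derivOne 𝔸 A Y * derivOne 𝔸 A X =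
      derivOne 𝔸 A (adDeriv X Y) := by
  have hd : MDifferentiableAt 𝓘(ℝ, E) 𝓘(ℝ, 𝔸) A 1 := hA.mdifferentiable (by simp) 1
  have hAd : MDifferentiableAt 𝓘(ℝ, E) 𝓘(ℝ, 𝔸) (fun g : G => derivHom A (adOrbit Y g)) 1 :=
    ((derivHom A).contMDiff.comp (contMDiff_Ad Y)).mdifferentiable (n := ∞) (by simp) 1
  have h1 := derivOne_mul hd (mdifferentiableAt_const (c := derivOne 𝔸 A Y)) X
  have h2 := derivOne_mul hAd hd X
  have h3 := derivOne_clm_comp (mdifferentiableAt_Ad Y 1) (derivHom A) X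
  have h4 : (fun g => A g * derivOne 𝔸 A Y) = fun g => derivHom A (adOrbit Y g) * A g := by
    funext g
    change _ = derivOne 𝔸 A (Ad E g Y) * A g
    rw [derivOne_hom_Ad hA, mul_assoc, ← map_mul, inv_mul_cancel, map_one, mul_one]
  have h5 : derivOne (E := E) (G := G) 𝔸 (fun _ => derivOne 𝔸 A Y) X = 0 :=
    congrArg (fun L : E →L[ℝ] 𝔸 => L X)
      (mfderiv_const (I := 𝓘(ℝ, E)) (I' := 𝓘(ℝ, 𝔸)) (x := (1 : G)) (c := derivOne 𝔸 A Y))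
  rw [h4, h2, h3, h5, mul_zero, add_zero, map_one, mul_one] at h1
  have h6 : derivHom A (adOrbit Y (1 : G)) = derivOne 𝔸 A Y := by
    change derivOne 𝔸 A (Ad E (1 : G) Y) = _
    rw [Ad_one]
  rw [h6] at h1
  rw [← h1]
  exact add_sub_cancel_right _ _

theorem derivOne_hom_commTwo (hA : ContMDiff 𝓘(ℝ, E) 𝓘(ℝ, 𝔸) ∞ A)
    (X Y : GroupLieAlgebra 𝓘(ℝ, E) G) :
    derivOne 𝔸 A (commTwo X Y) =
      2 * (derivOne 𝔸 A X * derivOne 𝔸 A Y - derivOne 𝔸 A Y * derivOne 𝔸 A X) := by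
  rw [commTwo, map_sub, ← derivOne_hom_commutator hA, ← derivOne_hom_commutator hA]
  noncomm_ring

end Adjoint

/-! ### One-parameter subgroups -/

theorem hasDerivAt_of_hasFDerivAt_smulRight {E V : Type*} [NormedAddCommGroup E] [NormedSpace ℝ E]
    [NormedAddCommGroup V] [NormedSpace ℝ V] {f : ℝ → V} {D : E →L[ℝ] V} {w : E} {d : V} {s : ℝ}
    (h : HasFDerivAt f (D.comp ((1 : ℝ →L[ℝ] ℝ).smulRight w)) s) (hd : D w = d) :
    HasDerivAt f d s := by
  have h1 := h.hasDerivAt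
  simpa [hd] using h1

section OneParameter

variable {E : Type*} [NormedAddCommGroup E] [NormedSpace ℝ E]
  {G : Type*} [TopologicalSpace G] [ChartedSpace E G] [Group G] [LieGroup 𝓘(ℝ, E) ∞ G]

omit [Group G] [LieGroup 𝓘(ℝ, E) ∞ G] in
theorem mfderiv_congr_point_apply {V : Type*} [NormedAddCommGroup V] [NormedSpace ℝ V]
    {N : Type*} [TopologicalSpace N] [ChartedSpace V N] {f : G → N} {a b : G} (hab : a = b) (X : E) :
    (mfderiv 𝓘(ℝ, E) 𝓘(ℝ, V) f a : E →L[ℝ] V) X = (mfderiv 𝓘(ℝ, E) 𝓘(ℝ, V) f b : E →L[ℝ] V) X := by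
  subst hab
  rfl

theorem mdifferentiable_mul_left' (g : G) : MDifferentiable 𝓘(ℝ, E) 𝓘(ℝ, E) fun x : G => g * x :=
  (contMDiff_mul_left (n := ∞)).mdifferentiable (by simp)

omit [LieGroup 𝓘(ℝ, E) ∞ G] in
/-- The value at `g` of the left-invariant vector field given by `v`. -/
def invariantVec (v : GroupLieAlgebra 𝓘(ℝ, E) G) (g : G) : E := mulInvariantVectorField v g

omit [LieGroup 𝓘(ℝ, E) ∞ G] in
theorem mfderiv_invariantVec_of_eq_one {V : Type*} [NormedAddCommGroup V] [NormedSpace ℝ V]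
    (f : G → V) (v : GroupLieAlgebra 𝓘(ℝ, E) G) {a : G} (ha : a = 1) :
    (mfderiv 𝓘(ℝ, E) 𝓘(ℝ, V) f a : E →L[ℝ] V) (invariantVec (E := E) v a) = derivOne V f v := by
  subst ha
  have h : (fun x : G => 1 * x) = id := funext one_mul
  have h1 : invariantVec (E := E) v (1 : G) = v := by
    rw [invariantVec, mulInvariantVectorField, h]
    exact congrArg (fun L : E →L[ℝ] E => L v) (mfderiv_id (I := 𝓘(ℝ, E)) (x := (1 : G)))
  rw [h1]
  rfl

/-- The intertwining form covers both cases needed: left translations, with ψ the identity, and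
conjugations by elements whose adjoint action fixes `v`, with φ = ψ. -/
theorem mfderiv_mulInvariantVectorField {φ ψ : G → G} (hφ : MDifferentiable 𝓘(ℝ, E) 𝓘(ℝ, E) φ)
    (hψ : MDifferentiable 𝓘(ℝ, E) 𝓘(ℝ, E) ψ) (hψ1 : ψ 1 = 1)
    (h : ∀ g x, φ (g * x) = φ g * ψ x) {v : GroupLieAlgebra 𝓘(ℝ, E) G}
    (hv : derivOne E ψ v = v) (g : G) :
    (mfderiv 𝓘(ℝ, E) 𝓘(ℝ, E) φ g : E →L[ℝ] E) (invariantVec (E := E) v g) =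
      invariantVec (E := E) v (φ g) := by
  have h1 := mfderiv_comp (I := 𝓘(ℝ, E)) (I' := 𝓘(ℝ, E)) (I'' := 𝓘(ℝ, E)) (1 : G)
    (g := φ) (f := fun x => g * x) (hφ _) (mdifferentiable_mul_left' g 1)
  have h2 := mfderiv_comp (I := 𝓘(ℝ, E)) (I' := 𝓘(ℝ, E)) (I'' := 𝓘(ℝ, E)) (1 : G)
    (g := fun x => φ g * x) (f := ψ) (mdifferentiable_mul_left' (φ g) _) (hψ 1)
  have h3 : φ ∘ (fun x => g * x) = (fun x => φ g * x) ∘ ψ := funext fun x => h g x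
  rw [h3] at h1
  have h4 := congrArg (fun L : E →L[ℝ] E => L v) (h1.symm.trans h2)
  refine (mfderiv_congr_point_apply (V := E) (f := φ) (mul_one g).symm
    (invariantVec (E := E) v g)).trans (h4.trans ?_)
  refine (mfderiv_congr_point_apply (V := E) (f := fun x => φ g * x) hψ1 (derivOne E ψ v)).trans ?_
  rw [hv]
  rfl

theorem isMIntegralCurve_map {φ ψ : G → G} (hφ : MDifferentiable 𝓘(ℝ, E) 𝓘(ℝ, E) φ)
    (hψ : MDifferentiable 𝓘(ℝ, E) 𝓘(ℝ, E) ψ) (hψ1 : ψ 1 = 1)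
    (h : ∀ g x, φ (g * x) = φ g * ψ x) {v : GroupLieAlgebra 𝓘(ℝ, E) G}
    (hv : derivOne E ψ v = v) {γ : ℝ → G} {s : Set ℝ}
    (hγ : IsMIntegralCurveOn (I := 𝓘(ℝ, E)) γ (mulInvariantVectorField v) s) :
    IsMIntegralCurveOn (I := 𝓘(ℝ, E)) (φ ∘ γ) (mulInvariantVectorField v) s := by
  intro t ht
  have h1 := (hφ (γ t)).hasMFDerivAt.comp_hasMFDerivWithinAt t (hγ t ht)
  refine h1.congr_mfderiv ?_
  refine ContinuousLinearMap.ext fun (c : ℝ) => ?_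
  refine (map_smul (mfderiv 𝓘(ℝ, E) 𝓘(ℝ, E) φ (γ t) : E →L[ℝ] E) c
    (invariantVec (E := E) v (γ t))).trans ?_
  exact congrArg (fun w : E => c • w) (mfderiv_mulInvariantVectorField hφ hψ hψ1 h hv (γ t))

theorem isMIntegralCurve_mul_left (g : G) {v : GroupLieAlgebra 𝓘(ℝ, E) G} {γ : ℝ → G} {s : Set ℝ}
    (hγ : IsMIntegralCurveOn (I := 𝓘(ℝ, E)) γ (mulInvariantVectorField v) s) :
    IsMIntegralCurveOn (I := 𝓘(ℝ, E)) ((fun x => g * x) ∘ γ) (mulInvariantVectorField v) s :=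
  isMIntegralCurve_map (mdifferentiable_mul_left' g) mdifferentiable_id rfl
    (fun a x => (mul_assoc g a x).symm)
    (congrArg (fun L : E →L[ℝ] E => L v) (mfderiv_id (I := 𝓘(ℝ, E)) (x := (1 : G)))) hγ

theorem isMIntegralCurve_conj {g : G} {v : GroupLieAlgebra 𝓘(ℝ, E) G} (hv : Ad E g v = v)
    {γ : ℝ → G} {s : Set ℝ}
    (hγ : IsMIntegralCurveOn (I := 𝓘(ℝ, E)) γ (mulInvariantVectorField v) s) :
    IsMIntegralCurveOn (I := 𝓘(ℝ, E)) ((fun x => g * x * g⁻¹) ∘ γ)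
      (mulInvariantVectorField v) s :=
  isMIntegralCurve_map (mdifferentiable_conj (E := E) g) (mdifferentiable_conj (E := E) g) (by simp)
    (fun a x => by group) hv hγ

theorem contMDiff_one_mulInvariantVectorField (v : GroupLieAlgebra 𝓘(ℝ, E) G) :
    ContMDiff 𝓘(ℝ, E) 𝓘(ℝ, E).tangent 1
      (fun g : G => (⟨g, mulInvariantVectorField v g⟩ : TangentBundle 𝓘(ℝ, E) G)) := by
  have : LieGroup 𝓘(ℝ, E) (minSmoothness ℝ 3) G := by
    rw [minSmoothness_of_isRCLikeNormedField]
    infer_instance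
  refine (contMDiff_mulInvariantVectorField v).of_le ?_
  rw [minSmoothness_of_isRCLikeNormedField]
  exact one_le_two

variable [FiniteDimensional ℝ E] [T2Space G]

/-- The one-parameter subgroup with a given derivative. -/
theorem exists_oneParameterSubgroup (v : GroupLieAlgebra 𝓘(ℝ, E) G) :
    ∃ γ : ℝ → G, Continuous γ ∧ γ 0 = 1 ∧ (∀ s t, γ (s + t) = γ s * γ t) ∧
      (∀ g : G, Ad E g v = v → ∀ s, g * γ s = γ s * g) ∧
      ∀ {V : Type} [NormedAddCommGroup V] [NormedSpace ℝ V] (f : G → V),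
        MDifferentiableAt 𝓘(ℝ, E) 𝓘(ℝ, V) f 1 →
        HasDerivAt (fun s => f (γ s)) (derivOne V f v) 0 := by
  have : IsManifold 𝓘(ℝ, E) 1 G := IsManifold.of_le (n := ∞) (by simp)
  have : CompleteSpace E := FiniteDimensional.complete ℝ E
  have hv := contMDiff_one_mulInvariantVectorField v
  obtain ⟨γ₀, h₀, hγ₀⟩ := exists_isMIntegralCurveAt_of_contMDiffAt_boundaryless
    (t₀ := 0) (hv (1 : G))
  obtain ⟨ε, hε, hγ₀⟩ := isMIntegralCurveAt_iff'.1 hγ₀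
  -- Left translates of one local integral curve exist for the same time ε from every point, so the
  -- left-invariant field is complete.
  have hloc : ∀ x : G, ∃ γ : ℝ → G, γ 0 = x ∧
      IsMIntegralCurveOn (I := 𝓘(ℝ, E)) γ (mulInvariantVectorField v) (Set.Ioo (-ε) ε) := fun x => by
    refine ⟨(fun y => x * y) ∘ γ₀, by simp [h₀], ?_⟩
    have := isMIntegralCurve_mul_left x hγ₀
    rwa [Real.ball_eq_Ioo, zero_sub, zero_add] at this
  obtain ⟨γ, hγ0, hγ⟩ := exists_isMIntegralCurve_of_isMIntegralCurveOn hv hε hloc 1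
  have huniq : ∀ γ' : ℝ → G, IsMIntegralCurve (I := 𝓘(ℝ, E)) γ' (mulInvariantVectorField v) →
      ∀ γ'' : ℝ → G, IsMIntegralCurve (I := 𝓘(ℝ, E)) γ'' (mulInvariantVectorField v) →
      γ' 0 = γ'' 0 → γ' = γ'' := fun γ' h' γ'' h'' h =>
    isMIntegralCurve_Ioo_eq_of_contMDiff_boundaryless (t₀ := 0) hv h' h'' h
  have hγu := isMIntegralCurve_iff_isMIntegralCurveOn.1 hγ
  refine ⟨γ, continuous_iff_continuousAt.2 fun t => (hγ t).continuousAt, hγ0, fun s t => ?_,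
    fun g hg s => ?_, fun {V} _ _ f hf => ?_⟩
  · have h1 := huniq (γ ∘ (· + s)) (hγ.comp_add s) ((fun x => γ s * x) ∘ γ)
      (isMIntegralCurve_iff_isMIntegralCurveOn.2 (isMIntegralCurve_mul_left (γ s) hγu))
      (by simp [hγ0])
    have h2 := congrFun h1 t
    simp only [Function.comp] at h2
    rw [add_comm, h2]
  · have h1 := huniq ((fun x => g * x * g⁻¹) ∘ γ)
      (isMIntegralCurve_iff_isMIntegralCurveOn.2 (isMIntegralCurve_conj hg hγu)) γ hγ
      (by simp [hγ0])
    have h2 := congrFun h1 s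
    simp only [Function.comp] at h2
    exact mul_inv_eq_iff_eq_mul.1 h2
  · have h1 := hγ 0
    have h2 : HasFDerivAt (f ∘ γ) ((mfderiv 𝓘(ℝ, E) 𝓘(ℝ, V) f (γ 0) : E →L[ℝ] V).comp
        ((1 : ℝ →L[ℝ] ℝ).smulRight (invariantVec (E := E) v (γ 0)))) 0 := ((hγ0.symm ▸ hf :
      MDifferentiableAt 𝓘(ℝ, E) 𝓘(ℝ, V) f (γ 0)).hasMFDerivAt.comp 0 h1).hasFDerivAt
    exact hasDerivAt_of_hasFDerivAt_smulRight (E := E) (V := V) (D := mfderiv 𝓘(ℝ, E) 𝓘(ℝ, V) f (γ 0))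
      (w := invariantVec (E := E) v (γ 0)) h2 (mfderiv_invariantVec_of_eq_one f v hγ0)

end OneParameter

/-! ### The weights of a torus -/

section TorusWeights

open UnitAddTorus

variable {F : Type*} [NormedAddCommGroup F] [NormedSpace ℝ F]
  {T : Type*} [TopologicalSpace T] [ChartedSpace F T] [CommGroup T] {r : ℕ}
  {p : (Fin r → ℝ) → T}

/-- The character `x ↦ exp (2πi ⟨n, x⟩)` of `ℝ^r`. -/
def circleChar (n : Fin r → ℤ) (x : Fin r → ℝ) : Circle :=
  Circle.exp (2 * Real.pi * ∑ i, n i * x i)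

theorem circleChar_add (n : Fin r → ℤ) (x y : Fin r → ℝ) :
    circleChar n (x + y) = circleChar n x * circleChar n y := by
  simp only [circleChar, Pi.add_apply, mul_add, Finset.sum_add_distrib, Circle.exp_add]

theorem coe_circleChar (n : Fin r → ℤ) (x : Fin r → ℝ) :
    (circleChar n x : ℂ) = mFourier n (torusProj x) := by
  rw [mFourier_torusProj, circleChar, Circle.coe_exp]
  congr 1
  push_cast
  ring

theorem circleChar_intCast (n m : Fin r → ℤ) : circleChar n (fun i => (m i : ℝ)) = 1 := by
  have h : (2 * Real.pi * ∑ i, (n i : ℝ) * (m i : ℝ)) = (∑ i, n i * m i : ℤ) * (2 * Real.pi) := by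
    push_cast
    ring
  rw [circleChar, h, Circle.exp_eq_one]
  exact ⟨_, rfl⟩

theorem contMDiff_circleChar (n : Fin r → ℤ) :
    ContMDiff 𝓘(ℝ, Fin r → ℝ) (𝓡 1) ∞ (circleChar n) := by
  refine contMDiff_circleExp.comp (ContDiff.contMDiff ?_)
  fun_prop

section
variable (hp : IsTorusParam F p)
include hp

theorem IsTorusParam.exists_eq_add_intCast {x y : Fin r → ℝ} (h : p x = p y) :
    ∃ m : Fin r → ℤ, x = y + fun i => (m i : ℝ) := by
  have h1 : p (x - y) = 1 := by
    have := hp.map_add (x - y) y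
    rw [sub_add_cancel, h] at this
    exact (right_eq_mul.1 this)
  obtain ⟨m, hm⟩ := (hp.ker _).1 h1
  exact ⟨m, by rw [← hm, add_sub_cancel]⟩

theorem circleChar_eq_of_eq (n : Fin r → ℤ) {x y : Fin r → ℝ} (h : p x = p y) :
    circleChar n x = circleChar n y := by
  obtain ⟨m, rfl⟩ := hp.exists_eq_add_intCast h
  rw [circleChar_add, circleChar_intCast, mul_one]

end

/-- The weight of the torus with given coordinates. -/
def torusWeight (hp : IsTorusParam F p) (n : Fin r → ℤ) : Weight F T where
  toFun t := circleChar n (hp.surjective t).choose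
  map_one' := by
    rw [circleChar_eq_of_eq hp n ((hp.surjective 1).choose_spec.trans hp.map_zero.symm)]
    simp [circleChar]
  map_mul' s t := by
    rw [← circleChar_add]
    refine circleChar_eq_of_eq hp n ?_
    rw [hp.map_add, (hp.surjective _).choose_spec, (hp.surjective _).choose_spec,
      (hp.surjective _).choose_spec]
  contMDiff_toFun := by
    intro t
    obtain ⟨x, rfl⟩ := hp.surjective t
    -- A local inverse of `p` is a smooth lift; it differs from the chosen lift by lattice vectors,
    -- which the character does not see.
    obtain ⟨Φ, hx, hΦ⟩ := hp.isLocalDiffeomorph x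
    have h1 : Φ x ∈ Φ.target := Φ.map_source hx
    have h2 : ContMDiffAt 𝓘(ℝ, F) (𝓡 1) ∞ (circleChar n ∘ Φ.symm) (p x) := by
      refine (contMDiff_circleChar n).contMDiffAt.comp _ ?_
      rw [hΦ hx]
      exact Φ.contMDiffOn_invFun.contMDiffAt (Φ.open_target.mem_nhds h1)
    refine h2.congr_of_eventuallyEq ?_
    rw [hΦ hx]
    filter_upwards [Φ.open_target.mem_nhds h1] with s hs
    refine circleChar_eq_of_eq hp n ?_
    rw [(hp.surjective s).choose_spec]
    exact ((hΦ (Φ.map_target hs)).trans (Φ.right_inv hs)).symm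

theorem torusWeight_apply (hp : IsTorusParam F p) (n : Fin r → ℤ) (x : Fin r → ℝ) :
    torusWeight hp n (p x) = circleChar n x :=
  circleChar_eq_of_eq hp n (hp.surjective _).choose_spec

theorem coe_torusWeight_torusMap (hp : IsTorusParam F p) (n : Fin r → ℤ)
    (t : UnitAddTorus (Fin r)) : (torusWeight hp n (torusMap p t) : ℂ) = mFourier n t := by
  obtain ⟨x, rfl⟩ := surjective_torusProj t
  rw [torusMap_torusProj hp, torusWeight_apply, coe_circleChar]

theorem Weight.continuous_coe (χ : Weight F T) : Continuous fun t => (χ t : ℂ) :=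
  χ.toSmoothFn.contMDiff.continuous

theorem exists_weightCoord (hp : IsTorusParam F p) (χ : Weight F T) :
    ∃ n : Fin r → ℤ, ∀ t, (χ (torusMap p t) : ℂ) = mFourier n t := by
  refine exists_eq_mFourier (χ.continuous_coe.comp (continuous_torusMap hp)) ?_ fun s t => ?_
  · exact Circle.coe_ne_zero _
  · rw [torusMap_add hp, map_mul, Circle.coe_mul]

/-- The coordinates of a weight of the torus. -/
def weightCoord (hp : IsTorusParam F p) (χ : Weight F T) : Fin r → ℤ :=
  (exists_weightCoord hp χ).choose

theorem coe_weight_torusMap (hp : IsTorusParam F p) (χ : Weight F T) (t : UnitAddTorus (Fin r)) :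
    (χ (torusMap p t) : ℂ) = mFourier (weightCoord hp χ) t :=
  (exists_weightCoord hp χ).choose_spec t

theorem weightCoord_injective (hp : IsTorusParam F p) :
    Function.Injective (weightCoord hp) := fun χ ν h => by
  refine DFunLike.ext _ _ fun s => ?_
  obtain ⟨t, rfl⟩ := surjective_torusMap hp s
  refine Circle.ext ?_
  rw [coe_weight_torusMap hp, coe_weight_torusMap hp, h]

theorem mFourier_injective {m n : Fin r → ℤ} (h : ∀ t, mFourier m t = mFourier n t) : m = n := by
  have h1 : mFourierCoeff (mFourier m) m = mFourierCoeff (mFourier n) m :=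
    congrArg (fun f : C(UnitAddTorus (Fin r), ℂ) => mFourierCoeff f m) (ContinuousMap.ext h)
  rw [mFourierCoeff_mFourier, mFourierCoeff_mFourier, if_pos rfl] at h1
  by_contra hne
  rw [if_neg hne] at h1
  exact one_ne_zero h1

theorem weightCoord_torusWeight (hp : IsTorusParam F p) (n : Fin r → ℤ) :
    weightCoord hp (torusWeight hp n) = n :=
  mFourier_injective fun t => by
    rw [← coe_weight_torusMap hp, coe_torusWeight_torusMap]

/-- The tangent vector of the torus at the unit with given coordinates. -/
def torusTangent (F : Type*) [NormedAddCommGroup F] [NormedSpace ℝ F] [ChartedSpace F T]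
    (p : (Fin r → ℝ) → T) (y : Fin r → ℝ) : GroupLieAlgebra 𝓘(ℝ, F) T :=
  (mfderiv 𝓘(ℝ, Fin r → ℝ) 𝓘(ℝ, F) p 0 : (Fin r → ℝ) →L[ℝ] F) y

theorem derivOne_torusTangent {V : Type*} [NormedAddCommGroup V] [NormedSpace ℝ V]
    (hp : IsTorusParam F p) {f : T → V} (hf : MDifferentiableAt 𝓘(ℝ, F) 𝓘(ℝ, V) f 1)
    (y : Fin r → ℝ) :
    derivOne V f (torusTangent F p y) = fderiv ℝ (fun x => f (p x)) 0 y := by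
  have h0 := hp.map_zero
  have hf' : MDifferentiableAt 𝓘(ℝ, F) 𝓘(ℝ, V) f (p 0) := by rwa [h0]
  have h1 := mfderiv_comp (I := 𝓘(ℝ, Fin r → ℝ)) (I' := 𝓘(ℝ, F)) (I'' := 𝓘(ℝ, V)) (0 : Fin r → ℝ)
    hf' (hp.contMDiff.mdifferentiable (by simp) 0)
  rw [mfderiv_eq_fderiv] at h1
  have h2 := congrArg (fun L : (Fin r → ℝ) →L[ℝ] V => L y) h1
  refine Eq.trans ?_ h2.symm
  exact (mfderiv_congr_point_apply (E := F) (V := V) (f := f) h0 (torusTangent F p y)).symm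

theorem derivOne_weight_torusTangent (hp : IsTorusParam F p) (χ : Weight F T) (y : Fin r → ℝ) :
    derivOne ℂ (fun t : T => (χ t : ℂ)) (torusTangent F p y) =
      2 * Real.pi * Complex.I * ∑ i, weightCoord hp χ i * (y i : ℂ) := by
  have h1 := derivOne_torusTangent hp (χ.toSmoothFn.contMDiff.mdifferentiable (by simp) 1) y
  have h2 : (fun x => χ.toSmoothFn (p x)) = fun x : Fin r → ℝ =>
      Complex.exp (2 * Real.pi * Complex.I * ((∑ i, weightCoord hp χ i * x i : ℝ) : ℂ)) := by
    funext x
    rw [← mFourier_torusProj, ← coe_weight_torusMap hp, torusMap_torusProj hp]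
    rfl
  let q : (Fin r → ℝ) →L[ℝ] ℂ := ∑ i, (weightCoord hp χ i : ℂ) •
    Complex.ofRealCLM.comp (ContinuousLinearMap.proj (R := ℝ) (φ := fun _ : Fin r => ℝ) i)
  have h3 : ∀ x : Fin r → ℝ, ((∑ i, weightCoord hp χ i * x i : ℝ) : ℂ) = q x := fun x => by
    simp [q]
  have h4 := ((q.hasFDerivAt (x := 0)).const_mul (2 * Real.pi * Complex.I)).cexp.fderiv
  simp only [h2, h3] at h1
  refine (h1.trans (congrArg (fun L : (Fin r → ℝ) →L[ℝ] ℂ => L y) h4)).trans ?_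
  simp [q]

/-- Evaluation on these tangent vectors turns identities between linear forms, such as ν = λ + ρ,
into identities between integer coordinates. -/
theorem toDual_torusTangent_single (hp : IsTorusParam F p) (χ : Weight F T) (j : Fin r) :
    χ.toDual (torusTangent F p (Pi.single j 1)) = weightCoord hp χ j := by
  rw [Weight.toDual, LinearMap.smul_apply, LinearMap.comp_apply,
    derivOne_weight_torusTangent hp χ,
    Finset.sum_eq_single j (fun i _ hi => by simp [hi]) (by simp)]
  simp [mul_assoc, Real.pi_ne_zero]

theorem toDual_injective (hp : IsTorusParam F p) :
    Function.Injective (Weight.toDual (F := F) (T := T)) := fun χ ν h => by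
  refine weightCoord_injective hp (funext fun j => ?_)
  have h1 := toDual_torusTangent_single hp χ j
  rw [h, toDual_torusTangent_single hp ν j] at h1
  exact_mod_cast h1.symm

/-- A shift of the weights by a fixed linear form changes the size of the coordinates by a bounded
factor. -/
theorem exists_one_add_norm_weightCoord_le (hp : IsTorusParam F p)
    (q : Module.Dual ℝ (GroupLieAlgebra 𝓘(ℝ, F) T)) :
    ∃ C : ℝ, 0 ≤ C ∧ ∀ χ ν : Weight F T, ν.toDual = χ.toDual + q →
      1 + ‖weightCoord hp χ‖ ≤ C * (1 + ‖weightCoord hp ν‖) := by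
  let c : Fin r → ℝ := fun j => q (torusTangent F p (Pi.single j 1))
  refine ⟨1 + ‖c‖, by positivity, fun χ ν h => ?_⟩
  have h1 : ‖weightCoord hp χ‖ ≤ ‖weightCoord hp ν‖ + ‖c‖ := by
    refine (pi_norm_le_iff_of_nonneg (by positivity)).2 fun j => ?_
    have h2 := congrArg (fun L => L (torusTangent F p (Pi.single j 1))) h
    rw [LinearMap.add_apply, toDual_torusTangent_single hp,
      toDual_torusTangent_single hp] at h2
    have h3 : ((weightCoord hp χ j : ℤ) : ℝ) = weightCoord hp ν j - c j := by
      rw [h2]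
      exact (add_sub_cancel_right _ _).symm
    rw [← Int.norm_cast_real, h3]
    refine (norm_sub_le _ _).trans (add_le_add ?_ (norm_le_pi_norm c j))
    rw [Int.norm_cast_real]
    exact norm_le_pi_norm (weightCoord hp ν) j
  nlinarith [norm_nonneg c, norm_nonneg (weightCoord hp ν)]

theorem toDual_of_forall_eq_inv {χ ν : Weight F T} (h : ∀ t, ν t = (χ t)⁻¹)
    (X : GroupLieAlgebra 𝓘(ℝ, F) T) : ν.toDual X = -χ.toDual X := by
  have h1 := derivOne_clm_comp (χ.toSmoothFn.contMDiff.mdifferentiable (by simp) 1)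
    (Complex.conjCLE : ℂ →L[ℝ] ℂ) X
  have h2 : (fun t => (Complex.conjCLE : ℂ →L[ℝ] ℂ) (χ.toSmoothFn t)) = fun t => (ν t : ℂ) := by
    funext t
    rw [h, Circle.coe_inv_eq_conj]
    rfl
  rw [h2] at h1
  rw [Weight.toDual, Weight.toDual, LinearMap.smul_apply, LinearMap.comp_apply, h1,
    LinearMap.smul_apply, LinearMap.comp_apply, ← smul_neg]
  rfl

theorem toDual_torusWeight_neg (hp : IsTorusParam F p) (n : Fin r → ℤ)
    (X : GroupLieAlgebra 𝓘(ℝ, F) T) :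
    (torusWeight hp (-n)).toDual X = -(torusWeight hp n).toDual X := by
  refine toDual_of_forall_eq_inv (fun t => ?_) X
  obtain ⟨t, rfl⟩ := surjective_torusMap hp t
  refine Circle.ext ?_
  rw [Circle.coe_inv, coe_torusWeight_torusMap, coe_torusWeight_torusMap]
  exact eq_inv_of_mul_eq_one_left (mFourier_neg_mul_self n t)

end TorusWeights

/-! ### Vectors of the Lie algebra that are fixed by a maximal torus -/

/-- Integration of the functional equation gives f(s) ∫_0^h f = ∫_s^{s+h} f, whose right side is
differentiable in s. Some h has ∫_0^h f ≠ 0, because the primitive of f has derivative f(0) = 1 at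
0. -/
theorem differentiable_of_map_add_eq_mul {f : ℝ → ℂ} (hf : Continuous f) (h0 : f 0 = 1)
    (hadd : ∀ s t, f (s + t) = f s * f t) : Differentiable ℝ f := by
  have hd : ∀ s, HasDerivAt (fun h => ∫ x in (0 : ℝ)..h, f x) (f s) s := fun s =>
    intervalIntegral.integral_hasDerivAt_right (hf.intervalIntegrable _ _)
      (hf.stronglyMeasurableAtFilter _ _) hf.continuousAt
  obtain ⟨h, hh⟩ : ∃ h : ℝ, ∫ x in (0 : ℝ)..h, f x ≠ 0 := by
    by_contra! hz
    have h1 := hd 0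
    simp only [hz] at h1
    have h2 := h1.unique (hasDerivAt_const 0 0)
    rw [h0] at h2
    exact one_ne_zero h2
  have h1 : f = fun s => ((∫ x in (0 : ℝ)..(s + h), f x) - ∫ x in (0 : ℝ)..s, f x) *
      (∫ x in (0 : ℝ)..h, f x)⁻¹ := by
    funext s
    rw [intervalIntegral.integral_interval_sub_left (hf.intervalIntegrable _ _)
      (hf.intervalIntegrable _ _)]
    have h2 : ∫ x in s..(s + h), f x = f s * ∫ x in (0 : ℝ)..h, f x := by
      rw [← intervalIntegral.integral_const_mul]
      simp only [← hadd]
      rw [intervalIntegral.integral_comp_add_left (fun x => f x) s, add_zero]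
    rw [h2, mul_assoc, mul_inv_cancel₀ hh, mul_one]
  rw [h1]
  have h3 : Differentiable ℝ fun s => ∫ x in (0 : ℝ)..s, f x := fun s =>
    (hd s).differentiableAt
  exact ((h3.comp (differentiable_id.add_const h)).sub h3).mul_const _

section Fixed

open UnitAddTorus

variable {E : Type*} [NormedAddCommGroup E] [NormedSpace ℝ E]
  {G : Type*} [TopologicalSpace G] [ChartedSpace E G] [Group G] [LieGroup 𝓘(ℝ, E) ∞ G] [T2Space G]
  {F : Type*} [NormedAddCommGroup F] [NormedSpace ℝ F]
  {T : Type*} [TopologicalSpace T] [ChartedSpace F T] [CommGroup T]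
  {ι : LieHom F T E G}

/-- A one-parameter subgroup commuting with a maximal torus is contained in it. -/
theorem IsMaximalTorus.mem_range_of_commute [ConnectedSpace T] (hι : IsMaximalTorus ι)
    {γ : Multiplicative ℝ →* G} (hγ : Continuous γ) (hc : ∀ t s, Commute (ι t) (γ s))
    (s : Multiplicative ℝ) : γ s ∈ ι.toMonoidHom.range := by
  have : IsTopologicalGroup G := topologicalGroup_of_lieGroup 𝓘(ℝ, E) ∞
  -- The closure of the image of Φ is closed, connected and commutative and contains the maximal
  -- torus, hence equals it.
  let Φ : T × Multiplicative ℝ →* G := ι.toMonoidHom.noncommCoprod γ hc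
  have hΦ : Continuous Φ := (ι.contMDiff_toFun.continuous.comp continuous_fst).mul
    (hγ.comp continuous_snd)
  have hcomm : ∀ x y : Φ.range, x * y = y * x := by
    rintro ⟨_, x, rfl⟩ ⟨_, y, rfl⟩
    refine Subtype.ext ?_
    change Φ x * Φ y = Φ y * Φ x
    rw [← map_mul, mul_comm, map_mul]
  have : ConnectedSpace (Multiplicative ℝ) := inferInstanceAs (ConnectedSpace ℝ)
  have hconn : IsConnected (Φ.range : Set G) := by
    rw [MonoidHom.coe_range]
    exact isConnected_range hΦ
  have hle : ι.toMonoidHom.range ≤ Φ.range.topologicalClosure := by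
    rintro _ ⟨t, rfl⟩
    refine Φ.range.le_topologicalClosure ⟨(t, 1), ?_⟩
    change ι t * γ 1 = ι t
    rw [map_one, mul_one]
  let _ := Subgroup.commGroupTopologicalClosure Φ.range hcomm
  refine hι.2.2 ⟨Φ.range.isClosed_topologicalClosure, hconn.closure, fun x hx y hy => ?_⟩ hle
    (Φ.range.le_topologicalClosure ⟨(1, s), ?_⟩)
  · exact congrArg Subtype.val
      (mul_comm (⟨x, hx⟩ : Φ.range.topologicalClosure) ⟨y, hy⟩)
  · change ι 1 * γ s = γ s
    rw [map_one, one_mul]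

variable [FiniteDimensional ℝ E] {r : ℕ} {p : (Fin r → ℝ) → T}

/-- A vector fixed by a maximal torus acts on the weight vectors by a linear function of the
weight. -/
theorem IsMaximalTorus.exists_derivOne_eq_smul (hp : IsTorusParam F p) (hι : IsMaximalTorus ι)
    {Z : GroupLieAlgebra 𝓘(ℝ, E) G} (hZ : ∀ t, Ad E (ι t) Z = Z) :
    ∃ a : Fin r → ℂ, ∀ {W : Type} [NormedAddCommGroup W] [NormedSpace ℂ W] (f : G → W) (w : W)
      (χ : Weight F T), MDifferentiableAt 𝓘(ℝ, E) 𝓘(ℝ, W) f 1 → (∀ t, f (ι t) = (χ t : ℂ) • w) →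
      derivOne W f Z = (∑ j, weightCoord hp χ j * a j) • w := by
  have := compactSpace_of_isTorusParam hp
  have := connectedSpace_of_isTorusParam hp
  obtain ⟨γ, hγ, hγ0, hγadd, hγc, hγd⟩ := exists_oneParameterSubgroup Z
  let γ' : Multiplicative ℝ →* G := ⟨⟨γ, hγ0⟩, hγadd⟩
  have h1 := hι.mem_range_of_commute (γ := γ') hγ fun t s => hγc _ (hZ t) s
  choose δ hδ using fun s : ℝ => h1 s
  have hιe : IsClosedEmbedding ι := ι.contMDiff_toFun.continuous.isClosedEmbedding hι.1
  replace hδ : ∀ s, ι (δ s) = γ s := hδ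
  have hδc : Continuous δ := by
    rw [hιe.isInducing.continuous_iff]
    exact hγ.congr fun s => (hδ s).symm
  have hδadd : ∀ s t, δ (s + t) = δ s * δ t := fun s t => hι.1 (by
    rw [map_mul, hδ, hδ, hδ, hγadd])
  have hδ0 : δ 0 = 1 := hι.1 (by rw [map_one, hδ, hγ0])
  -- These are the basic characters along the curve δ in the torus. Every weight is a product of
  -- their powers, so its logarithmic derivative at 0 is linear in the coordinates. Continuity of δ
  -- is enough, since a continuous homomorphism to ℂ is differentiable.
  let g : Fin r → ℝ → ℂ := fun j s => torusWeight hp (Pi.single j 1) (δ s)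
  have hg0 : ∀ j, g j 0 = 1 := fun j => by simp [g, hδ0]
  have hg : ∀ j, Differentiable ℝ (g j) := fun j =>
    differentiable_of_map_add_eq_mul ((Weight.continuous_coe _).comp hδc) (hg0 j) fun s t => by
      simp [g, hδadd]
  refine ⟨fun j => deriv (g j) 0, fun {W} _ _ f w χ hf hfw => ?_⟩
  have hχ : ∀ s, (χ (δ s) : ℂ) = ∏ j, g j s ^ weightCoord hp χ j := fun s => by
    obtain ⟨t, ht⟩ := surjective_torusMap hp (δ s)
    have hgj : ∀ j, g j s = fourier 1 (t j) := fun j => by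
      simp only [g, ← ht, coe_torusWeight_torusMap, mFourier, ContinuousMap.coe_mk]
      rw [Finset.prod_eq_single j (fun i _ hij => by rw [Pi.single_eq_of_ne hij, fourier_zero])
        (by simp), Pi.single_eq_same]
    simp only [hgj, ← ht, coe_weight_torusMap hp, mFourier, ContinuousMap.coe_mk]
    refine Finset.prod_congr rfl fun j _ => ?_
    simp [fourier_apply, AddCircle.toCircle_zsmul]
  have hd : HasDerivAt (fun s => (χ (δ s) : ℂ)) (∑ j, weightCoord hp χ j * deriv (g j) 0) 0 := by
    simp only [hχ]
    have h1 : ∀ j, HasDerivAt (fun s => g j s ^ weightCoord hp χ j)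
        (weightCoord hp χ j * deriv (g j) 0) 0 := fun j => by
      have h2 := hasDerivAt_zpow (weightCoord hp χ j) (g j 0)
        (Or.inl (by rw [hg0]; exact one_ne_zero))
      refine (h2.comp 0 (hg j 0).hasDerivAt).congr_deriv ?_
      simp [hg0]
    refine (HasDerivAt.fun_finsetProd (u := Finset.univ) fun j _ => h1 j).congr_deriv ?_
    simp [hg0]
  have h3 := hγd f hf
  have h4 : (fun s => f (γ s)) = fun s => (χ (δ s) : ℂ) • w := by
    funext s
    rw [← hδ, hfw]
  rw [h4] at h3
  exact h3.unique (hd.smul_const w)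

end Fixed

/-! ### Decomposition of the Lie algebra under a torus -/

section RootSpan

open UnitAddTorus

variable {E : Type*} [NormedAddCommGroup E] [NormedSpace ℝ E] [FiniteDimensional ℝ E]
  {G : Type*} [TopologicalSpace G] [ChartedSpace E G] [Group G] [LieGroup 𝓘(ℝ, E) ∞ G]
  {F : Type*} [NormedAddCommGroup F] [NormedSpace ℝ F]
  {T : Type*} [TopologicalSpace T] [ChartedSpace F T] [CommGroup T]
  {ι : LieHom F T E G} {r : ℕ} {p : (Fin r → ℝ) → T}

/-- The torus acts on `X` and `Y` by rotations, with the character of coordinates `n`: the vector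
`X + iY` belongs to this character. -/
def IsRotationPair (ι : LieHom F T E G) (p : (Fin r → ℝ) → T) (n : Fin r → ℤ)
    (X Y : GroupLieAlgebra 𝓘(ℝ, E) G) : Prop :=
  ∀ t, Ad E (ι (torusMap p t)) X = (mFourier n t).re • X - (mFourier n t).im • Y ∧
    Ad E (ι (torusMap p t)) Y = (mFourier n t).im • X + (mFourier n t).re • Y

omit [FiniteDimensional ℝ E] [LieGroup 𝓘(ℝ, E) ∞ G] in
theorem IsRotationPair.neg {n : Fin r → ℤ} {X Y : GroupLieAlgebra 𝓘(ℝ, E) G}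
    (h : IsRotationPair ι p n X Y) : IsRotationPair ι p (-n) X (-Y) := fun t => by
  obtain ⟨h1, h2⟩ := h t
  rw [map_neg, h1, h2, mFourier_neg, Complex.conj_re, Complex.conj_im]
  constructor <;> module

instance : FiniteDimensional ℝ (GroupLieAlgebra 𝓘(ℝ, E) G) :=
  inferInstanceAs (FiniteDimensional ℝ E)

/-- The function `t ↦ L (Ad t X)` on the torus. -/
def adCoeff (ι : LieHom F T E G) (p : (Fin r → ℝ) → T) (X : GroupLieAlgebra 𝓘(ℝ, E) G)
    (L : Module.Dual ℝ (GroupLieAlgebra 𝓘(ℝ, E) G)) (t : UnitAddTorus (Fin r)) : ℂ :=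
  L (Ad E (ι (torusMap p t)) X)

theorem continuous_adCoeff (hp : IsTorusParam F p) (X : GroupLieAlgebra 𝓘(ℝ, E) G)
    (L : Module.Dual ℝ (GroupLieAlgebra 𝓘(ℝ, E) G)) : Continuous (adCoeff ι p X L) := by
  let L' : E →ₗ[ℝ] ℝ := L
  have h1 : Continuous L' := L'.continuous_of_finiteDimensional
  exact Complex.continuous_ofReal.comp (h1.comp ((contMDiff_Ad X).continuous.comp
    (ι.contMDiff_toFun.continuous.comp (continuous_torusMap hp))))

/-- X' + iY' is the `n`-th Fourier coefficient of the vector-valued function t ↦ Ad t X. It is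
defined by duality: the coefficient of L(Ad t X) is linear in L, so its real and imaginary parts are
evaluations at vectors. -/
theorem exists_fourierPair (hp : IsTorusParam F p) (X : GroupLieAlgebra 𝓘(ℝ, E) G)
    (n : Fin r → ℤ) : ∃ X' Y' : GroupLieAlgebra 𝓘(ℝ, E) G, IsRotationPair ι p n X' Y' ∧
      ∀ L, mFourierCoeff (adCoeff ι p X L) n = L X' + L Y' * Complex.I := by
  let c : Module.Dual ℝ (GroupLieAlgebra 𝓘(ℝ, E) G) →ₗ[ℝ] ℂ :=
    { toFun := fun L => mFourierCoeff (adCoeff ι p X L) n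
      map_add' := fun L L' => by
        rw [← mFourierCoeff_add (continuous_adCoeff hp X L) (continuous_adCoeff hp X L')]
        congr 1
        funext t
        simp [adCoeff]
      map_smul' := fun a L => by
        rw [RingHom.id_apply, Complex.real_smul, ← mFourierCoeff_const_mul]
        congr 1
        funext t
        simp [adCoeff] }
  let ev := Module.evalEquiv ℝ (GroupLieAlgebra 𝓘(ℝ, E) G)
  let X' := ev.symm (Complex.reLm ∘ₗ c)
  let Y' := ev.symm (Complex.imLm ∘ₗ c)
  have hX : ∀ L, L X' = (c L).re := fun L => by
    rw [Module.apply_evalEquiv_symm_apply]; rfl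
  have hY : ∀ L, L Y' = (c L).im := fun L => by
    rw [Module.apply_evalEquiv_symm_apply]; rfl
  have key : ∀ t L, c (L ∘ₗ Ad E (ι (torusMap p t))) = mFourier n t * c L := fun t L => by
    refine Eq.trans ?_ (mFourierCoeff_translate (adCoeff ι p X L) n t)
    change mFourierCoeff (adCoeff ι p X _) n = _
    congr 1
    funext s
    simp only [adCoeff, torusMap_add hp, map_mul, Ad_mul, LinearMap.comp_apply]
  refine ⟨X', Y', fun t => ⟨?_, ?_⟩, fun L => ?_⟩
  · refine (Module.forall_dual_apply_eq_zero_iff ℝ _).1 |> fun h => sub_eq_zero.1 (h fun L => ?_)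
    have h1 := hX (L ∘ₗ Ad E (ι (torusMap p t)))
    rw [key, Complex.mul_re, ← hX, ← hY, LinearMap.comp_apply] at h1
    simp [h1]
  · refine (Module.forall_dual_apply_eq_zero_iff ℝ _).1 |> fun h => sub_eq_zero.1 (h fun L => ?_)
    have h1 := hY (L ∘ₗ Ad E (ι (torusMap p t)))
    rw [key, Complex.mul_im, ← hX, ← hY, LinearMap.comp_apply] at h1
    simp [h1]
    ring
  · rw [hX, hY, Complex.re_add_im]
    rfl

/-- The Lie algebra is spanned by the vectors on which the torus acts by rotations. -/
theorem eq_top_of_isRotationPair (hp : IsTorusParam F p)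
    {S : Submodule ℝ (GroupLieAlgebra 𝓘(ℝ, E) G)}
    (hS : ∀ n X Y, IsRotationPair ι p n X Y → X ∈ S ∧ Y ∈ S) : S = ⊤ := by
  rw [Submodule.eq_top_iff']
  intro X
  by_contra hX
  -- L vanishes on `S`, which contains all Fourier pairs of `X`. So L(Ad t X) has zero Fourier
  -- coefficients and vanishes identically, although its value at the unit is L(X) ≠ 0.
  obtain ⟨L, hL, hLS⟩ := Submodule.exists_dual_map_eq_bot_of_notMem hX inferInstance
  have hL0 : ∀ Y ∈ S, L Y = 0 := fun Y hY => by
    have h1 : L Y ∈ S.map L := Submodule.mem_map_of_mem hY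
    rwa [hLS, Submodule.mem_bot] at h1
  have h2 : ∀ n, mFourierCoeff (adCoeff ι p X L) n = 0 := fun n => by
    obtain ⟨X', Y', hXY, h⟩ := exists_fourierPair (ι := ι) hp X n
    obtain ⟨h3, h4⟩ := hS n X' Y' hXY
    rw [h, hL0 _ h3, hL0 _ h4]
    simp
  have h3 := eq_zero_of_mFourierCoeff (continuous_adCoeff hp X L) h2 0
  rw [adCoeff, torusMap_zero hp, map_one, Ad_one, Complex.ofReal_eq_zero] at h3
  exact hL h3

omit [FiniteDimensional ℝ E] [LieGroup 𝓘(ℝ, E) ∞ G] in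
theorem IsRotationPair.mem_rootSpace {n : Fin r → ℤ} (hp : IsTorusParam F p)
    {X Y : GroupLieAlgebra 𝓘(ℝ, E) G} (h : IsRotationPair ι p n X Y) :
    (1 : ℂ) ⊗ₜ[ℝ] X + Complex.I ⊗ₜ[ℝ] Y ∈ rootSpace ι (torusWeight hp n) := by
  rw [rootSpace, Submodule.mem_iInf]
  intro t
  obtain ⟨t, rfl⟩ := surjective_torusMap hp t
  obtain ⟨h1, h2⟩ := h t
  rw [Module.End.mem_eigenspace_iff, map_add, LinearMap.baseChange_tmul,
    LinearMap.baseChange_tmul, h1, h2, coe_torusWeight_torusMap]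
  generalize mFourier n t = z
  have hz : z • (1 : ℂ) = z.re • (1 : ℂ) + z.im • Complex.I := by
    simp [Complex.re_add_im]
  have hz' : z • Complex.I = z.re • Complex.I - z.im • (1 : ℂ) := by
    apply Complex.ext <;> simp
  rw [smul_add, TensorProduct.smul_tmul', TensorProduct.smul_tmul', hz, hz',
    TensorProduct.add_tmul, TensorProduct.sub_tmul, TensorProduct.tmul_add, TensorProduct.tmul_sub]
  simp only [TensorProduct.tmul_smul, ← TensorProduct.smul_tmul']
  abel

omit [LieGroup 𝓘(ℝ, E) ∞ G] in
theorem eq_zero_of_tmul_add_tmul_eq_zero {X Y : GroupLieAlgebra 𝓘(ℝ, E) G}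
    (h : (1 : ℂ) ⊗ₜ[ℝ] X + Complex.I ⊗ₜ[ℝ] Y = 0) : X = 0 ∧ Y = 0 := by
  have h1 : ∀ L : Module.Dual ℝ (GroupLieAlgebra 𝓘(ℝ, E) G), (L X : ℂ) + L Y * Complex.I = 0 :=
    fun L => by
      have h2 := congrArg (LinearMap.liftBaseChange ℂ (Complex.ofRealCLM.toLinearMap ∘ₗ L)) h
      simpa [mul_comm] using h2
  constructor
  · refine (Module.forall_dual_apply_eq_zero_iff ℝ _).1 fun L => ?_
    simpa using congrArg Complex.re (h1 L)
  · refine (Module.forall_dual_apply_eq_zero_iff ℝ _).1 fun L => ?_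
    simpa using congrArg Complex.im (h1 L)

end RootSpan

/-! ### Unitary representations -/

section Unitary

variable {E : Type*} [NormedAddCommGroup E] [NormedSpace ℝ E]
  {G : Type*} [TopologicalSpace G] [ChartedSpace E G] [Group G]
  {F : Type*} [NormedAddCommGroup F] [NormedSpace ℝ F]
  {T : Type*} [TopologicalSpace T] [ChartedSpace F T] [CommGroup T]
  {ι : LieHom F T E G} {ξ₀ : GroupLieAlgebra 𝓘(ℝ, F) T} {χ : Weight F T}

namespace HighestWeightRep

variable (V : HighestWeightRep ι ξ₀ χ)

/-- The space of a representation. -/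
abbrev Space : Type := EuclideanSpace ℂ (Fin V.n)

/-- A representation as a homomorphism to an algebra of continuous linear maps. -/
def hom : G →* (V.Space →L[ℂ] V.Space) where
  toFun g := LinearMap.toContinuousLinearMap (V.π g)
  map_one' := by rw [map_one]; rfl
  map_mul' g h := by rw [map_mul]; rfl

theorem hom_apply (g : G) (w : V.Space) : V.hom g w = V.π g w := rfl

theorem contMDiff_hom : ContMDiff 𝓘(ℝ, E) 𝓘(ℝ, V.Space →L[ℂ] V.Space) ∞ V.hom := by
  let b := Module.finBasis ℂ V.Space
  let c : ∀ i, V.Space →L[ℂ] ℂ := fun i => LinearMap.toContinuousLinearMap (b.coord i)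
  have h : (V.hom : G → V.Space →L[ℂ] V.Space) = fun g => ∑ i,
      (ContinuousLinearMap.smulRightL ℂ V.Space V.Space (c i)).restrictScalars ℝ (V.π g (b i)) := by
    funext g
    ext1 w
    rw [hom_apply]
    conv_lhs => rw [← b.sum_repr w, map_sum]
    simp only [map_smul]
    simp [c]
  rw [h]
  refine contMDiff_finsetSum fun i _ => ?_
  exact (ContinuousLinearMap.contMDiff _).comp (V.smooth _)

theorem norm_π_apply (g : G) (w : V.Space) : ‖V.π g w‖ = ‖w‖ := by
  have h := V.unitary g w w
  rw [inner_self_eq_norm_sq_to_K, inner_self_eq_norm_sq_to_K] at h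
  have h1 : ‖V.π g w‖ ^ 2 = ‖w‖ ^ 2 := by exact_mod_cast h
  exact (sq_eq_sq₀ (norm_nonneg _) (norm_nonneg _)).1 h1

theorem norm_hom_le (g : G) : ‖V.hom g‖ ≤ 1 :=
  ContinuousLinearMap.opNorm_le_bound _ zero_le_one fun w => by
    rw [hom_apply, norm_π_apply, one_mul]

/-- The representation of the Lie algebra. -/
def dHom (X : GroupLieAlgebra 𝓘(ℝ, E) G) : V.Space →L[ℂ] V.Space :=
  derivOne (V.Space →L[ℂ] V.Space) V.hom X

theorem mdifferentiableAt_hom (g : G) :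
    MDifferentiableAt 𝓘(ℝ, E) 𝓘(ℝ, V.Space →L[ℂ] V.Space) V.hom g :=
  V.contMDiff_hom.mdifferentiable (by simp) g

theorem derivOne_apply (X : GroupLieAlgebra 𝓘(ℝ, E) G) (w : V.Space) :
    derivOne V.Space (fun g => V.π g w) X = V.dHom X w :=
  derivOne_clm_comp (V.mdifferentiableAt_hom 1)
    ((ContinuousLinearMap.apply ℂ V.Space w).restrictScalars ℝ) X

theorem star_hom_mul_hom (g : G) : star (V.hom g) * V.hom g = 1 := by
  rw [ContinuousLinearMap.star_eq_adjoint]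
  ext1 w
  refine ext_inner_left ℂ fun w' => ?_
  change ⟪w', ContinuousLinearMap.adjoint (V.hom g) (V.hom g w)⟫_ℂ = ⟪w', w⟫_ℂ
  rw [ContinuousLinearMap.adjoint_inner_right]
  exact V.unitary g w' w

/-- Differentiate π(g)* π(g) = 1 at the unit. -/
theorem star_dHom (X : GroupLieAlgebra 𝓘(ℝ, E) G) : star (V.dHom X) = -V.dHom X := by
  let s : (V.Space →L[ℂ] V.Space) →L[ℝ] (V.Space →L[ℂ] V.Space) :=
    (starL' ℝ : (V.Space →L[ℂ] V.Space) ≃L[ℝ] (V.Space →L[ℂ] V.Space))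
  have hs : MDifferentiableAt 𝓘(ℝ, E) 𝓘(ℝ, V.Space →L[ℂ] V.Space) (fun g => s (V.hom g)) 1 :=
    s.mdifferentiableAt.comp _ (V.mdifferentiableAt_hom 1)
  have h1 := derivOne_mul hs (V.mdifferentiableAt_hom 1) X
  have h2 : (fun g => s (V.hom g) * V.hom g) = fun _ => (1 : V.Space →L[ℂ] V.Space) := funext V.star_hom_mul_hom
  have h3 : derivOne (E := E) (G := G) (V.Space →L[ℂ] V.Space)
      (fun _ => (1 : V.Space →L[ℂ] V.Space)) X = 0 :=
    congrArg (fun L : E →L[ℝ] (V.Space →L[ℂ] V.Space) => L X)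
      (mfderiv_const (I := 𝓘(ℝ, E)) (I' := 𝓘(ℝ, V.Space →L[ℂ] V.Space)) (x := (1 : G)) (c := (1 : V.Space →L[ℂ] V.Space)))
  rw [h2, h3, derivOne_clm_comp (V.mdifferentiableAt_hom 1), map_one, mul_one] at h1
  have h4 : s 1 = 1 := star_one _
  rw [h4, one_mul] at h1
  exact eq_neg_of_add_eq_zero_left h1.symm

theorem inner_dHom (X : GroupLieAlgebra 𝓘(ℝ, E) G) (w w' : V.Space) :
    ⟪V.dHom X w, w'⟫_ℂ = -⟪w, V.dHom X w'⟫_ℂ := by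
  rw [← ContinuousLinearMap.adjoint_inner_right, ← ContinuousLinearMap.star_eq_adjoint, star_dHom,
    neg_apply, inner_neg_right]

theorem norm_sq_dHom (X : GroupLieAlgebra 𝓘(ℝ, E) G) (w : V.Space) :
    ((‖V.dHom X w‖ ^ 2 : ℝ) : ℂ) = -⟪w, V.dHom X (V.dHom X w)⟫_ℂ := by
  rw [← inner_dHom, inner_self_eq_norm_sq_to_K]
  simp

variable [LieGroup 𝓘(ℝ, E) ∞ G]

theorem dHom_Ad (g : G) (X : GroupLieAlgebra 𝓘(ℝ, E) G) :
    V.dHom (Ad E g X) = V.hom g * V.dHom X * V.hom g⁻¹ :=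
  derivOne_hom_Ad V.contMDiff_hom g X

/-- If `X + iY` annihilates a vector, then its image under `X` is controlled by the commutator of
`X` and `Y`. -/
theorem norm_sq_dHom_le [FiniteDimensional ℝ E] {X Y : GroupLieAlgebra 𝓘(ℝ, E) G} {w : V.Space}
    (h : V.dHom X w + Complex.I • V.dHom Y w = 0) :
    ‖V.dHom X w‖ ^ 2 ≤ ‖w‖ * ‖V.dHom (commTwo X Y) w‖ ∧
      ‖V.dHom Y w‖ ^ 2 ≤ ‖w‖ * ‖V.dHom (commTwo X Y) w‖ := by
  have hx : V.dHom X w = -(Complex.I • V.dHom Y w) := eq_neg_of_add_eq_zero_left h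
  have hy : V.dHom Y w = Complex.I • V.dHom X w := by
    rw [hx, smul_neg, smul_smul, Complex.I_mul_I, neg_one_smul, neg_neg]
  have hn : ‖V.dHom Y w‖ = ‖V.dHom X w‖ := by
    rw [hy, norm_smul, Complex.norm_I, one_mul]
  have h1 : V.dHom (commTwo X Y) w =
      (2 : ℂ) • (V.dHom X (V.dHom Y w) - V.dHom Y (V.dHom X w)) := by
    have h2 := derivOne_hom_commTwo V.contMDiff_hom X Y
    have h3 := congrArg (fun a : V.Space →L[ℂ] V.Space => a w) h2
    refine h3.trans ?_
    rw [two_mul, two_smul]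
    rfl
  have h2 : V.dHom X (V.dHom X w) = -(Complex.I • V.dHom X (V.dHom Y w)) := by
    conv_lhs => rw [hx, map_neg, map_smul]
  have h3 : V.dHom Y (V.dHom Y w) = Complex.I • V.dHom Y (V.dHom X w) := by
    conv_lhs => rw [hy, map_smul]
  -- Skew-adjointness and Xw = -iYw give ‖Xw‖² + ‖Yw‖² = i⟨w, [X,Y]w⟩. The two norms agree and
  -- `commTwo` is twice the commutator, whence the factor 4.
  have h4 : ((4 * ‖V.dHom X w‖ ^ 2 : ℝ) : ℂ) = Complex.I * ⟪w, V.dHom (commTwo X Y) w⟫_ℂ := by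
    have h5 := V.norm_sq_dHom X w
    have h6 := V.norm_sq_dHom Y w
    rw [h2, inner_neg_right, inner_smul_right] at h5
    rw [h3, inner_smul_right, hn] at h6
    rw [h1, inner_smul_right, inner_sub_right]
    push_cast at h5 h6 ⊢
    linear_combination 2 * h5 + 2 * h6
  have h5 : 4 * ‖V.dHom X w‖ ^ 2 ≤ ‖w‖ * ‖V.dHom (commTwo X Y) w‖ := by
    have h6 := congrArg norm h4
    rw [Complex.norm_real, Real.norm_of_nonneg (by positivity), norm_mul, Complex.norm_I,
      one_mul] at h6
    rw [h6]
    exact norm_inner_le_norm _ _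
  rw [hn]
  constructor <;> nlinarith [sq_nonneg ‖V.dHom X w‖]

end HighestWeightRep
end Unitary

/-! ### Growth of the representations -/

section Growth

open UnitAddTorus

variable {E : Type*} [NormedAddCommGroup E] [NormedSpace ℝ E] [FiniteDimensional ℝ E]
  {G : Type*} [TopologicalSpace G] [ChartedSpace E G] [Group G] [LieGroup 𝓘(ℝ, E) ∞ G]
  {F : Type*} [NormedAddCommGroup F] [NormedSpace ℝ F]
  {T : Type*} [TopologicalSpace T] [ChartedSpace F T] [CommGroup T]
  {ι : LieHom F T E G} {ξ₀ : GroupLieAlgebra 𝓘(ℝ, F) T} {r : ℕ} {p : (Fin r → ℝ) → T}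

omit [LieGroup 𝓘(ℝ, E) ∞ G] [FiniteDimensional ℝ E] in
theorem HighestWeightRep.norm_dHom_add_le {χ : Weight F T} (V : HighestWeightRep ι ξ₀ χ)
    (X Y : GroupLieAlgebra 𝓘(ℝ, E) G) (w : V.Space) :
    ‖V.dHom (X + Y) w‖ ≤ ‖V.dHom X w‖ + ‖V.dHom Y w‖ := by
  have h : V.dHom (X + Y) = V.dHom X + V.dHom Y := map_add (derivOne _ _) X Y
  rw [h]
  exact norm_add_le _ _

omit [LieGroup 𝓘(ℝ, E) ∞ G] [FiniteDimensional ℝ E] in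
theorem HighestWeightRep.dHom_smul {χ : Weight F T} (V : HighestWeightRep ι ξ₀ χ)
    (c : ℝ) (X : GroupLieAlgebra 𝓘(ℝ, E) G) : V.dHom (c • X) = c • V.dHom X :=
  map_smul (derivOne _ _) c X

/-- The elements of the Lie algebra whose action on the highest weight vectors grows at most
linearly with the weight. -/
def growthSubmodule (ι : LieHom F T E G) (ξ₀ : GroupLieAlgebra 𝓘(ℝ, F) T)
    (hp : IsTorusParam F p) : Submodule ℝ (GroupLieAlgebra 𝓘(ℝ, E) G) where
  carrier := {X | ∃ C : ℝ, 0 ≤ C ∧ ∀ (χ : Weight F T) (V : HighestWeightRep ι ξ₀ χ),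
    ‖V.dHom X V.v‖ ≤ C * (1 + ‖weightCoord hp χ‖)}
  add_mem' := by
    rintro X Y ⟨C, hC, hX⟩ ⟨C', hC', hY⟩
    refine ⟨C + C', by positivity, fun χ V => (V.norm_dHom_add_le X Y V.v).trans ?_⟩
    rw [add_mul]
    exact add_le_add (hX χ V) (hY χ V)
  zero_mem' := ⟨0, le_rfl, fun χ V => by
    have h : V.dHom 0 = 0 := map_zero (derivOne _ _)
    simp [h]⟩
  smul_mem' := by
    rintro c X ⟨C, hC, hX⟩
    refine ⟨|c| * C, by positivity, fun χ V => ?_⟩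
    rw [V.dHom_smul, smul_apply, norm_smul, mul_assoc, Real.norm_eq_abs]
    exact mul_le_mul_of_nonneg_left (hX χ V) (abs_nonneg c)

variable [T2Space G] (hp : IsTorusParam F p) (hι : IsMaximalTorus ι)
include hι

theorem mem_growthSubmodule_of_Ad_eq {Z : GroupLieAlgebra 𝓘(ℝ, E) G}
    (hZ : ∀ t, Ad E (ι t) Z = Z) : Z ∈ growthSubmodule ι ξ₀ hp := by
  obtain ⟨a, ha⟩ := hι.exists_derivOne_eq_smul hp hZ
  refine ⟨∑ j, ‖a j‖, by positivity, fun χ V => ?_⟩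
  rw [← V.derivOne_apply, ha _ V.v χ ((V.smooth V.v).mdifferentiable (by simp) 1) V.weight_v,
    norm_smul, V.norm_v, mul_one, Finset.sum_mul]
  refine (norm_sum_le _ _).trans (Finset.sum_le_sum fun j _ => ?_)
  rw [norm_mul, mul_comm]
  refine mul_le_mul_of_nonneg_left ?_ (norm_nonneg _)
  rw [Complex.norm_intCast, ← Int.norm_eq_abs]
  exact (norm_le_pi_norm (weightCoord hp χ) j).trans (le_add_of_nonneg_left zero_le_one)

/-- X + iY is a root vector of a positive root and annihilates the highest weight vector. So the
squared norms are controlled by the commutator, which is fixed by the torus and thus already known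
to grow linearly. -/
theorem IsRotationPair.mem_growthSubmodule_of_mem_posRoots {n : Fin r → ℤ}
    {X Y : GroupLieAlgebra 𝓘(ℝ, E) G} (h : IsRotationPair ι p n X Y)
    (hn : torusWeight hp n ∈ posRoots ι ξ₀) :
    X ∈ growthSubmodule ι ξ₀ hp ∧ Y ∈ growthSubmodule ι ξ₀ hp := by
  have hcomm : ∀ t, Ad E (ι t) (commTwo X Y) = commTwo X Y := fun t => by
    obtain ⟨t, rfl⟩ := surjective_torusMap hp t
    obtain ⟨h1, h2⟩ := h t
    rw [Ad_commTwo, h1, h2]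
    refine commTwo_rotation ?_ X Y
    have h3 := norm_mFourier_apply n t
    have h4 := Complex.sq_norm (mFourier n t)
    rw [h3, Complex.normSq_apply] at h4
    linarith
  obtain ⟨C, hC, hCV⟩ := mem_growthSubmodule_of_Ad_eq (ξ₀ := ξ₀) hp hι hcomm
  have key : ∀ (χ : Weight F T) (V : HighestWeightRep ι ξ₀ χ),
      ‖V.dHom X V.v‖ ^ 2 ≤ C * (1 + ‖weightCoord hp χ‖) ∧
      ‖V.dHom Y V.v‖ ^ 2 ≤ C * (1 + ‖weightCoord hp χ‖) := fun χ V => by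
    have h1 := V.highest _ hn _ (h.mem_rootSpace hp)
    rw [map_add, LinearMap.liftBaseChange_tmul, LinearMap.liftBaseChange_tmul, V.derivOne_apply,
      V.derivOne_apply, one_smul] at h1
    have h2 := V.norm_sq_dHom_le h1
    rw [V.norm_v, one_mul] at h2
    exact ⟨h2.1.trans (hCV χ V), h2.2.trans (hCV χ V)⟩
  have aux : ∀ a b : ℝ, 0 ≤ b → a ^ 2 ≤ C * (1 + b) → a ≤ (1 + C) * (1 + b) := fun a b hb hab => by
    nlinarith [sq_nonneg (a - 1), mul_nonneg hC hb]
  exact ⟨⟨1 + C, by positivity, fun χ V => aux _ _ (norm_nonneg _) (key χ V).1⟩,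
    ⟨1 + C, by positivity, fun χ V => aux _ _ (norm_nonneg _) (key χ V).2⟩⟩

theorem growthSubmodule_eq_top (hξ₀ : IsRegular ι ξ₀) : growthSubmodule ι ξ₀ hp = ⊤ := by
  refine eq_top_of_isRotationPair (ι := ι) hp fun n X Y h => ?_
  by_cases hn : n = 0
  · subst hn
    have h1 : ∀ t, Ad E (ι t) X = X ∧ Ad E (ι t) Y = Y := fun t => by
      obtain ⟨t, rfl⟩ := surjective_torusMap hp t
      have h2 := h t
      rw [mFourier_zero] at h2
      simpa using h2
    exact ⟨mem_growthSubmodule_of_Ad_eq hp hι fun t => (h1 t).1,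
      mem_growthSubmodule_of_Ad_eq hp hι fun t => (h1 t).2⟩
  have hroot : ∀ (m : Fin r → ℤ) (X' Y' : GroupLieAlgebra 𝓘(ℝ, E) G), m ≠ 0 →
      IsRotationPair ι p m X' Y' → (X' ≠ 0 ∨ Y' ≠ 0) → IsRoot ι (torusWeight hp m) := by
    refine fun m X' Y' hm h hne => ⟨fun h1 => hm ?_, fun h1 => ?_⟩
    · refine mFourier_injective fun t => ?_
      rw [← coe_torusWeight_torusMap hp, h1, mFourier_zero]
      rfl
    · have h2 := h.mem_rootSpace hp
      rw [h1, Submodule.mem_bot] at h2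
      have h3 := eq_zero_of_tmul_add_tmul_eq_zero h2
      exact hne.elim (fun h => h h3.1) fun h => h h3.2
  by_cases hXY : X ≠ 0 ∨ Y ≠ 0
  · have hr := hroot n X Y hn h hXY
    -- Regularity of ξ₀ makes the root or its negative positive. In the second case the pair (X, -Y)
    -- belongs to the negative root and spans the same space.
    rcases lt_or_gt_of_ne (hξ₀ _ hr) with hlt | hgt
    · have hr' := hroot (-n) X (-Y) (neg_ne_zero.2 hn) h.neg (by simpa using hXY)
      obtain ⟨h1, h2⟩ := h.neg.mem_growthSubmodule_of_mem_posRoots hp hι (ξ₀ := ξ₀)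
        ⟨hr', by rw [toDual_torusWeight_neg]; exact neg_pos.2 hlt⟩
      exact ⟨h1, by simpa using h2⟩
    · exact h.mem_growthSubmodule_of_mem_posRoots hp hι ⟨hr, hgt⟩
  · push Not at hXY
    rw [hXY.1, hXY.2]
    exact ⟨Submodule.zero_mem _, Submodule.zero_mem _⟩

end Growth

/-! ### The Casimir operator -/

section Casimir

variable {E : Type*} [NormedAddCommGroup E] [NormedSpace ℝ E] [FiniteDimensional ℝ E]
  {G : Type*} [TopologicalSpace G] [ChartedSpace E G] [Group G]
  {F : Type*} [NormedAddCommGroup F] [NormedSpace ℝ F]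
  {T : Type*} [TopologicalSpace T] [ChartedSpace F T] [CommGroup T]
  {ι : LieHom F T E G} {ξ₀ : GroupLieAlgebra 𝓘(ℝ, F) T}
  {B : LinearMap.BilinForm ℝ (GroupLieAlgebra 𝓘(ℝ, E) G)}

theorem IsInvariantInner.exists_orthonormal (hB : IsInvariantInner B) :
    ∃ (m : ℕ) (b : Fin m → GroupLieAlgebra 𝓘(ℝ, E) G),
      (∀ i j, B (b i) (b j) = if i = j then 1 else 0) ∧ ∀ X, X = ∑ i, B (b i) X • b i := by
  have : Invertible (2 : ℝ) := invertibleOfNonzero two_ne_zero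
  obtain ⟨b, hb⟩ := LinearMap.BilinForm.exists_orthogonal_basis (B := B) ⟨hB.symm⟩
  have hpos : ∀ i, 0 < B (b i) (b i) := fun i => hB.pos _ (b.ne_zero i)
  have hne : ∀ i, √(B (b i) (b i)) ≠ 0 := fun i => (Real.sqrt_pos.2 (hpos i)).ne'
  have horth : ∀ i j, B (b i) (b j) = if i = j then B (b i) (b i) else 0 := fun i j => by
    split_ifs with h
    · rw [h]
    · exact hb h
  refine ⟨_, fun i => (√(B (b i) (b i)))⁻¹ • b i, fun i j => ?_, fun X => ?_⟩
  · simp only [map_smul, LinearMap.smul_apply, smul_eq_mul, horth i j]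
    split_ifs with h
    · subst h
      have h1 := Real.mul_self_sqrt (hpos i).le
      field_simp
      rw [sq, h1]
      exact div_self (hpos i).ne'
    · simp
  · conv_lhs => rw [← b.sum_repr X]
    refine Finset.sum_congr rfl fun i _ => ?_
    have h1 : B (b i) X = b.repr X i * B (b i) (b i) := by
      conv_lhs => rw [← b.sum_repr X, map_sum]
      rw [Finset.sum_eq_single i (fun j _ hj => by rw [map_smul, horth, if_neg hj.symm, smul_zero])
        (by simp), map_smul, smul_eq_mul]
    have h2 := Real.mul_self_sqrt (hpos i).le
    rw [map_smul, LinearMap.smul_apply, h1, smul_smul, smul_eq_mul]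
    congr 1
    have := hne i
    field_simp
    rw [sq, h2]

omit [FiniteDimensional ℝ E] in
/-- The trace of a bilinear map does not depend on the orthonormal basis. -/
theorem IsInvariantInner.sum_apply_eq_sum_apply (hB : IsInvariantInner B) {m : ℕ}
    {b c : Fin m → GroupLieAlgebra 𝓘(ℝ, E) G}
    (hb : ∀ i j, B (b i) (b j) = if i = j then 1 else 0) (hb' : ∀ X, X = ∑ i, B (b i) X • b i)
    (hc : ∀ X, X = ∑ i, B (c i) X • c i) {A : Type*} [AddCommGroup A] [Module ℝ A]
    (φ : GroupLieAlgebra 𝓘(ℝ, E) G →ₗ[ℝ] GroupLieAlgebra 𝓘(ℝ, E) G →ₗ[ℝ] A) :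
    ∑ i, φ (c i) (c i) = ∑ i, φ (b i) (b i) := by
  have h1 : ∀ i, φ (c i) (c i) =
      ∑ j, ∑ k, (B (b j) (c i) * B (b k) (c i)) • φ (b j) (b k) := fun i => by
    conv_lhs => rw [hb' (c i)]
    simp only [map_sum, map_smul, LinearMap.sum_apply, LinearMap.smul_apply, Finset.smul_sum,
      smul_smul]
    rw [Finset.sum_comm]
    refine Finset.sum_congr rfl fun j _ => Finset.sum_congr rfl fun k _ => ?_
    congr 1
    ring
  have h2 : ∀ j k, ∑ i, B (b j) (c i) * B (b k) (c i) = if j = k then 1 else 0 := fun j k => by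
    rw [← hb j k]
    conv_rhs => rw [hc (b j)]
    simp only [map_sum, map_smul, LinearMap.sum_apply, LinearMap.smul_apply, smul_eq_mul]
    exact Finset.sum_congr rfl fun i _ => by rw [hB.symm (b j), hB.symm (b k)]
  simp only [h1]
  rw [Finset.sum_comm]
  refine Finset.sum_congr rfl fun j _ => ?_
  rw [Finset.sum_comm]
  simp only [← Finset.sum_smul, h2]
  simp

variable [LieGroup 𝓘(ℝ, E) ∞ G]

omit [FiniteDimensional ℝ E] in
theorem HighestWeightRep.sum_dHom_sq_comm {χ : Weight F T} (V : HighestWeightRep ι ξ₀ χ)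
    (hB : IsInvariantInner B) {m : ℕ} {b : Fin m → GroupLieAlgebra 𝓘(ℝ, E) G}
    (hb : ∀ i j, B (b i) (b j) = if i = j then 1 else 0) (hb' : ∀ X, X = ∑ i, B (b i) X • b i)
    (g : G) : V.hom g * (∑ i, V.dHom (b i) * V.dHom (b i)) =
      (∑ i, V.dHom (b i) * V.dHom (b i)) * V.hom g := by
  -- Invariance of B makes Ad g b_i another orthonormal basis. The Casimir sum does not depend on
  -- the basis, while the change of basis conjugates it by π(g).
  have hc : ∀ X, X = ∑ i, B (Ad E g (b i)) X • Ad E g (b i) := fun X => by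
    have h := congrArg (Ad E g) (hb' (Ad E g⁻¹ X))
    rw [Ad_Ad_inv, map_sum] at h
    conv_lhs => rw [h]
    refine Finset.sum_congr rfl fun i _ => ?_
    rw [map_smul, ← hB.invariant g, Ad_Ad_inv]
  let D := derivOne (E := E) (G := G) (V.Space →L[ℂ] V.Space) V.hom
  have h1 := hB.sum_apply_eq_sum_apply hb hb' hc
    ((LinearMap.mul ℝ (V.Space →L[ℂ] V.Space)).compl₁₂ D D)
  replace h1 : ∑ i, V.dHom (Ad E g (b i)) * V.dHom (Ad E g (b i)) =
    ∑ i, V.dHom (b i) * V.dHom (b i) := h1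
  rw [← h1, Finset.sum_mul]
  conv_lhs => rw [h1, Finset.mul_sum]
  refine Finset.sum_congr rfl fun i _ => ?_
  have h2 : V.hom g⁻¹ * V.hom g = 1 := by rw [← map_mul, inv_mul_cancel, map_one]
  rw [V.dHom_Ad]
  calc V.hom g * (V.dHom (b i) * V.dHom (b i))
      = V.hom g * V.dHom (b i) * 1 * V.dHom (b i) * 1 := by noncomm_ring
    _ = _ := by
      conv_lhs => rw [← h2]
      noncomm_ring

omit [FiniteDimensional ℝ E] in
/-- The Casimir operator is a scalar. -/
theorem HighestWeightRep.sum_norm_sq_dHom {χ : Weight F T} (V : HighestWeightRep ι ξ₀ χ)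
    (hB : IsInvariantInner B) {m : ℕ} {b : Fin m → GroupLieAlgebra 𝓘(ℝ, E) G}
    (hb : ∀ i j, B (b i) (b j) = if i = j then 1 else 0) (hb' : ∀ X, X = ∑ i, B (b i) X • b i)
    (w : V.Space) :
    ∑ i, ‖V.dHom (b i) w‖ ^ 2 = (∑ i, ‖V.dHom (b i) V.v‖ ^ 2) * ‖w‖ ^ 2 := by
  have := V.irreducible
  let P : V.Space →L[ℂ] V.Space := ∑ i, V.dHom (b i) * V.dHom (b i)
  let f : V.π.IntertwiningMap V.π :=
    { toLinearMap := P
      isIntertwining' := fun g => LinearMap.ext fun w =>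
        (congrArg (fun a : V.Space →L[ℂ] V.Space => a w) (V.sum_dHom_sq_comm hB hb hb' g)).symm }
  -- Schur's lemma. Pairing the scalar operator with w gives -c‖w‖², and the unit vector `V.v`
  -- identifies -c.
  obtain ⟨c, hc⟩ :=
    (Representation.IsIrreducible.algebraMap_intertwiningMap_bijective_of_isAlgClosed
      (ρ := V.π)).2 f
  have hP : ∀ w, P w = c • w := fun w => by
    have h := congrArg (fun f : V.π.IntertwiningMap V.π => f w) hc
    exact h.symm
  have h1 : ∀ w : V.Space, ((∑ i, ‖V.dHom (b i) w‖ ^ 2 : ℝ) : ℂ) = -c * ‖w‖ ^ 2 := fun w => by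
    rw [Complex.ofReal_sum, Finset.sum_congr rfl fun i _ => V.norm_sq_dHom (b i) w,
      Finset.sum_neg_distrib, ← inner_sum]
    have h2 : ∑ i, V.dHom (b i) (V.dHom (b i) w) = P w := by
      simp only [P, sum_apply]
      rfl
    rw [h2, hP, inner_smul_right, inner_self_eq_norm_sq_to_K]
    simp
  have h2 := h1 V.v
  have h3 := h1 w
  rw [V.norm_v] at h2
  have h4 : ((∑ i, ‖V.dHom (b i) w‖ ^ 2 : ℝ) : ℂ) =
      (((∑ i, ‖V.dHom (b i) V.v‖ ^ 2) * ‖w‖ ^ 2 : ℝ) : ℂ) := by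
    rw [Complex.ofReal_mul, h2, h3]
    simp
  exact_mod_cast h4

variable [T2Space G] {r : ℕ} {p : (Fin r → ℝ) → T}

/-- The derivatives of the highest weight representations grow at most linearly. -/
theorem exists_norm_derivHom_le (hp : IsTorusParam F p) (hι : IsMaximalTorus ι)
    (hB : IsInvariantInner B) (hξ₀ : IsRegular ι ξ₀) :
    ∃ C : ℝ, 0 ≤ C ∧ ∀ (χ : Weight F T) (V : HighestWeightRep ι ξ₀ χ),
      ‖derivHom (E := E) V.hom‖ ≤ C * (1 + ‖weightCoord hp χ‖) := by
  obtain ⟨m, b, hb, hb'⟩ := hB.exists_orthonormal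
  have h1 : ∀ i, ∃ C : ℝ, 0 ≤ C ∧ ∀ (χ : Weight F T) (V : HighestWeightRep ι ξ₀ χ),
      ‖V.dHom (b i) V.v‖ ≤ C * (1 + ‖weightCoord hp χ‖) := fun i => by
    have h : b i ∈ growthSubmodule ι ξ₀ hp := by
      rw [growthSubmodule_eq_top hp hι hξ₀]
      exact Submodule.mem_top
    exact h
  choose C hC hCV using h1
  have h2 : ∀ i, ∃ K : ℝ, 0 ≤ K ∧ ∀ X : E, |B (b i) X| ≤ K * ‖X‖ := fun i => by
    let ℓ : E →ₗ[ℝ] ℝ := B (b i)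
    exact ⟨‖LinearMap.toContinuousLinearMap ℓ‖, norm_nonneg _,
      (LinearMap.toContinuousLinearMap ℓ).le_opNorm⟩
  choose K hK hKX using h2
  refine ⟨(∑ i, K i) * ∑ i, C i, mul_nonneg (Finset.sum_nonneg fun i _ => hK i)
    (Finset.sum_nonneg fun i _ => hC i), fun χ V => ?_⟩
  set N := 1 + ‖weightCoord hp χ‖
  have hN : 0 ≤ N := by positivity
  have hS : 0 ≤ (∑ i, C i) * N := mul_nonneg (Finset.sum_nonneg fun i _ => hC i) hN
  have h3 : ∑ i, ‖V.dHom (b i) V.v‖ ^ 2 ≤ ((∑ i, C i) * N) ^ 2 := by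
    refine (Finset.sum_sq_le_sq_sum_of_nonneg fun i _ => norm_nonneg _).trans ?_
    refine pow_le_pow_left₀ (Finset.sum_nonneg fun i _ => norm_nonneg _) ?_ 2
    rw [Finset.sum_mul]
    exact Finset.sum_le_sum fun i _ => hCV i χ V
  -- The Casimir identity carries the bound on the highest weight vector over to every vector, hence
  -- to the operator norm.
  have h4 : ∀ i, ‖V.dHom (b i)‖ ≤ (∑ i, C i) * N := fun i => by
    refine ContinuousLinearMap.opNorm_le_bound _ hS fun w => ?_
    refine abs_le_of_sq_le_sq' ?_ (by positivity) |>.2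
    have h5 := Finset.single_le_sum (f := fun i => ‖V.dHom (b i) w‖ ^ 2)
      (fun i _ => sq_nonneg _) (Finset.mem_univ i)
    refine h5.trans ?_
    rw [V.sum_norm_sq_dHom hB hb hb', mul_pow]
    exact mul_le_mul_of_nonneg_right h3 (sq_nonneg _)
  refine ContinuousLinearMap.opNorm_le_bound _
    (mul_nonneg (mul_nonneg (Finset.sum_nonneg fun i _ => hK i)
      (Finset.sum_nonneg fun i _ => hC i)) hN) fun X => ?_
  have h5 : derivHom (E := E) V.hom X = ∑ i, B (b i) X • V.dHom (b i) := by
    have h6 := congrArg (derivOne (V.Space →L[ℂ] V.Space) V.hom) (hb' X)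
    rw [map_sum] at h6
    refine h6.trans (Finset.sum_congr rfl fun i _ => ?_)
    rw [map_smul]
    rfl
  rw [h5]
  refine (norm_sum_le _ _).trans ?_
  have h7 : (∑ i, K i) * (∑ i, C i) * N * ‖X‖ = ∑ i, K i * ‖X‖ * ((∑ i, C i) * N) := by
    rw [← Finset.sum_mul, ← Finset.sum_mul]
    ring
  rw [h7]
  refine Finset.sum_le_sum fun i _ => ?_
  rw [norm_smul, Real.norm_eq_abs]
  exact mul_le_mul (hKX i X) (h4 i) (norm_nonneg _) (mul_nonneg (hK i) (norm_nonneg _))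

end Casimir

/-! ### Fourier series in `C^∞(T)` -/

section TorusSeries

open UnitAddTorus

variable {F : Type*} [NormedAddCommGroup F] [NormedSpace ℝ F] [FiniteDimensional ℝ F]
  {T : Type*} [TopologicalSpace T] [ChartedSpace F T] [CommGroup T] [LieGroup 𝓘(ℝ, F) ∞ T]
  {r : ℕ} {p : (Fin r → ℝ) → T} (hp : IsTorusParam F p)

theorem one_add_mul_one_add_pow_le {a b : ℝ} (ha : 0 ≤ a) (hb : 0 ≤ b) (k : ℕ) :
    (1 + a * (1 + b)) ^ k ≤ (1 + a) ^ k * (1 + b) ^ k := by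
  rw [← mul_pow]
  refine pow_le_pow_left₀ (by positivity) ?_ k
  nlinarith

/-- A weight as a homomorphism to the complex numbers. -/
def Weight.toComplexHom (χ : Weight F T) : T →* ℂ := Circle.coeHom.comp χ.toMonoidHom

include hp

omit [LieGroup 𝓘(ℝ, F) ∞ T] in
-- The derivative of the local diffeomorphism `p` at 0 is invertible, and its inverse is bounded in
-- finite dimension.
theorem exists_torusTangent_eq : ∃ K : ℝ, 0 ≤ K ∧ ∀ X : F, ∃ y : Fin r → ℝ,
    torusTangent F p y = X ∧ ‖y‖ ≤ K * ‖X‖ := by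
  let e := hp.isLocalDiffeomorph.mfderivToContinuousLinearEquiv (by simp) 0
  let M₀ : F →ₗ[ℝ] (Fin r → ℝ) :=
    { toFun := e.symm
      map_add' := fun X Y => map_add e.symm X Y
      map_smul' := fun c X => map_smul e.symm c X }
  let M := LinearMap.toContinuousLinearMap M₀
  exact ⟨‖M‖, norm_nonneg _, fun X => ⟨M X, e.apply_symm_apply X, M.le_opNorm X⟩⟩

omit [LieGroup 𝓘(ℝ, F) ∞ T] in
theorem exists_norm_derivHom_weight_le : ∃ C : ℝ, 0 ≤ C ∧ ∀ χ : Weight F T,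
    ‖derivHom (E := F) χ.toComplexHom‖ ≤ C * (1 + ‖weightCoord hp χ‖) := by
  obtain ⟨K, hK, h⟩ := exists_torusTangent_eq hp
  refine ⟨2 * Real.pi * (r * K), by positivity, fun χ => ?_⟩
  refine ContinuousLinearMap.opNorm_le_bound _ (by positivity) fun X => ?_
  obtain ⟨y, hyX, hy⟩ := h X
  have h1 : derivHom (E := F) χ.toComplexHom X =
      2 * Real.pi * Complex.I * ∑ i, weightCoord hp χ i * (y i : ℂ) :=
    (congrArg _ hyX.symm).trans (derivOne_weight_torusTangent hp χ y)
  have h2 : ‖∑ i, weightCoord hp χ i * (y i : ℂ)‖ ≤ r * (‖weightCoord hp χ‖ * ‖y‖) := by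
    refine (norm_sum_le _ _).trans ?_
    refine (Finset.sum_le_card_nsmul Finset.univ _ (‖weightCoord hp χ‖ * ‖y‖)
      fun i _ => ?_).trans_eq (by simp)
    rw [norm_mul, Complex.norm_intCast, ← Int.norm_eq_abs, Complex.norm_real]
    exact mul_le_mul (norm_le_pi_norm _ i) (norm_le_pi_norm y i) (norm_nonneg _) (norm_nonneg _)
  rw [h1, norm_mul, norm_mul, norm_mul, Complex.norm_I, mul_one, Complex.norm_real,
    Real.norm_of_nonneg Real.pi_pos.le, Complex.norm_ofNat]
  refine (mul_le_mul_of_nonneg_left h2 (by positivity)).trans ?_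
  have h3 : ‖weightCoord hp χ‖ * ‖y‖ ≤
      (1 + ‖weightCoord hp χ‖) * (K * ‖X‖) :=
    mul_le_mul (by linarith) hy (norm_nonneg _) (by positivity)
  calc 2 * Real.pi * (r * (‖weightCoord hp χ‖ * ‖y‖))
      ≤ 2 * Real.pi * (r * ((1 + ‖weightCoord hp χ‖) * (K * ‖X‖))) := by
        gcongr
    _ = _ := by ring

theorem exists_smoothSeminorms_weight_le (i : SeminormIndex F T) :
    ∃ (C : ℝ) (k : ℕ), ∀ χ : Weight F T,
      smoothSeminorms F T i χ.toSmoothFn ≤ C * (1 + ‖weightCoord hp χ‖) ^ k := by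
  obtain ⟨C, hC, h⟩ := exists_norm_derivHom_weight_le hp
  obtain ⟨C', hC', h'⟩ := exists_smoothSeminorms_matrixCoeff_le (E := F) (G := T) i
  refine ⟨C' * (1 + C) ^ i.2, i.2, fun χ => ?_⟩
  refine (h' χ.toComplexHom _ (ContinuousLinearMap.id ℝ ℂ) χ.toSmoothFn χ.toSmoothFn.contMDiff
    (fun t => (Circle.norm_coe (χ t)).le) (h χ) ContinuousLinearMap.norm_id_le
    fun t => rfl).trans ?_
  rw [mul_assoc]
  exact mul_le_mul_of_nonneg_left (one_add_mul_one_add_pow_le hC (norm_nonneg _) _) hC'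

theorem summable_torusCoeff (φ : SmoothFn F T) : Summable (torusCoeff p φ) := by
  obtain ⟨q, -, hq⟩ := exists_seminorm_torusCoeff_le hp (r + 1)
  refine Summable.of_norm_bounded (summable_one_add_norm_inv_pow.mul_left (q φ)) fun n => ?_
  rw [← div_eq_mul_inv, le_div_iff₀ (by positivity)]
  exact hq φ n

theorem hasSum_torusCoeff_apply (φ : SmoothFn F T) (t : T) :
    HasSum (fun n => torusCoeff p φ n * (torusWeight hp n).toSmoothFn t) (φ t) := by
  obtain ⟨t, rfl⟩ := surjective_torusMap hp t
  have h := hasSum_mFourier_series_apply_of_summable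
    (f := ⟨fun t => φ (torusMap p t), φ.continuous_comp_torusMap hp⟩)
    (summable_torusCoeff hp φ) t
  have h1 : (fun n => torusCoeff p φ n * (torusWeight hp n).toSmoothFn (torusMap p t)) =
      fun n => mFourierCoeff (fun t => φ (torusMap p t)) n • mFourier n t := by
    funext n
    rw [← coe_torusWeight_torusMap hp n t]
    rfl
  rw [h1]
  exact h

/-- The Fourier series of a smooth function converges in `C^∞(T)`. -/
theorem hasSum_torusCoeff_smul (φ : SmoothFn F T) :
    HasSum (fun n => torusCoeff p φ n • (torusWeight hp n).toSmoothFn) φ := by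
  obtain ⟨ψ, hψ⟩ := exists_synthesis hp (D := fun n => (torusWeight hp n).toSmoothFn) fun i => by
    obtain ⟨C, k, h⟩ := exists_smoothSeminorms_weight_le hp i
    refine ⟨C, k, fun n => ?_⟩
    have h1 := h (torusWeight hp n)
    rwa [weightCoord_torusWeight] at h1
  obtain ⟨h1, h2⟩ := hψ φ
  -- Synthesis with the characters gives convergence in C^∞(T) to some function; the pointwise
  -- Fourier series shows that it is φ.
  have h3 : ψ φ = φ := SmoothFn.ext fun t => by
    rw [h2, (hasSum_torusCoeff_apply hp φ t).tsum_eq]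
  rwa [h3] at h1

/-- A distribution on a torus is determined by its Fourier coefficients. -/
theorem dist_ext {w w' : Dist F T} (h : ∀ ν : Weight F T, w ν.toSmoothFn = w' ν.toSmoothFn) :
    w = w' := by
  refine DFunLike.ext _ _ fun φ => ?_
  have h1 := (hasSum_torusCoeff_smul hp φ).map w (map_continuous w)
  have h2 := (hasSum_torusCoeff_smul hp φ).map w' (map_continuous w')
  have h3 : (w ∘ fun n => torusCoeff p φ n • (torusWeight hp n).toSmoothFn) =
      w' ∘ fun n => torusCoeff p φ n • (torusWeight hp n).toSmoothFn := by
    funext n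
    simp only [Function.comp, map_smul, h]
  rw [h3] at h1
  exact h1.unique h2

omit [FiniteDimensional ℝ F] [LieGroup 𝓘(ℝ, F) ∞ T] in
theorem torusCoeff_weight (ν : Weight F T) (n : Fin r → ℤ) :
    torusCoeff p ν.toSmoothFn n = if n = weightCoord hp ν then 1 else 0 := by
  rw [← mFourierCoeff_mFourier, torusCoeff]
  congr 1
  funext t
  exact coe_weight_torusMap hp ν t

end TorusSeries

/-! ### The restriction map -/

section Restriction

variable {E : Type*} [NormedAddCommGroup E] [NormedSpace ℝ E] [FiniteDimensional ℝ E]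
  {G : Type*} [TopologicalSpace G] [ChartedSpace E G] [Group G] [LieGroup 𝓘(ℝ, E) ∞ G] [T2Space G]
  {F : Type*} [NormedAddCommGroup F] [NormedSpace ℝ F] [FiniteDimensional ℝ F]
  {T : Type*} [TopologicalSpace T] [ChartedSpace F T] [CommGroup T] [LieGroup 𝓘(ℝ, F) ∞ T]
  {ι : LieHom F T E G} {ξ₀ : GroupLieAlgebra 𝓘(ℝ, F) T}
  {B : LinearMap.BilinForm ℝ (GroupLieAlgebra 𝓘(ℝ, E) G)}
  {r : ℕ} {p : (Fin r → ℝ) → T}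

omit [FiniteDimensional ℝ F] [LieGroup 𝓘(ℝ, F) ∞ T] in
theorem exists_smoothSeminorms_coeff_le (hp : IsTorusParam F p) (hι : IsMaximalTorus ι)
    (hB : IsInvariantInner B) (hξ₀ : IsRegular ι ξ₀) (i : SeminormIndex E G) :
    ∃ C : ℝ, 0 ≤ C ∧ ∀ (χ : Weight F T) (V : HighestWeightRep ι ξ₀ χ),
      smoothSeminorms E G i V.coeff ≤ C * (1 + ‖weightCoord hp χ‖) ^ i.2 := by
  obtain ⟨C, hC, h⟩ := exists_norm_derivHom_le hp hι hB hξ₀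
  obtain ⟨C', hC', h'⟩ := exists_smoothSeminorms_matrixCoeff_le (E := E) (G := G) i
  refine ⟨C' * (1 + C) ^ i.2, by positivity, fun χ V => ?_⟩
  let ℓ : (V.Space →L[ℂ] V.Space) →L[ℝ] ℂ :=
    ((innerSL ℂ V.v).comp (ContinuousLinearMap.apply ℂ V.Space V.v)).restrictScalars ℝ
  have hℓ : ‖ℓ‖ ≤ 1 := by
    refine ContinuousLinearMap.opNorm_le_bound _ zero_le_one fun a => ?_
    have h1 : ‖⟪V.v, a V.v⟫_ℂ‖ ≤ ‖V.v‖ * ‖a V.v‖ := norm_inner_le_norm _ _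
    have h2 := a.le_opNorm V.v
    rw [V.norm_v] at h1 h2
    rw [one_mul, mul_one] at *
    exact h1.trans h2
  refine (h' V.hom _ ℓ V.coeff V.contMDiff_hom V.norm_hom_le (h χ V) hℓ fun g => rfl).trans ?_
  rw [mul_assoc]
  exact mul_le_mul_of_nonneg_left (one_add_mul_one_add_pow_le hC (norm_nonneg _) _) hC'

omit [FiniteDimensional ℝ F] [LieGroup 𝓘(ℝ, F) ∞ T] in
-- Growth in λ is converted to growth in λ + ρ, the variable of the Fourier series; the shift
-- changes 1 + ‖·‖ by at most a constant factor.
theorem exists_smoothSeminorms_Delta_le (hp : IsTorusParam F p) (hι : IsMaximalTorus ι)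
    (hB : IsInvariantInner B) (hξ₀ : IsRegular ι ξ₀) (V : RepChoice ι ξ₀) (i : SeminormIndex E G) :
    ∃ C : ℝ, 0 ≤ C ∧ ∀ χ ν : Weight F T, IsRhoShift ι ξ₀ χ ν →
      smoothSeminorms E G i (Delta V χ) ≤ C * (1 + ‖weightCoord hp ν‖) ^ i.2 := by
  obtain ⟨C, hC, h⟩ := exists_smoothSeminorms_coeff_le hp hι hB hξ₀ i
  obtain ⟨C', hC', h'⟩ := exists_one_add_norm_weightCoord_le hp (rho ι ξ₀)
  refine ⟨C * C' ^ i.2, by positivity, fun χ ν hν => ?_⟩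
  rw [mul_assoc, ← mul_pow]
  unfold Delta
  split_ifs with hV
  · exact (h χ _).trans (mul_le_mul_of_nonneg_left
      (pow_le_pow_left₀ (by positivity) (h' χ ν hν) _) hC)
  · rw [map_zero]
    positivity

open Classical in
/-- The function `Δ_λ` for the coordinates of `λ + ρ`, and zero at the other lattice points. -/
def deltaOfCoord (hp : IsTorusParam F p) (B : LinearMap.BilinForm ℝ (GroupLieAlgebra 𝓘(ℝ, E) G))
    (V : RepChoice ι ξ₀) (n : Fin r → ℤ) : SmoothFn E G :=
  if h : ∃ χ ν : Weight F T, IsDominant ι B ξ₀ χ ∧ IsRhoShift ι ξ₀ χ ν ∧ weightCoord hp ν = n then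
    Delta V h.choose else 0

omit [FiniteDimensional ℝ E] [FiniteDimensional ℝ F] [T2Space G] [LieGroup 𝓘(ℝ, E) ∞ G]
  [LieGroup 𝓘(ℝ, F) ∞ T] in
theorem deltaOfCoord_eq (hp : IsTorusParam F p) (V : RepChoice ι ξ₀) {χ ν : Weight F T}
    (hχ : IsDominant ι B ξ₀ χ) (hν : IsRhoShift ι ξ₀ χ ν) :
    deltaOfCoord hp B V (weightCoord hp ν) = Delta V χ := by
  have h : ∃ χ' ν' : Weight F T, IsDominant ι B ξ₀ χ' ∧ IsRhoShift ι ξ₀ χ' ν' ∧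
    weightCoord hp ν' = weightCoord hp ν := ⟨χ, ν, hχ, hν, rfl⟩
  rw [deltaOfCoord, dif_pos h]
  obtain ⟨ν', -, h1, h2⟩ := h.choose_spec
  congr 1
  -- The weight λ chosen in the definition is the given one, since ν determines λ = ν - ρ as a
  -- linear form.
  refine toDual_injective hp ?_
  rw [weightCoord_injective hp h2, IsRhoShift, hν] at h1
  exact (add_right_cancel h1).symm

omit [FiniteDimensional ℝ E] [FiniteDimensional ℝ F] [T2Space G] [LieGroup 𝓘(ℝ, E) ∞ G]
  [LieGroup 𝓘(ℝ, F) ∞ T] in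
theorem deltaOfCoord_eq_zero (hp : IsTorusParam F p) (V : RepChoice ι ξ₀) {ν : Weight F T}
    (h : ¬ ∃ χ, IsDominant ι B ξ₀ χ ∧ IsRhoShift ι ξ₀ χ ν) :
    deltaOfCoord hp B V (weightCoord hp ν) = 0 := by
  rw [deltaOfCoord, dif_neg]
  rintro ⟨χ, ν', h1, h2, h3⟩
  rw [weightCoord_injective hp h3] at h2
  exact h ⟨χ, h1, h2⟩

/-- The transpose of the restriction map. -/
theorem exists_transpose (hp : IsTorusParam F p) (hι : IsMaximalTorus ι)
    (hB : IsInvariantInner B) (hξ₀ : IsRegular ι ξ₀) (V : RepChoice ι ξ₀) :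
    ∃ ψ : SmoothFn F T →L[ℂ] SmoothFn E G, ∀ ν : Weight F T,
      ψ ν.toSmoothFn = deltaOfCoord hp B V (weightCoord hp ν) := by
  obtain ⟨ψ, hψ⟩ := exists_synthesis hp (D := deltaOfCoord hp B V) fun i => by
    obtain ⟨C, hC, h⟩ := exists_smoothSeminorms_Delta_le hp hι hB hξ₀ V i
    refine ⟨C, i.2, fun n => ?_⟩
    unfold deltaOfCoord
    split_ifs with hn
    · obtain ⟨ν, -, h1, h2⟩ := hn.choose_spec
      exact (h _ ν h1).trans_eq (by rw [h2])
    · rw [map_zero]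
      positivity
  refine ⟨ψ, fun ν => SmoothFn.ext fun x => ?_⟩
  -- A character has a single nonzero Fourier coefficient, so one term of the series survives.
  rw [(hψ _).2, tsum_eq_single (weightCoord hp ν) fun n hn => by
    rw [torusCoeff_weight hp, if_neg hn, zero_mul], torusCoeff_weight hp, if_pos rfl, one_mul]

omit [FiniteDimensional ℝ E] [T2Space G] in
theorem IsRestriction.unique (hp : IsTorusParam F p) {V : RepChoice ι ξ₀} {u : Dist E G}
    {w w' : hardy ι B ξ₀} (h : IsRestriction B V u w) (h' : IsRestriction B V u w') : w = w' := by
  refine Subtype.ext (dist_ext hp fun ν => ?_)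
  by_cases hν : ∃ χ, IsDominant ι B ξ₀ χ ∧ IsRhoShift ι ξ₀ χ ν
  · obtain ⟨χ, h1, h2⟩ := hν
    rw [h χ ν h1 h2, h' χ ν h1 h2]
  · rw [w.2 ν hν, w'.2 ν hν]

end Restriction

end LieDist

end

/-! ### The restriction map as composition with its transpose. -/

theorem mainTheorem10
    {E : Type*} [NormedAddCommGroup E] [NormedSpace ℝ E] [FiniteDimensional ℝ E]
    {G : Type*} [TopologicalSpace G] [ChartedSpace E G] [Group G] [LieGroup 𝓘(ℝ, E) ∞ G]
    [T2Space G] [CompactSpace G] [ConnectedSpace G]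
    (hG : IsSimplyConnectedTimesTorus G)
    {F : Type*} [NormedAddCommGroup F] [NormedSpace ℝ F] [FiniteDimensional ℝ F]
    {T : Type*} [TopologicalSpace T] [ChartedSpace F T] [CommGroup T] [LieGroup 𝓘(ℝ, F) ∞ T]
    (hT : IsTorus F T)
    (ι : LieHom F T E G) (hι : IsMaximalTorus ι)
    (B : LinearMap.BilinForm ℝ (GroupLieAlgebra 𝓘(ℝ, E) G)) (hB : IsInvariantInner B)
    (ξ₀ : GroupLieAlgebra 𝓘(ℝ, F) T) (hξ₀ : IsRegular ι ξ₀)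
    (V : RepChoice ι ξ₀) :
    (∀ u : Dist E G, ∃! w : hardy ι B ξ₀, IsRestriction B V u w) ∧
      ∀ r : Dist E G → hardy ι B ξ₀, (∀ u, IsRestriction B V u (r u)) →
        IsLinearMap ℂ r ∧ Continuous r := by
  obtain ⟨r, p, h1, h2, h3, h4⟩ := hT
  have hp : IsTorusParam F p := ⟨h1, h2, h3, h4⟩
  obtain ⟨ψ, hψ⟩ := exists_transpose hp hι hB hξ₀ V
  let w : Dist E G → hardy ι B ξ₀ := fun u =>
    ⟨(ContinuousLinearMap.comp u ψ : SmoothFn F T →L[ℂ] ℂ), fun ν hν => by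
      change u (ψ ν.toSmoothFn) = 0
      rw [hψ, deltaOfCoord_eq_zero hp V hν, map_zero]⟩
  have hw : ∀ u, IsRestriction B V u (w u) := fun u χ ν hχ hν => by
    change u (ψ ν.toSmoothFn) = _
    rw [hψ, deltaOfCoord_eq hp V hχ hν]
  refine ⟨fun u => ⟨w u, hw u, fun w' hw' => hw'.unique hp (hw u)⟩, fun r hr => ?_⟩
  -- By uniqueness any such map is u ↦ u ∘ ψ, so linearity and continuity need checking only for
  -- this one.
  have hrw : r = w := funext fun u => (hr u).unique hp (hw u)
  subst hrw
  refine ⟨⟨fun u u' => rfl, fun c u => rfl⟩, ?_⟩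
  -- In the weak topologies it suffices to test on each φ, where the map becomes evaluation of u at
  -- ψ(φ).
  refine Continuous.subtype_mk (WeakDual.continuous_of_continuous_eval fun φ => ?_) _
  exact WeakDual.eval_continuous (ψ φ)
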